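/- Let $d,\nu\ge 1$ and $0\le d_2\le d$ be integers and let $Z=\mathbb R^{d-d_2}\times\mathbb T^{d_2}$, $\mathbb T=\mathbb R/2\pi\mathbb Z$, with dual group $\widehat Z=\mathbb R^{d-d_2}\times\mathbb Z^{d_2}$. Let $\widehat f$ be the Fourier transform of $f\in L^2(Z)$ (unitary, with kernel $e^{-ix\cdot\xi}$), and for $\sigma\in\mathbb R$ put $$\|f\|_{H^\sigma}=\|w_\sigma\widehat f\,\|_{L^2(\widehat Z)},\qquad w_\sigma(\xi)=(1+|\xi|^2)^{\sigma/2}\ \text{ if }\sigma\ge 0,\qquad w_\sigma(\xi)=\min\{1,|\xi|^{\sigma}\}\ \text{ if }\sigma<0$$ (with $w_\sigma(0)=1$); for each $\sigma$ this norm is equivalent to the usual one. Let $H^\infty=\bigcap_\sigma H^\sigma(Z)$. Assume that - $s<-\frac23$ if $d=\nu=1$; - $s<-\frac13$ if $d\ge 2$, $\nu=1$ and $d_2\le 1$; - $s<-\frac1{2\nu+1}$ if $\nu\ge 2$ and $d_2=0$; - $s<0$ in all other cases. Then, for either choice of the sign, norm inflation in $H^s$ with infinite loss of regularity occurs for $$i\partial_tu+\Delta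 u=\pm|u|^{2\nu}u,\qquad u(0)=\phi\qquad\text{on } Z.$$ That is, for every $\delta>0$ there exist $\phi\in H^\infty$ and $T$ with $\|\phi\|_{H^s}<\delta$ and $0<T<\delta$ such that the corresponding smooth solution $u$ exists on $[0,T]$ (there is exactly one solution $u\in C([0,T];H^\infty)$), $\|\widehat u(T)\|_{L^2(\{|\xi|\le 1\})}>\delta^{-1}$, and $$\|u(T)\|_{H^\sigma}>\delta^{-1}\qquad\text{for all }\sigma\in\mathbb R .$$ -/

import Mathlib

open MeasureTheory Set Filter Topology
open scoped ENNReal ContDiff FourierTransform Laplacian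

noncomputable section

/-- The covering space `ℝ^{d₁} × ℝ^{d₂}` of `Z = ℝ^{d₁} × 𝕋^{d₂}`, where `𝕋 = ℝ / 2πℤ`. A function
on `Z` is treated as a function on the covering space that is `2π`-periodic in each of the last
`d₂` variables. -/
abbrev NLSCover (d₁ d₂ : ℕ) : Type := EuclideanSpace ℝ (Fin d₁ ⊕ Fin d₂)

/-- The point with nonperiodic coordinates `x` and periodic coordinates `y`. -/
def NLSCover.mk {d₁ d₂ : ℕ} (x : EuclideanSpace ℝ (Fin d₁)) (y : Fin d₂ → ℝ) : NLSCover d₁ d₂ :=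
  WithLp.toLp 2 (Sum.elim (fun i => x i) y)

/-- `f` is `2π`-periodic in each of the last `d₂` variables, i.e. it is a function on `Z`. -/
def IsPeriodicZ {d₁ d₂ : ℕ} (f : NLSCover d₁ d₂ → ℂ) : Prop :=
  ∀ (j : Fin d₂) (z : NLSCover d₁ d₂),
    f (z + EuclideanSpace.single (Sum.inr j) (2 * Real.pi)) = f z

/-- The fundamental domain `ℝ^{d₁} × (0, 2π]^{d₂}` of `Z`. -/
def fundDomainZ (d₁ d₂ : ℕ) : Set (NLSCover d₁ d₂) :=
  {z | ∀ j : Fin d₂, z (Sum.inr j) ∈ Ioc (0 : ℝ) (2 * Real.pi)}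

/-- The partial Fourier coefficient in the periodic variables,
`x ↦ (2π)^{-d₂/2} ∫_{(0,2π]^{d₂}} f(x,y) e^{-i k·y} dy`, for `k ∈ ℤ^{d₂}`. -/
def periodicCoeff {d₁ d₂ : ℕ} (f : NLSCover d₁ d₂ → ℂ) (k : Fin d₂ → ℤ)
    (x : EuclideanSpace ℝ (Fin d₁)) : ℂ :=
  (((Real.sqrt (2 * Real.pi))⁻¹ ^ d₂ : ℝ) : ℂ) *
    ∫ y in Set.pi univ (fun _ : Fin d₂ => Ioc (0 : ℝ) (2 * Real.pi)),
      f (NLSCover.mk x y) * Complex.exp (-Complex.I * ((∑ j, (k j : ℝ) * y j : ℝ) : ℂ))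

open Classical in
/-- The (unitary) Fourier transform on `Z` of an `L²` function, as a function of the dual variable
`(ξ, k) ∈ ℝ^{d₁} × ℤ^{d₂}`: formally
`f̂(ξ,k) = (2π)^{-(d₁+d₂)/2} ∫_Z f(x,y) e^{-i(x·ξ + y·k)} dx dy`.
In the nonperiodic variables it is the Fourier-Plancherel transform on `L²(ℝ^{d₁})`; Mathlib uses
the kernel `e^{-2πi x·η}`, hence `η = ξ / 2π`. It is only used for `f ∈ L²(Z)`, for which all the
coefficients `periodicCoeff f k` belong to `L²(ℝ^{d₁})`. -/
def fourierZ {d₁ d₂ : ℕ} (f : NLSCover d₁ d₂ → ℂ) (k : Fin d₂ → ℤ)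
    (ξ : EuclideanSpace ℝ (Fin d₁)) : ℂ :=
  if h : MemLp (periodicCoeff f k) 2 (volume : Measure (EuclideanSpace ℝ (Fin d₁))) then
    (((Real.sqrt (2 * Real.pi))⁻¹ ^ d₁ : ℝ) : ℂ) *
      (𝓕 (h.toLp (periodicCoeff f k)) : Lp ℂ 2 (volume : Measure (EuclideanSpace ℝ (Fin d₁))))
        ((2 * Real.pi)⁻¹ • ξ)
  else 0

/-- The length `|(ξ, k)|` of a frequency `(ξ, k) ∈ ℝ^{d₁} × ℤ^{d₂}`. -/
def freqNorm {d₁ d₂ : ℕ} (k : Fin d₂ → ℤ) (ξ : EuclideanSpace ℝ (Fin d₁)) : ℝ :=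
  Real.sqrt (‖ξ‖ ^ 2 + ∑ j, (k j : ℝ) ^ 2)

/-- The Sobolev weight at a frequency of length `r ≥ 0`: `(1 + r²)^{σ/2}` for `σ ≥ 0`, and
`min {1, r^σ}` (equal to `1` at `r = 0`) for `σ < 0`. For each fixed `σ` it is comparable to
`(1 + r²)^{σ/2}`, so that it gives an equivalent norm of `H^σ`. -/
def sobolevWeight (σ r : ℝ) : ℝ :=
  if 0 ≤ σ then (1 + r ^ 2) ^ (σ / 2) else (max 1 r) ^ σ

/-- The norm of `H^σ(Z)`, with values in `[0, ∞]`. -/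
def sobolevNorm {d₁ d₂ : ℕ} (σ : ℝ) (f : NLSCover d₁ d₂ → ℂ) : ℝ≥0∞ :=
  (∑' k : Fin d₂ → ℤ, ∫⁻ ξ : EuclideanSpace ℝ (Fin d₁),
    (ENNReal.ofReal (sobolevWeight σ (freqNorm k ξ)) * ‖fourierZ f k ξ‖ₑ) ^ 2) ^ (1 / 2 : ℝ)

/-- The norm of `f̂` in `L²({|(ξ, k)| ≤ 1})`. -/
def lowFreqNorm {d₁ d₂ : ℕ} (f : NLSCover d₁ d₂ → ℂ) : ℝ≥0∞ :=
  (∑' k : Fin d₂ → ℤ, ∫⁻ ξ in {ξ : EuclideanSpace ℝ (Fin d₁) | freqNorm k ξ ≤ 1},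
    ‖fourierZ f k ξ‖ₑ ^ 2) ^ (1 / 2 : ℝ)

/-- `f ∈ H^∞(Z) = ⋂_σ H^σ(Z)`, where `f` is the smooth representative of its class. -/
structure MemHInfty {d₁ d₂ : ℕ} (f : NLSCover d₁ d₂ → ℂ) : Prop where
  contDiff : ContDiff ℝ ∞ f
  periodic : IsPeriodicZ f
  memLp : MemLp f 2 (volume.restrict (fundDomainZ d₁ d₂))
  sobolevNorm_lt_top : ∀ σ : ℝ, sobolevNorm σ f < ⊤

/-- `u` is a smooth solution on `[0, T]` of
`i ∂ₜu + Δu = ε |u|^{2ν} u` on `Z`, `u(0) = φ`: it belongs to `C([0,T]; H^∞(Z))` and satisfies the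
equation pointwise (with one-sided time derivatives at the end points of `[0, T]`). Smoothness in
time then follows from the equation. Only the values of `u` at times in `[0, T]` matter. -/
structure IsSmoothNLSSolution {d₁ d₂ : ℕ} (ν : ℕ) (ε : ℝ) (T : ℝ) (φ : NLSCover d₁ d₂ → ℂ)
    (u : ℝ → NLSCover d₁ d₂ → ℂ) : Prop where
  memHInfty : ∀ t ∈ Icc 0 T, MemHInfty (u t)
  continuous : ∀ σ : ℝ, ∀ t₀ ∈ Icc 0 T,
    Tendsto (fun t => sobolevNorm σ (u t - u t₀)) (𝓝[Icc 0 T] t₀) (𝓝 0)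
  equation : ∀ t ∈ Icc 0 T, ∀ z : NLSCover d₁ d₂, ∃ v : ℂ,
    HasDerivWithinAt (fun τ => u τ z) v (Icc 0 T) t ∧
      Complex.I * v + (Δ (u t)) z = (ε : ℂ) * (‖u t z‖ : ℂ) ^ (2 * ν) * u t z
  initial : u 0 = φ

/-- The upper bound for the regularity index `s`, for dimension `d`, number `d₂` of periodic
directions and power `2ν + 1` of the nonlinearity. -/
def inflationThreshold (d d₂ ν : ℕ) : ℝ :=
  if d = 1 ∧ ν = 1 then -2 / 3
  else if 2 ≤ d ∧ ν = 1 ∧ d₂ ≤ 1 then -1 / 3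
  else if 2 ≤ ν ∧ d₂ = 0 then -1 / (2 * (ν : ℝ) + 1)
  else 0

end

set_option linter.unusedSectionVars false

/-! The equation is studied on the Fourier side, in the algebra `WeightedL1` of functions on the
dual group that are integrable against e^{a‖ξ‖}. Convolution is bounded there and the free evolution
S(t) is multiplication by a unimodular function. In the interaction representation v(t) = S(-t)û(t)
the equation is therefore an ordinary differential equation with a locally Lipschitz field, solvable
up to time T once T(2M)^{2ν} ≤ 1/2, with M a bound for the data (`WeightedL1.exists_solution`). For
a > 0, bounded elements of the algebra are transforms of functions in H^∞, and the curve v yields a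
smooth solution (`isSmoothNLSSolution_synth`).

The data are sums of finitely many bumps of height B on balls of radius A around frequencies Nκ_i
far from the origin. The κ_i are chosen so that some alternating sum of 2ν+1 of them vanishes,
together with the same sum of the |κ_i|² (`squareConfig`, `lineConfig`). The first nonlinear iterate
then feeds the low frequencies. Up to small errors the phases e^{-iτ|ξ|²} on the bumps are
e^{-iτN²|κ_i|²}. The nonlinearity becomes a trigonometric polynomial in time with nonnegative
coefficient functions. Its integral over a whole number of periods keeps only the zero mode, a sum
of nonnegative terms, so the resonant contribution, of order T B^{2ν+1} A^{2νd}, cannot be cancelled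
(`IsPosTrig.le_re_integral`). The sign in front of the nonlinearity is a unimodular factor and plays
no role.

The errors are measured in L^∞, on which L¹ acts by convolution. The remainder after the first
iterate is of order (T(2M)^{2ν})² B (`dualBound_sub_picard`), and freezing the phases costs
T(2M)^{2ν} B (T + TE), where E is the error in the dispersion relation on the bumps. Since M is of
order B A^d, fixing T(2M)^{2ν} as a small constant makes the resonant term dominate, and û(T) has
size of order B at low frequencies (`le_norm_integral_solution`).

With this choice B is of order T^{-1/(2ν)} A^{-d}. Inflation follows if T, TE, T^{1/(2ν)} A^d and
T^{-1/(2ν)} A^{-d/2} N^s all tend to zero (`hasInfiniteLossInflation_of_tendsto`). For A = N^α/2 and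
T ~ N^{-t} these are linear inequalities in α and t. In general E is of order N^{1+α}, which
produces a negative threshold. In periodic directions balls of radius 1/2 contain a single lattice
coordinate, E stays bounded, and every s < 0 is allowed. For the one-dimensional cubic equation the
squares are not made resonant; instead T N² → 0, so that the phases do not turn at all.

All Sobolev norms blow up together because every weight is at least 1 where |ξ| ≤ 1. Uniqueness
holds because Fourier inversion (`synth_invSynth`) turns any smooth solution into a solution of the
same ordinary differential equation in unweighted L¹ (`IsSmoothNLSSolution.exists_interaction`). -/

noncomputable section

/-! ### The convolution algebra of exponentially weighted L¹ functions. -/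

section WeightedConvolution

open scoped NNReal ComplexConjugate

variable {G : Type*} [NormedAddCommGroup G] [MeasurableSpace G] [BorelSpace G]
  [SecondCountableTopology G] {μ : Measure G}

/-- The submultiplicative weight `e^{a‖ξ‖}`. -/
def expWeight (a : ℝ≥0) (ξ : G) : ℝ≥0∞ := ENNReal.ofReal (Real.exp (a * ‖ξ‖))

lemma one_le_expWeight (a : ℝ≥0) (ξ : G) : 1 ≤ expWeight a ξ := by
  rw [expWeight, ← ENNReal.ofReal_one]
  exact ENNReal.ofReal_le_ofReal (Real.one_le_exp (by positivity))

lemma measurable_expWeight (a : ℝ≥0) : Measurable (expWeight a : G → ℝ≥0∞) := by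
  unfold expWeight
  fun_prop

lemma expWeight_ne_zero (a : ℝ≥0) (ξ : G) : expWeight a ξ ≠ 0 :=
  (zero_lt_one.trans_le (one_le_expWeight a ξ)).ne'

lemma expWeight_ne_top (a : ℝ≥0) (ξ : G) : expWeight a ξ ≠ ⊤ := ENNReal.ofReal_ne_top

lemma expWeight_neg (a : ℝ≥0) (ξ : G) : expWeight a (-ξ) = expWeight a ξ := by
  simp [expWeight]

/-- The triangle inequality in exponential form; it is what makes the weighted space a convolution
algebra. -/
lemma expWeight_le_mul (a : ℝ≥0) (ξ η : G) :
    expWeight a ξ ≤ expWeight a η * expWeight a (ξ - η) := by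
  rw [expWeight, expWeight, expWeight, ← ENNReal.ofReal_mul (Real.exp_nonneg _), ← Real.exp_add,
    ← mul_add]
  refine ENNReal.ofReal_le_ofReal (Real.exp_le_exp.2 ?_)
  gcongr
  calc ‖ξ‖ = ‖η + (ξ - η)‖ := by rw [add_sub_cancel]
    _ ≤ _ := norm_add_le _ _

/-- The measure `e^{a‖ξ‖} dμ(ξ)`. -/
def expMeasure (μ : Measure G) (a : ℝ≥0) : Measure G := μ.withDensity (expWeight a)

lemma expMeasure_zero : expMeasure μ 0 = μ := by
  have : (expWeight 0 : G → ℝ≥0∞) = 1 := by ext ξ; simp [expWeight]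
  rw [expMeasure, this, withDensity_one]

lemma expMeasure_ac (a : ℝ≥0) : expMeasure μ a ≪ μ := withDensity_absolutelyContinuous _ _

lemma ac_expMeasure (a : ℝ≥0) : μ ≪ expMeasure μ a :=
  withDensity_absolutelyContinuous' (measurable_expWeight a).aemeasurable
    (Eventually.of_forall (expWeight_ne_zero a))

lemma lintegral_expMeasure (a : ℝ≥0) (f : G → ℝ≥0∞) :
    ∫⁻ ξ, f ξ ∂(expMeasure μ a) = ∫⁻ ξ, expWeight a ξ * f ξ ∂μ := by
  rw [expMeasure, lintegral_withDensity_eq_lintegral_mul_non_measurable _ (measurable_expWeight a)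
    (Eventually.of_forall fun ξ => (expWeight_ne_top a ξ).lt_top)]
  rfl

/-- The density vanishes nowhere, so both measures have the same null sets; this allows almost
everywhere statements to refer to `μ` for every `a`. -/
lemma ae_expMeasure_iff (a : ℝ≥0) {p : G → Prop} :
    (∀ᵐ ξ ∂(expMeasure μ a), p ξ) ↔ ∀ᵐ ξ ∂μ, p ξ :=
  ⟨fun h => (ac_expMeasure a).ae_le h, fun h => (expMeasure_ac a).ae_le h⟩

lemma aestronglyMeasurable_expMeasure_iff (a : ℝ≥0) {f : G → ℂ} :
    AEStronglyMeasurable f (expMeasure μ a) ↔ AEStronglyMeasurable f μ :=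
  ⟨fun h => h.mono_ac (ac_expMeasure a), fun h => h.mono_ac (expMeasure_ac a)⟩

lemma integrable_expMeasure_iff (a : ℝ≥0) {f : G → ℂ} :
    Integrable f (expMeasure μ a) ↔
      AEStronglyMeasurable f μ ∧ ∫⁻ ξ, expWeight a ξ * ‖f ξ‖ₑ ∂μ < ⊤ := by
  rw [Integrable, aestronglyMeasurable_expMeasure_iff, hasFiniteIntegral_iff_enorm,
    lintegral_expMeasure]

lemma MeasureTheory.Integrable.of_expMeasure {a : ℝ≥0} {f : G → ℂ}
    (hf : Integrable f (expMeasure μ a)) : Integrable f μ := by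
  rw [integrable_expMeasure_iff] at hf
  refine ⟨hf.1, lt_of_le_of_lt (lintegral_mono fun ξ => ?_) hf.2⟩
  exact le_mul_of_one_le_left' (one_le_expWeight a ξ)

variable (μ) in
/-- Functions `f` with `∫ |f| e^{a‖ξ‖} dμ < ∞`. -/
abbrev WeightedL1 (a : ℝ≥0) : Type _ := Lp ℂ 1 (expMeasure μ a)

namespace WeightedL1

variable {a : ℝ≥0}

lemma integrable_exp (f : WeightedL1 μ a) : Integrable f (expMeasure μ a) := L1.integrable_coeFn f

lemma integrable (f : WeightedL1 μ a) : Integrable f μ := (integrable_exp f).of_expMeasure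

lemma aesm (f : WeightedL1 μ a) : AEStronglyMeasurable f μ := (integrable f).1

lemma ext_ae {f g : WeightedL1 μ a} (h : f =ᵐ[μ] g) : f = g :=
  Lp.ext ((ae_expMeasure_iff a).2 h)

lemma coe_toL1 {f : G → ℂ} (hf : Integrable f (expMeasure μ a)) :
    (hf.toL1 f : G → ℂ) =ᵐ[μ] f := (ae_expMeasure_iff a).1 hf.coeFn_toL1

lemma coe_add (f g : WeightedL1 μ a) : (↑(f + g) : G → ℂ) =ᵐ[μ] f + g :=
  (ae_expMeasure_iff a).1 (Lp.coeFn_add f g)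

lemma coe_sub (f g : WeightedL1 μ a) : (↑(f - g) : G → ℂ) =ᵐ[μ] f - g :=
  (ae_expMeasure_iff a).1 (Lp.coeFn_sub f g)

lemma coe_smul (c : ℂ) (f : WeightedL1 μ a) : (↑(c • f) : G → ℂ) =ᵐ[μ] c • (f : G → ℂ) :=
  (ae_expMeasure_iff a).1 (Lp.coeFn_smul c f)

lemma enorm_eq (f : WeightedL1 μ a) : ‖f‖ₑ = ∫⁻ ξ, expWeight a ξ * ‖f ξ‖ₑ ∂μ := by
  rw [Lp.enorm_def, eLpNorm_one_eq_lintegral_enorm, lintegral_expMeasure]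

lemma enorm_toL1 {f : G → ℂ} (hf : Integrable f (expMeasure μ a)) :
    ‖hf.toL1 f‖ₑ = ∫⁻ ξ, expWeight a ξ * ‖f ξ‖ₑ ∂μ := by
  rw [enorm_eq]
  refine lintegral_congr_ae ?_
  filter_upwards [coe_toL1 hf] with ξ h
  rw [h]

/-- The pairing `f ↦ ∫ h f dμ` with a function of growth at most `e^{a‖ξ‖}`. -/
lemma enorm_integral_mul_le {h : G → ℂ} {C : ℝ≥0}
    (hb : ∀ ξ, ‖h ξ‖ₑ ≤ C * expWeight a ξ) (f : WeightedL1 μ a) :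
    ‖∫ ξ, h ξ * f ξ ∂μ‖ₑ ≤ C * ‖f‖ₑ := by
  refine (enorm_integral_le_lintegral_enorm _).trans ?_
  rw [enorm_eq, ← lintegral_const_mul' _ _ ENNReal.coe_ne_top]
  refine lintegral_mono fun ξ => ?_
  rw [enorm_mul, ← mul_assoc]
  gcongr
  exact hb ξ

lemma integrable_mul {h : G → ℂ} (hm : Measurable h) {C : ℝ≥0}
    (hb : ∀ ξ, ‖h ξ‖ₑ ≤ C * expWeight a ξ) (f : WeightedL1 μ a) :
    Integrable (fun ξ => h ξ * f ξ) μ := by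
  refine ⟨hm.aestronglyMeasurable.mul f.aesm, ?_⟩
  rw [hasFiniteIntegral_iff_enorm]
  have h1 : ∫⁻ ξ, ‖h ξ * f ξ‖ₑ ∂μ ≤ C * ‖f‖ₑ := by
    rw [enorm_eq, ← lintegral_const_mul' _ _ ENNReal.coe_ne_top]
    refine lintegral_mono fun ξ => ?_
    rw [enorm_mul, ← mul_assoc]
    gcongr
    exact hb ξ
  exact h1.trans_lt (ENNReal.mul_lt_top ENNReal.coe_lt_top enorm_lt_top)

variable (μ a) in
/-- The functional `f ↦ ∫ h f dμ`, for a measurable `h` with `|h| ≤ C e^{a‖ξ‖}`. -/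
def pairing (h : G → ℂ) (hm : Measurable h) (C : ℝ≥0)
    (hb : ∀ ξ, ‖h ξ‖ₑ ≤ C * expWeight a ξ) : WeightedL1 μ a →L[ℂ] ℂ :=
  LinearMap.mkContinuous
    { toFun := fun f => ∫ ξ, h ξ * f ξ ∂μ
      map_add' := fun f g => by
        rw [← integral_add (integrable_mul hm hb f) (integrable_mul hm hb g)]
        refine integral_congr_ae ?_
        filter_upwards [coe_add f g] with ξ h1
        rw [h1, Pi.add_apply, mul_add]
      map_smul' := fun c f => by
        rw [RingHom.id_apply, smul_eq_mul, ← integral_const_mul]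
        refine integral_congr_ae ?_
        filter_upwards [coe_smul c f] with ξ h1
        rw [h1, Pi.smul_apply, smul_eq_mul]; ring } C (fun f => by
    have := enorm_integral_mul_le hb f
    rw [← ofReal_norm, ← ofReal_norm, ← ENNReal.ofReal_coe_nnreal,
      ← ENNReal.ofReal_mul C.coe_nonneg] at this
    exact (ENNReal.ofReal_le_ofReal_iff (by positivity)).1 this)

lemma pairing_apply (h : G → ℂ) (hm : Measurable h) (C : ℝ≥0)
    (hb : ∀ ξ, ‖h ξ‖ₑ ≤ C * expWeight a ξ) (f : WeightedL1 μ a) :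
    pairing μ a h hm C hb f = ∫ ξ, h ξ * f ξ ∂μ := rfl

lemma norm_pairing_le (h : G → ℂ) (hm : Measurable h) (C : ℝ≥0)
    (hb : ∀ ξ, ‖h ξ‖ₑ ≤ C * expWeight a ξ) : ‖pairing μ a h hm C hb‖ ≤ C :=
  LinearMap.mkContinuous_norm_le _ C.coe_nonneg _

/-! ### Convolution -/

variable (μ) in
/-- The convolution of two functions with respect to `μ`. -/
def convFun (f g : G → ℂ) (ξ : G) : ℂ := ∫ η, f η * g (ξ - η) ∂μ

variable [SigmaFinite μ] [μ.IsAddLeftInvariant] [μ.IsNegInvariant]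

lemma ae_sub_left {p : G → Prop} (h : ∀ᵐ η ∂μ, p η) (ξ : G) : ∀ᵐ η ∂μ, p (ξ - η) :=
  (quasiMeasurePreserving_sub_left μ ξ).ae h

lemma convFun_congr {f f' g g' : G → ℂ} (hf : f =ᵐ[μ] f') (hg : g =ᵐ[μ] g') :
    convFun μ f g = convFun μ f' g' := by
  ext ξ
  refine integral_congr_ae ?_
  filter_upwards [hf, ae_sub_left hg ξ] with η h1 h2
  rw [h1, h2]

lemma convFun_comm (f g : G → ℂ) : convFun μ f g = convFun μ g f := by
  ext ξ
  rw [convFun, ← integral_sub_left_eq_self _ μ ξ]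
  simp only [sub_sub_cancel]
  exact integral_congr_ae (Eventually.of_forall fun η => mul_comm _ _)

lemma aesm_convFun_integrand {f g : G → ℂ} (hf : AEStronglyMeasurable f μ)
    (hg : AEStronglyMeasurable g μ) :
    AEStronglyMeasurable (fun p : G × G => f p.2 * g (p.1 - p.2)) (μ.prod μ) :=
  hf.convolution_integrand (ContinuousLinearMap.mul ℂ ℂ) hg

lemma aesm_convFun {f g : G → ℂ} (hf : AEStronglyMeasurable f μ)
    (hg : AEStronglyMeasurable g μ) : AEStronglyMeasurable (convFun μ f g) μ :=
  (aesm_convFun_integrand hf hg).integral_prod_right'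

/-- Tonelli, after distributing the weight over the two factors; translation invariance turns the
inner integral into the norm of `g`. -/
lemma lintegral_expWeight_conv (f g : WeightedL1 μ a) :
    ∫⁻ ξ, ∫⁻ η, expWeight a ξ * ‖f η * g (ξ - η)‖ₑ ∂μ ∂μ ≤ ‖f‖ₑ * ‖g‖ₑ := by
  have hm := (aesm_convFun_integrand f.aesm g.aesm).enorm
  have hm' : AEMeasurable (fun p : G × G => expWeight a p.1 * ‖f p.2 * g (p.1 - p.2)‖ₑ)
      (μ.prod μ) := ((measurable_expWeight a).comp measurable_fst).aemeasurable.mul hm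
  rw [lintegral_lintegral_swap hm']
  calc ∫⁻ η, ∫⁻ ξ, expWeight a ξ * ‖f η * g (ξ - η)‖ₑ ∂μ ∂μ
      ≤ ∫⁻ η, ∫⁻ ξ, (expWeight a η * ‖f η‖ₑ) * (expWeight a (ξ - η) * ‖g (ξ - η)‖ₑ) ∂μ ∂μ := by
        refine lintegral_mono fun η => lintegral_mono fun ξ => ?_
        rw [enorm_mul]
        calc _ ≤ (expWeight a η * expWeight a (ξ - η)) * (‖f η‖ₑ * ‖g (ξ - η)‖ₑ) := by
              gcongr; exact expWeight_le_mul a ξ η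
          _ = _ := by ring
    _ = ∫⁻ η, (expWeight a η * ‖f η‖ₑ) * ‖g‖ₑ ∂μ := by
        refine lintegral_congr fun η => ?_
        rw [lintegral_const_mul' _ _ (ENNReal.mul_ne_top (expWeight_ne_top a η) enorm_ne_top),
          lintegral_sub_right_eq_self (fun ξ => expWeight a ξ * ‖g ξ‖ₑ) η, enorm_eq g]
    _ = _ := by rw [lintegral_mul_const' _ _ enorm_ne_top, ← enorm_eq]

lemma lintegral_convFun_le (f g : WeightedL1 μ a) :
    ∫⁻ ξ, expWeight a ξ * ‖convFun μ f g ξ‖ₑ ∂μ ≤ ‖f‖ₑ * ‖g‖ₑ := by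
  refine le_trans (lintegral_mono fun ξ => ?_) (lintegral_expWeight_conv f g)
  rw [lintegral_const_mul' _ _ (expWeight_ne_top a ξ)]
  gcongr
  exact enorm_integral_le_lintegral_enorm _

lemma integrable_convFun (f g : WeightedL1 μ a) :
    Integrable (convFun μ f g) (expMeasure μ a) :=
  (integrable_expMeasure_iff a).2 ⟨aesm_convFun f.aesm g.aesm,
    (lintegral_convFun_le f g).trans_lt (ENNReal.mul_lt_top enorm_lt_top enorm_lt_top)⟩

lemma integrable_conv_integrand (f g : WeightedL1 μ a) :
    Integrable (fun p : G × G => f p.2 * g (p.1 - p.2)) (μ.prod μ) :=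
  f.integrable.convolution_integrand (ContinuousLinearMap.mul ℂ ℂ) g.integrable

lemma ae_integrable_conv (f g : WeightedL1 μ a) :
    ∀ᵐ ξ ∂μ, Integrable (fun η => f η * g (ξ - η)) μ :=
  (integrable_conv_integrand f g).prod_right_ae

lemma norm_toL1_convFun_le (f g : WeightedL1 μ a) :
    ‖(integrable_convFun f g).toL1‖ ≤ ‖f‖ * ‖g‖ := by
  have h := lintegral_convFun_le f g
  rw [← enorm_toL1 (integrable_convFun f g), ← ofReal_norm, ← ofReal_norm, ← ofReal_norm,
    ← ENNReal.ofReal_mul (norm_nonneg _)] at h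
  exact (ENNReal.ofReal_le_ofReal_iff (by positivity)).1 h

lemma convFun_add_right_ae (f g h : WeightedL1 μ a) :
    convFun μ f (↑(g + h) : G → ℂ) =ᵐ[μ] convFun μ f g + convFun μ f h := by
  rw [convFun_congr (Filter.EventuallyEq.refl _ _) (coe_add g h)]
  filter_upwards [ae_integrable_conv f g, ae_integrable_conv f h] with ξ h1 h2
  rw [Pi.add_apply, convFun, convFun, convFun, ← integral_add h1 h2]
  simp [mul_add]

lemma convFun_smul_right (c : ℂ) (f g : WeightedL1 μ a) :
    convFun μ f (↑(c • g) : G → ℂ) = c • convFun μ f g := by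
  rw [convFun_congr (Filter.EventuallyEq.refl _ _) (coe_smul c g)]
  ext ξ
  rw [Pi.smul_apply, smul_eq_mul, convFun, convFun, ← integral_const_mul]
  refine integral_congr_ae (Eventually.of_forall fun η => ?_)
  simp only [Pi.smul_apply, smul_eq_mul]
  ring

variable (μ a) in
/-- Convolution as a bounded bilinear map of the weighted `L¹` space. -/
def conv : WeightedL1 μ a →L[ℂ] WeightedL1 μ a →L[ℂ] WeightedL1 μ a :=
  LinearMap.mkContinuous₂
    (LinearMap.mk₂ ℂ (fun f g => (integrable_convFun f g).toL1)
      (fun f f' g => by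
        refine ext_ae ((coe_toL1 _).trans (EventuallyEq.trans ?_ (coe_add _ _).symm))
        rw [convFun_comm]
        filter_upwards [convFun_add_right_ae g f f', coe_toL1 (integrable_convFun f g),
          coe_toL1 (integrable_convFun f' g)] with ξ h1 h2 h3
        rw [h1, Pi.add_apply, Pi.add_apply, h2, h3, convFun_comm, convFun_comm g])
      (fun c f g => by
        refine ext_ae ((coe_toL1 _).trans (EventuallyEq.trans ?_ (coe_smul _ _).symm))
        rw [convFun_comm, convFun_smul_right, convFun_comm]
        filter_upwards [coe_toL1 (integrable_convFun f g)] with ξ h2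
        rw [Pi.smul_apply, Pi.smul_apply, h2])
      (fun f g g' => by
        refine ext_ae ((coe_toL1 _).trans (EventuallyEq.trans ?_ (coe_add _ _).symm))
        filter_upwards [convFun_add_right_ae f g g', coe_toL1 (integrable_convFun f g),
          coe_toL1 (integrable_convFun f g')] with ξ h1 h2 h3
        rw [h1, Pi.add_apply, Pi.add_apply, h2, h3])
      (fun c f g => by
        refine ext_ae ((coe_toL1 _).trans (EventuallyEq.trans ?_ (coe_smul _ _).symm))
        rw [convFun_smul_right]
        filter_upwards [coe_toL1 (integrable_convFun f g)] with ξ h2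
        rw [Pi.smul_apply, Pi.smul_apply, h2])) 1
    (fun f g => by rw [one_mul]; exact norm_toL1_convFun_le f g)

lemma coe_conv (f g : WeightedL1 μ a) : (conv μ a f g : G → ℂ) =ᵐ[μ] convFun μ f g :=
  coe_toL1 (integrable_convFun f g)

lemma norm_conv_le (f g : WeightedL1 μ a) : ‖conv μ a f g‖ ≤ ‖f‖ * ‖g‖ :=
  norm_toL1_convFun_le f g

lemma conv_comm (f g : WeightedL1 μ a) : conv μ a f g = conv μ a g f :=
  ext_ae ((coe_conv f g).trans ((convFun_comm (μ := μ) f g) ▸ (coe_conv g f).symm))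

/-! ### Conjugation and multiplication by unimodular functions -/

lemma integrable_conjRefl (f : WeightedL1 μ a) :
    Integrable (fun ξ => conj (f (-ξ))) (expMeasure μ a) ∧
      ∫⁻ ξ, expWeight a ξ * ‖conj (f (-ξ))‖ₑ ∂μ = ‖f‖ₑ := by
  have h : ∫⁻ ξ, expWeight a ξ * ‖conj (f (-ξ))‖ₑ ∂μ = ‖f‖ₑ := by
    rw [enorm_eq, ← lintegral_neg_eq_self]
    simp [expWeight_neg]
  refine ⟨(integrable_expMeasure_iff a).2 ⟨?_, h ▸ enorm_lt_top⟩, h⟩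
  exact Complex.continuous_conj.comp_aestronglyMeasurable
    (f.aesm.comp_quasiMeasurePreserving (Measure.measurePreserving_neg μ).quasiMeasurePreserving)

lemma ae_neg {p : G → Prop} (h : ∀ᵐ η ∂μ, p η) : ∀ᵐ η ∂μ, p (-η) :=
  (Measure.measurePreserving_neg μ).quasiMeasurePreserving.ae h

variable (μ a) in
/-- The isometry `f ↦ conj f(-·)`, which corresponds to complex conjugation. -/
def conjRefl : WeightedL1 μ a →ₗᵢ⋆[ℂ] WeightedL1 μ a where
  toFun f := (integrable_conjRefl f).1.toL1
  map_add' f g := by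
    refine ext_ae ((coe_toL1 _).trans (EventuallyEq.trans ?_ (coe_add _ _).symm))
    filter_upwards [ae_neg (coe_add f g), coe_toL1 (integrable_conjRefl f).1,
      coe_toL1 (integrable_conjRefl g).1] with ξ h1 h2 h3
    rw [h1, Pi.add_apply, Pi.add_apply, h2, h3, map_add]
  map_smul' c f := by
    refine ext_ae ((coe_toL1 _).trans (EventuallyEq.trans ?_ (coe_smul _ _).symm))
    filter_upwards [ae_neg (coe_smul c f), coe_toL1 (integrable_conjRefl f).1] with ξ h1 h2
    rw [h1, Pi.smul_apply, Pi.smul_apply, h2, smul_eq_mul, smul_eq_mul, map_mul]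
  norm_map' f := by
    have h := (enorm_toL1 (integrable_conjRefl f).1).trans (integrable_conjRefl f).2
    simpa using congrArg ENNReal.toReal h

lemma coe_conjRefl (f : WeightedL1 μ a) :
    (conjRefl μ a f : G → ℂ) =ᵐ[μ] fun ξ => conj (f (-ξ)) :=
  coe_toL1 (integrable_conjRefl f).1

end WeightedL1

end WeightedConvolution

/-! ### Free evolution, power nonlinearity, and sup bounds by duality. -/

section Nonlinearity

open scoped NNReal ComplexConjugate

variable {G : Type*} [NormedAddCommGroup G] [MeasurableSpace G] [BorelSpace G]
  [SecondCountableTopology G] {μ : Measure G} {a : ℝ≥0}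

namespace WeightedL1

lemma enorm_phase (x : ℝ) : ‖Complex.exp (-(Complex.I * x))‖ₑ = 1 := by
  rw [← ofReal_norm, ← mul_neg, ← Complex.ofReal_neg, mul_comm, Complex.norm_exp_ofReal_mul_I,
    ENNReal.ofReal_one]

lemma measurable_phase {q : G → ℝ} (hq : Measurable q) :
    Measurable fun ξ => Complex.exp (-(Complex.I * q ξ)) := by fun_prop

lemma integrable_phase_mul {q : G → ℝ} (hq : Measurable q) (f : WeightedL1 μ a) :
    Integrable (fun ξ => Complex.exp (-(Complex.I * q ξ)) * f ξ) (expMeasure μ a) := by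
  refine (integrable_exp f).mono ((measurable_phase hq).aestronglyMeasurable.mul
    (integrable_exp f).1) (Eventually.of_forall fun ξ => ?_)
  rw [← enorm_le_iff_norm_le, enorm_mul, enorm_phase, one_mul]

variable (μ a) in
/-- Multiplication by `e^{-iq}`. -/
def phaseMul (q : G → ℝ) (hq : Measurable q) : WeightedL1 μ a →ₗᵢ[ℂ] WeightedL1 μ a where
  toFun f := (integrable_phase_mul hq f).toL1
  map_add' f g := by
    refine ext_ae ((coe_toL1 _).trans (EventuallyEq.trans ?_ (coe_add _ _).symm))
    filter_upwards [coe_add f g, coe_toL1 (integrable_phase_mul hq f),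
      coe_toL1 (integrable_phase_mul hq g)] with ξ h1 h2 h3
    rw [h1, Pi.add_apply, Pi.add_apply, h2, h3, mul_add]
  map_smul' c f := by
    refine ext_ae ((coe_toL1 _).trans (EventuallyEq.trans ?_ (coe_smul _ _).symm))
    filter_upwards [coe_smul c f, coe_toL1 (integrable_phase_mul hq f)] with ξ h1 h2
    rw [h1, Pi.smul_apply, Pi.smul_apply, h2, RingHom.id_apply, smul_eq_mul, smul_eq_mul]
    ring
  norm_map' f := by
    have h : ‖(integrable_phase_mul hq f).toL1‖ₑ = ‖f‖ₑ := by
      rw [enorm_toL1, enorm_eq]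
      refine lintegral_congr fun ξ => ?_
      rw [enorm_mul, enorm_phase, one_mul]
    simpa using congrArg ENNReal.toReal h

lemma coe_phaseMul (q : G → ℝ) (hq : Measurable q) (f : WeightedL1 μ a) :
    (phaseMul μ a q hq f : G → ℂ) =ᵐ[μ] fun ξ => Complex.exp (-(Complex.I * q ξ)) * f ξ :=
  coe_toL1 (integrable_phase_mul hq f)

variable (μ a) in
/-- The group `S(t)` of multiplications by `e^{-itQ}`. -/
def flow (Q : G → ℝ) (hQ : Measurable Q) (t : ℝ) : WeightedL1 μ a →ₗᵢ[ℂ] WeightedL1 μ a :=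
  phaseMul μ a (fun ξ => t * Q ξ) (hQ.const_mul t)

variable {Q : G → ℝ} {hQ : Measurable Q}

lemma coe_flow (t : ℝ) (f : WeightedL1 μ a) :
    (flow μ a Q hQ t f : G → ℂ) =ᵐ[μ] fun ξ => Complex.exp (-(Complex.I * (t * Q ξ : ℝ))) * f ξ :=
  coe_phaseMul _ _ f

lemma flow_zero (f : WeightedL1 μ a) : flow μ a Q hQ 0 f = f := by
  refine ext_ae ((coe_flow 0 f).trans (Eventually.of_forall fun ξ => ?_))
  simp

lemma flow_flow (s t : ℝ) (f : WeightedL1 μ a) :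
    flow μ a Q hQ s (flow μ a Q hQ t f) = flow μ a Q hQ (s + t) f := by
  refine ext_ae ?_
  filter_upwards [coe_flow (hQ := hQ) s (flow μ a Q hQ t f), coe_flow (hQ := hQ) t f,
    coe_flow (hQ := hQ) (s + t) f] with ξ h1 h2 h3
  rw [h1, h2, h3, ← mul_assoc, ← Complex.exp_add]
  congr 2
  push_cast
  ring

/-- Dominated convergence, for a fixed `f`. For unbounded `Q` the group is in general not norm
continuous, so later arguments always separate a fixed vector from a small increment. -/
lemma tendsto_flow (f : WeightedL1 μ a) (t₀ : ℝ) :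
    Tendsto (fun t => flow μ a Q hQ t f) (𝓝 t₀) (𝓝 (flow μ a Q hQ t₀ f)) := by
  rw [tendsto_iff_norm_sub_tendsto_zero]
  have key : ∀ t, ‖flow μ a Q hQ t f - flow μ a Q hQ t₀ f‖ₑ = ∫⁻ ξ, expWeight a ξ *
      ‖(Complex.exp (-(Complex.I * (t * Q ξ : ℝ))) -
        Complex.exp (-(Complex.I * (t₀ * Q ξ : ℝ)))) * f ξ‖ₑ ∂μ := fun t => by
    rw [enorm_eq]
    refine lintegral_congr_ae ?_
    filter_upwards [coe_sub (flow μ a Q hQ t f) (flow μ a Q hQ t₀ f), coe_flow (hQ := hQ) t f,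
      coe_flow (hQ := hQ) t₀ f] with ξ h1 h2 h3
    rw [h1, Pi.sub_apply, h2, h3, sub_mul]
  have hlim : Tendsto (fun t => ‖flow μ a Q hQ t f - flow μ a Q hQ t₀ f‖ₑ) (𝓝 t₀) (𝓝 0) := by
    simp_rw [key]
    have h0 : (0 : ℝ≥0∞) = ∫⁻ ξ, 0 ∂μ := by simp
    rw [h0]
    refine tendsto_lintegral_filter_of_dominated_convergence'
      (fun ξ => 2 * (expWeight a ξ * ‖f ξ‖ₑ)) (Eventually.of_forall fun t => ?_)
      (Eventually.of_forall fun t => Eventually.of_forall fun ξ => ?_) ?_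
      (Eventually.of_forall fun ξ => ?_)
    · refine (measurable_expWeight a).aemeasurable.mul (AEStronglyMeasurable.enorm ?_)
      exact ((measurable_phase (hQ.const_mul t)).sub
        (measurable_phase (hQ.const_mul t₀))).aestronglyMeasurable.mul f.aesm
    · rw [enorm_mul, mul_left_comm]
      gcongr
      refine (enorm_sub_le).trans ?_
      rw [enorm_phase, enorm_phase, one_add_one_eq_two]
    · rw [lintegral_const_mul' _ _ (by simp), ← enorm_eq]
      exact ENNReal.mul_ne_top (by simp) enorm_ne_top
    · have hc : Continuous fun t : ℝ => ‖(Complex.exp (-(Complex.I * (t * Q ξ : ℝ))) -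
        Complex.exp (-(Complex.I * (t₀ * Q ξ : ℝ)))) * f ξ‖ₑ := by
        refine Continuous.enorm ?_
        fun_prop
      have := ENNReal.Tendsto.const_mul (a := expWeight a ξ) (hc.tendsto t₀)
        (Or.inr (expWeight_ne_top a ξ))
      simpa using this
  have := (ENNReal.tendsto_toReal ENNReal.zero_ne_top).comp hlim
  simpa [Function.comp_def] using this

lemma continuousOn_flow {s : Set ℝ} {c : ℝ → ℝ} (hc : ContinuousOn c s) {f : ℝ → WeightedL1 μ a}
    (hf : ContinuousOn f s) : ContinuousOn (fun t => flow μ a Q hQ (c t) (f t)) s := by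
  intro t₀ ht₀
  rw [ContinuousWithinAt, tendsto_iff_norm_sub_tendsto_zero]
  have h1 := tendsto_iff_norm_sub_tendsto_zero.1 ((tendsto_flow (hQ := hQ) (f t₀) (c t₀)).comp
    (hc t₀ ht₀))
  have h2 := tendsto_iff_norm_sub_tendsto_zero.1 (hf t₀ ht₀)
  refine squeeze_zero (fun _ => norm_nonneg _) (fun t => ?_) (by simpa using h2.add h1)
  calc _ = ‖flow μ a Q hQ (c t) (f t - f t₀) +
        (flow μ a Q hQ (c t) (f t₀) - flow μ a Q hQ (c t₀) (f t₀))‖ := by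
        rw [map_sub, sub_add_sub_cancel]
    _ ≤ _ := (norm_add_le _ _).trans (by rw [LinearIsometry.norm_map])

variable [SigmaFinite μ] [μ.IsAddLeftInvariant] [μ.IsNegInvariant]

variable (μ a) in
/-- The nonlinearity `|u|^{2k} u` on the Fourier side. -/
def nonlin : ℕ → WeightedL1 μ a → WeightedL1 μ a
  | 0, f => f
  | k + 1, f => conv μ a (conv μ a f (conjRefl μ a f)) (nonlin k f)

lemma continuous_nonlin (k : ℕ) : Continuous (nonlin μ a k) := by
  induction k with
  | zero => exact continuous_id
  | succ k ih =>
    have h1 : Continuous fun f => conv μ a f (conjRefl μ a f) :=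
      (conv μ a).continuous.clm_apply (conjRefl μ a).continuous
    exact ((conv μ a).continuous.comp h1).clm_apply ih

/-- A family of bounds on which convolution with an element of the algebra acts with the
norm of that element. -/
structure IsModuleBound (P : ℝ → WeightedL1 μ a → Prop) : Prop where
  mono : ∀ {B B' f}, P B f → B ≤ B' → P B' f
  add : ∀ {B B' f g}, P B f → P B' g → P (B + B') (f + g)
  smul : ∀ {B f} (c : ℂ), P B f → P (‖c‖ * B) (c • f)
  conv_left : ∀ {B f} (g), P B f → P (B * ‖g‖) (conv μ a f g)
  refl : ∀ {B f}, P B f → P B (conjRefl μ a f)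
  phase : ∀ {B f} (q hq), P B f → P B (phaseMul μ a q hq f)

namespace IsModuleBound

variable {P : ℝ → WeightedL1 μ a → Prop}

lemma conv_right (hP : IsModuleBound P) {B f} (g) (h : P B f) : P (B * ‖g‖) (conv μ a g f) := by
  rw [conv_comm]; exact hP.conv_left g h

/-- With this instance the abstract estimates give the Lipschitz property of the field in the
algebra; with `DualBound` in place of the norm the same proofs give sup bounds. -/
lemma norm : IsModuleBound (fun B (f : WeightedL1 μ a) => ‖f‖ ≤ B) where
  mono h h' := h.trans h'
  add h h' := (norm_add_le _ _).trans (add_le_add h h')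
  smul c h := by rw [norm_smul]; gcongr
  conv_left g h := (norm_conv_le _ _).trans (by gcongr)
  refl h := by rwa [LinearIsometry.norm_map]
  phase q hq h := by rwa [LinearIsometry.norm_map]

end IsModuleBound

lemma norm_nonlin_le (k : ℕ) (f : WeightedL1 μ a) : ‖nonlin μ a k f‖ ≤ ‖f‖ ^ (2 * k + 1) := by
  induction k with
  | zero => simp [nonlin]
  | succ k ih =>
    calc ‖nonlin μ a (k + 1) f‖ ≤ ‖conv μ a f (conjRefl μ a f)‖ * ‖nonlin μ a k f‖ := norm_conv_le _ _
      _ ≤ (‖f‖ * ‖conjRefl μ a f‖) * ‖f‖ ^ (2 * k + 1) := by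
          gcongr
          exact norm_conv_le _ _
      _ = _ := by rw [LinearIsometry.norm_map]; ring

namespace IsModuleBound

variable {P : ℝ → WeightedL1 μ a → Prop}

lemma nonlin (hP : IsModuleBound P) {B M : ℝ} (hB : 0 ≤ B) (hM : 0 ≤ M) (k : ℕ)
    {f : WeightedL1 μ a} (hf : ‖f‖ ≤ M) (h : P B f) :
    P (M ^ (2 * k) * B) (WeightedL1.nonlin μ a k f) := by
  induction k with
  | zero => simpa [WeightedL1.nonlin] using h
  | succ k ih =>
    refine hP.mono (hP.conv_right (conv μ a f (conjRefl μ a f)) ih) ?_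
    calc M ^ (2 * k) * B * ‖conv μ a f (conjRefl μ a f)‖ ≤ M ^ (2 * k) * B * (M * M) := by
          gcongr
          refine (norm_conv_le _ _).trans ?_
          rw [LinearIsometry.norm_map]
          gcongr
      _ = _ := by ring

/-- Telescoping over the factors of the product. Each induction step changes two more factors, one
of them conjugated, which accounts for the constant `2 * k + 1`. -/
lemma nonlin_sub (hP : IsModuleBound P) {D M : ℝ} (hD : 0 ≤ D) (hM : 0 ≤ M) (k : ℕ)
    {f g : WeightedL1 μ a} (hf : ‖f‖ ≤ M) (hg : ‖g‖ ≤ M) (h : P D (f - g)) :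
    P ((2 * k + 1) * M ^ (2 * k) * D) (WeightedL1.nonlin μ a k f - WeightedL1.nonlin μ a k g) := by
  induction k with
  | zero => simpa [WeightedL1.nonlin] using h
  | succ k ih =>
    have e : WeightedL1.nonlin μ a (k + 1) f - WeightedL1.nonlin μ a (k + 1) g =
        (conv μ a (conv μ a (f - g) (conjRefl μ a f)) (WeightedL1.nonlin μ a k f) +
        conv μ a (conv μ a g (conjRefl μ a (f - g))) (WeightedL1.nonlin μ a k f)) +
        conv μ a (conv μ a g (conjRefl μ a g))
          (WeightedL1.nonlin μ a k f - WeightedL1.nonlin μ a k g) := by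
      simp only [WeightedL1.nonlin, map_sub, sub_apply]
      abel
    rw [e]
    have h1 := hP.conv_left (WeightedL1.nonlin μ a k f) (hP.conv_left (conjRefl μ a f) h)
    have h2 := hP.conv_left (WeightedL1.nonlin μ a k f) (hP.conv_right g (hP.refl h))
    have h3 := hP.conv_right (conv μ a g (conjRefl μ a g)) ih
    refine hP.mono (hP.add (hP.add h1 h2) h3) ?_
    have hN : ‖WeightedL1.nonlin μ a k f‖ ≤ M ^ (2 * k + 1) :=
      (norm_nonlin_le k f).trans (by gcongr)
    have hgg : ‖conv μ a g (conjRefl μ a g)‖ ≤ M * M :=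
      (norm_conv_le _ _).trans (by rw [LinearIsometry.norm_map]; gcongr)
    rw [LinearIsometry.norm_map]
    calc _ ≤ D * M * M ^ (2 * k + 1) + D * M * M ^ (2 * k + 1) +
          (2 * k + 1) * M ^ (2 * k) * D * (M * M) := by gcongr
      _ = _ := by push_cast; ring

end IsModuleBound

/-! ### Bounds by duality with test functions -/

/-- A measurable function with `|h| ≤ K` and `∫ |h| ≤ 1`. -/
structure IsTest (μ : Measure G) (K : ℝ≥0) (h : G → ℂ) : Prop where
  meas : Measurable h
  bound : ∀ ξ, ‖h ξ‖ₑ ≤ K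
  integral : ∫⁻ ξ, ‖h ξ‖ₑ ∂μ ≤ 1

lemma IsTest.bound_weight {K : ℝ≥0} {h : G → ℂ} (hh : IsTest μ K h) (ξ : G) :
    ‖h ξ‖ₑ ≤ K * expWeight a ξ :=
  (hh.bound ξ).trans (le_mul_of_one_le_right' (one_le_expWeight a ξ))

/-- The essential bound `|f| ≤ B`, tested against functions bounded by `K`. -/
def DualBound (K : ℝ≥0) (B : ℝ) (f : WeightedL1 μ a) : Prop :=
  ∀ h, IsTest μ K h → ‖∫ ξ, h ξ * f ξ ∂μ‖ ≤ B

/-- The cutoff `K` makes the test functions bounded, hence continuous functionals on the algebra.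
They commute with time integrals and supply an a priori finite bound, which the integral equation
later improves to one independent of `K`. -/
lemma dualBound_norm (K : ℝ≥0) (f : WeightedL1 μ a) : DualBound K (K * ‖f‖) f := by
  intro h hh
  rw [← pairing_apply h hh.meas K hh.bound_weight f]
  exact ((pairing μ a h hh.meas K hh.bound_weight).le_opNorm f).trans
    (by gcongr; exact norm_pairing_le _ _ _ _)

lemma dualBound_of_ae (K : ℝ≥0) {B : ℝ} {f : WeightedL1 μ a} (hB : 0 ≤ B)
    (hf : ∀ᵐ ξ ∂μ, ‖f ξ‖ ≤ B) : DualBound K B f := by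
  intro h hh
  have h1 : ‖∫ ξ, h ξ * f ξ ∂μ‖ₑ ≤ ENNReal.ofReal B := by
    refine (enorm_integral_le_lintegral_enorm _).trans ?_
    calc ∫⁻ ξ, ‖h ξ * f ξ‖ₑ ∂μ ≤ ∫⁻ ξ, ‖h ξ‖ₑ * ENNReal.ofReal B ∂μ := by
          refine lintegral_mono_ae ?_
          filter_upwards [hf] with ξ hξ
          rw [enorm_mul, ← ofReal_norm (f ξ)]
          gcongr
      _ ≤ 1 * ENNReal.ofReal B := by
          rw [lintegral_mul_const' _ _ ENNReal.ofReal_ne_top]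
          gcongr
          exact hh.integral
      _ = _ := one_mul _
  rw [← ofReal_norm] at h1
  exact (ENNReal.ofReal_le_ofReal_iff hB).1 h1

/-- Testing with the conjugate phase of `f`, normalized on a set of finite positive measure, shows
that the mean of the modulus over the set is at most `B`. The cutoff needed is the inverse of the
measure of the set, so all `K` must be admitted. -/
lemma ae_le_of_dualBound {B : ℝ} (f : WeightedL1 μ a)
    (hf : ∀ K, DualBound K B f) : ∀ᵐ ξ ∂μ, ‖f ξ‖ ≤ B := by
  set g : G → ℂ := f.aesm.mk f
  have hg : Measurable g := f.aesm.stronglyMeasurable_mk.measurable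
  have hfg : f =ᵐ[μ] g := f.aesm.ae_eq_mk
  have hgi : Integrable g μ := f.integrable.congr hfg
  have key : 0 ≤ᵐ[μ] fun ξ => B - ‖g ξ‖ := by
    refine ae_nonneg_of_forall_setIntegral_nonneg_of_sigmaFinite (fun s hs hμs => ?_)
      (fun s hs hμs => ?_)
    · exact (integrableOn_const (hs := hμs.ne)).sub hgi.norm.integrableOn
    have hcB : Integrable (fun _ => B) (μ.restrict s) := integrableOn_const (hs := hμs.ne)
    rw [integral_sub hcB hgi.norm.integrableOn, setIntegral_const, sub_nonneg, smul_eq_mul]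
    rcases eq_or_ne (μ s) 0 with h0 | h0
    · rw [Measure.restrict_eq_zero.2 h0]; simp [measureReal_def, h0]
    set m : ℝ := μ.real s
    have hm : 0 < m := ENNReal.toReal_pos h0 hμs.ne
    have hmE : μ s = ENNReal.ofReal m := (ENNReal.ofReal_toReal hμs.ne).symm
    let h : G → ℂ := s.indicator fun ξ => ((m⁻¹ * ‖g ξ‖⁻¹ : ℝ) : ℂ) * conj (g ξ)
    have hval : ∀ ξ, ‖h ξ‖ ≤ s.indicator (fun _ => m⁻¹) ξ := fun ξ => by
      by_cases hξ : ξ ∈ s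
      · simp only [h, indicator_of_mem hξ, norm_mul, Complex.norm_real, RCLike.norm_conj,
          Real.norm_eq_abs, abs_inv, abs_norm, abs_of_pos hm, mul_assoc]
        exact mul_le_of_le_one_right (by positivity) inv_mul_le_one
      · simp [h, hξ]
    have hT : IsTest μ (m⁻¹).toNNReal h := by
      refine ⟨Measurable.indicator (by fun_prop) hs, fun ξ => ?_, ?_⟩
      · rw [← ofReal_norm]
        refine ENNReal.ofReal_le_ofReal ((hval ξ).trans ?_)
        exact indicator_le_self' (fun _ _ => by positivity) ξ
      · calc ∫⁻ ξ, ‖h ξ‖ₑ ∂μ ≤ ∫⁻ ξ, s.indicator (fun _ => ENNReal.ofReal m⁻¹) ξ ∂μ := by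
              refine lintegral_mono fun ξ => ?_
              rw [← ofReal_norm]
              refine (ENNReal.ofReal_le_ofReal (hval ξ)).trans ?_
              by_cases hξ : ξ ∈ s <;> simp [hξ]
          _ = 1 := by
              rw [lintegral_indicator_const hs, hmE, ← ENNReal.ofReal_mul (by positivity),
                inv_mul_cancel₀ hm.ne', ENNReal.ofReal_one]
    have h1 := hf _ h hT
    have h2 : ∫ ξ, h ξ * f ξ ∂μ = ((m⁻¹ * ∫ ξ in s, ‖g ξ‖ ∂μ : ℝ) : ℂ) := by
      rw [← integral_const_mul, ← integral_complex_ofReal, ← integral_indicator hs]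
      refine integral_congr_ae ?_
      filter_upwards [hfg] with ξ hξ
      rw [hξ]
      by_cases hs' : ξ ∈ s
      · simp only [h, indicator_of_mem hs']
        rw [mul_assoc, mul_comm (conj _), Complex.mul_conj, Complex.normSq_eq_norm_sq]
        rw [← Complex.ofReal_mul]
        congr 1
        rcases eq_or_ne ‖g ξ‖ 0 with hz | hz
        · simp [hz]
        · field_simp
      · simp [h, hs']
    rw [h2, Complex.norm_real, Real.norm_of_nonneg (by positivity)] at h1
    rwa [inv_mul_le_iff₀ hm] at h1
  filter_upwards [key, hfg] with ξ h1 h2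
  rw [h2]
  simpa using h1

lemma isTest_translate {K : ℝ≥0} {h : G → ℂ} (hh : IsTest μ K h) (η : G) :
    IsTest μ K fun ξ => h (ξ + η) where
  meas := hh.meas.comp (measurable_add_const η)
  bound ξ := hh.bound _
  integral := by
    rw [lintegral_add_right_eq_self (fun ξ => ‖h ξ‖ₑ) η]
    exact hh.integral

lemma integral_mul_conv {K : ℝ≥0} {h : G → ℂ} (hm : Measurable h) (hb : ∀ ξ, ‖h ξ‖ₑ ≤ K)
    (f g : WeightedL1 μ a) :
    ∫ ξ, h ξ * conv μ a f g ξ ∂μ = ∫ η, (∫ ξ, h (ξ + η) * g ξ ∂μ) * f η ∂μ := by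
  have hi : Integrable (fun p : G × G => h p.1 * (f p.2 * g (p.1 - p.2))) (μ.prod μ) := by
    refine (integrable_conv_integrand f g).bdd_mul (c := K)
      (hm.comp measurable_fst).aestronglyMeasurable (Eventually.of_forall fun p => ?_)
    exact enorm_le_coe.1 (hb p.1)
  calc ∫ ξ, h ξ * conv μ a f g ξ ∂μ = ∫ ξ, ∫ η, h ξ * (f η * g (ξ - η)) ∂μ ∂μ := by
        refine integral_congr_ae ?_
        filter_upwards [coe_conv f g] with ξ hξ
        rw [hξ, convFun, integral_const_mul]
    _ = ∫ η, ∫ ξ, h ξ * (f η * g (ξ - η)) ∂μ ∂μ := integral_integral_swap hi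
    _ = _ := by
        refine integral_congr_ae (Eventually.of_forall fun η => ?_)
        simp only
        rw [← integral_mul_const, ← integral_add_right_eq_self _ η]
        refine integral_congr_ae (Eventually.of_forall fun ξ => ?_)
        simp only [add_sub_cancel_right]
        ring

/-- Each operation is moved onto the test function: tests are stable under translation, reflection
with conjugation, and multiplication by phases. For convolution, pairing `f` with the translates of
a test gives a function bounded by `B`, which is then integrated against `g`. -/
lemma isModuleBound_dualBound (K : ℝ≥0) :
    IsModuleBound (DualBound K : ℝ → WeightedL1 μ a → Prop) where
  mono h h' t ht := (h t ht).trans h'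
  add := by
    intro B B' f g hf hg h hh
    have := map_add (pairing μ a h hh.meas K hh.bound_weight) f g
    simp only [pairing_apply] at this
    rw [this]
    exact (norm_add_le _ _).trans (add_le_add (hf h hh) (hg h hh))
  smul := by
    intro B f c hf h hh
    have := map_smul (pairing μ a h hh.meas K hh.bound_weight) c f
    simp only [pairing_apply] at this
    rw [this, norm_smul]
    gcongr
    exact hf h hh
  conv_left := by
    intro B f g hf h hh
    rw [conv_comm, integral_mul_conv hh.meas hh.bound]
    have hB : 0 ≤ B := (norm_nonneg _).trans (hf h hh)
    have h1 : ‖∫ η, (∫ ξ, h (ξ + η) * f ξ ∂μ) * g η ∂μ‖ₑ ≤ B.toNNReal * ‖g‖ₑ := by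
      refine enorm_integral_mul_le (C := B.toNNReal) (fun η => ?_) g
      have h2 := hf _ (isTest_translate hh η)
      refine le_trans ?_ (le_mul_of_one_le_right' (one_le_expWeight a η))
      rw [← ofReal_norm]
      exact ENNReal.ofReal_le_ofReal h2
    rw [← ofReal_norm, ← ofReal_norm] at h1
    change _ ≤ ENNReal.ofReal B * _ at h1
    rw [← ENNReal.ofReal_mul hB] at h1
    exact (ENNReal.ofReal_le_ofReal_iff (by positivity)).1 h1
  refl := by
    intro B f hf h hh
    have hT : IsTest μ K fun ξ => conj (h (-ξ)) := by
      refine ⟨Complex.continuous_conj.measurable.comp (hh.meas.comp measurable_neg),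
        fun ξ => by simpa using hh.bound (-ξ), ?_⟩
      rw [← lintegral_neg_eq_self]
      simpa using hh.integral
    have h1 := hf _ hT
    rw [← RCLike.norm_conj, ← integral_conj] at h1
    refine le_of_eq_of_le ?_ h1
    congr 1
    rw [← integral_neg_eq_self]
    refine integral_congr_ae ?_
    filter_upwards [ae_neg (coe_conjRefl f)] with ξ hξ
    rw [hξ]
    simp
  phase := by
    intro B f q hq hf h hh
    have hT : IsTest μ K fun ξ => h ξ * Complex.exp (-(Complex.I * q ξ)) := by
      refine ⟨hh.meas.mul (measurable_phase hq), fun ξ => ?_, ?_⟩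
      · rw [enorm_mul, enorm_phase, mul_one]; exact hh.bound ξ
      · simpa only [enorm_mul, enorm_phase, mul_one] using hh.integral
    refine le_of_eq_of_le ?_ (hf _ hT)
    congr 1
    refine integral_congr_ae ?_
    filter_upwards [coe_phaseMul q hq f] with ξ hξ
    rw [hξ, mul_assoc]

lemma DualBound.integral {K : ℝ≥0} {B T : ℝ} (hT : 0 ≤ T) {f : ℝ → WeightedL1 μ a}
    (hc : ContinuousOn f (Icc 0 T)) (hf : ∀ t ∈ Icc 0 T, DualBound K B (f t)) :
    DualBound K (B * T) (∫ t in (0 : ℝ)..T, f t) := by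
  intro h hh
  have hi : IntervalIntegrable f volume 0 T := by
    rw [← uIcc_of_le hT] at hc; exact hc.intervalIntegrable
  rw [← pairing_apply (a := a) h hh.meas K hh.bound_weight,
    ← ContinuousLinearMap.intervalIntegral_comp_comm _ hi]
  refine (intervalIntegral.norm_integral_le_of_norm_le_const (C := B) fun t ht => ?_).trans ?_
  · rw [uIoc_of_le hT] at ht
    exact hf t (Ioc_subset_Icc_self ht) h hh
  · rw [sub_zero, abs_of_nonneg hT]

end WeightedL1

end Nonlinearity

/-! ### Existence, uniqueness and Picard iteration for the interaction equation. -/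

section AbstractEquation

open scoped NNReal ComplexConjugate
open Metric

variable {G : Type*} [NormedAddCommGroup G] [MeasurableSpace G] [BorelSpace G]
  [SecondCountableTopology G] {μ : Measure G} {a : ℝ≥0}
  [SigmaFinite μ] [μ.IsAddLeftInvariant] [μ.IsNegInvariant]

namespace WeightedL1

variable (μ a) in
/-- The vector field `F(t, v) = -iε S(-t) N(S(t) v)` of the equation in the interaction
representation. -/
def field (Q : G → ℝ) (hQ : Measurable Q) (ε : ℝ) (k : ℕ) (t : ℝ) (v : WeightedL1 μ a) :
    WeightedL1 μ a :=
  (-(Complex.I * ε)) • flow μ a Q hQ (-t) (nonlin μ a k (flow μ a Q hQ t v))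

variable {Q : G → ℝ} {hQ : Measurable Q} {ε : ℝ} {k : ℕ}

lemma norm_coupling (hε : |ε| = 1) : ‖-(Complex.I * (ε : ℂ))‖ = 1 := by
  simp [hε]

lemma norm_field_le (hε : |ε| = 1) (t : ℝ) (v : WeightedL1 μ a) :
    ‖field μ a Q hQ ε k t v‖ ≤ ‖v‖ ^ (2 * k + 1) := by
  rw [field, norm_smul, norm_coupling hε, one_mul, LinearIsometry.norm_map]
  exact (norm_nonlin_le k _).trans (by rw [LinearIsometry.norm_map])

lemma continuousOn_field {s : Set ℝ} {v : ℝ → WeightedL1 μ a} (hv : ContinuousOn v s) :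
    ContinuousOn (fun t => field μ a Q hQ ε k t (v t)) s := by
  have h1 : ContinuousOn (fun t => flow μ a Q hQ t (v t)) s := continuousOn_flow continuousOn_id hv
  have h2 : ContinuousOn (fun t => flow μ a Q hQ (-t) (nonlin μ a k (flow μ a Q hQ t (v t)))) s :=
    continuousOn_flow continuousOn_neg ((continuous_nonlin k).comp_continuousOn h1)
  exact h2.const_smul (-(Complex.I * ε))

namespace IsModuleBound

variable {P : ℝ → WeightedL1 μ a → Prop}

lemma field (hP : IsModuleBound P) (hε : |ε| = 1) {B M : ℝ} (hB : 0 ≤ B) (hM : 0 ≤ M) (t : ℝ)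
    {v : WeightedL1 μ a} (hv : ‖v‖ ≤ M) (h : P B v) :
    P (M ^ (2 * k) * B) (WeightedL1.field μ a Q hQ ε k t v) := by
  have := hP.smul (-(Complex.I * ε)) (hP.phase _ ((hQ.const_mul (-t))) (hP.nonlin hB hM k
    (f := flow μ a Q hQ t v) (by rwa [LinearIsometry.norm_map]) (hP.phase _ _ h)))
  rwa [norm_coupling hε, one_mul] at this

lemma field_sub (hP : IsModuleBound P) (hε : |ε| = 1) {D M : ℝ} (hD : 0 ≤ D) (hM : 0 ≤ M) (t : ℝ)
    {v w : WeightedL1 μ a} (hv : ‖v‖ ≤ M) (hw : ‖w‖ ≤ M) (h : P D (v - w)) :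
    P ((2 * k + 1) * M ^ (2 * k) * D)
      (WeightedL1.field μ a Q hQ ε k t v - WeightedL1.field μ a Q hQ ε k t w) := by
  have h1 : P D (flow μ a Q hQ t v - flow μ a Q hQ t w) := by
    rw [← map_sub]; exact hP.phase _ _ h
  have := hP.smul (-(Complex.I * ε)) (hP.phase _ ((hQ.const_mul (-t))) (hP.nonlin_sub hD hM k
    (f := flow μ a Q hQ t v) (g := flow μ a Q hQ t w) (by rwa [LinearIsometry.norm_map])
    (by rwa [LinearIsometry.norm_map]) h1))
  rw [norm_coupling hε, one_mul] at this
  convert this using 1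
  rw [WeightedL1.field, WeightedL1.field, ← smul_sub]
  congr 1
  exact (map_sub (flow μ a Q hQ (-t)) _ _).symm

end IsModuleBound

lemma lipschitzOnWith_field (hε : |ε| = 1) {M : ℝ} (hM : 0 ≤ M) (t : ℝ) :
    LipschitzOnWith (((2 * k + 1) * M ^ (2 * k)).toNNReal) (field μ a Q hQ ε k t)
      {v | ‖v‖ ≤ M} := by
  refine LipschitzOnWith.of_dist_le_mul fun v hv w hw => ?_
  rw [dist_eq_norm, dist_eq_norm, Real.coe_toNNReal _ (by positivity)]
  exact IsModuleBound.norm.field_sub hε (norm_nonneg _) hM t hv hw le_rfl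

/-- Local existence for the equation in the interaction representation. -/
theorem exists_solution (hε : |ε| = 1) {M T : ℝ} (hM : 0 ≤ M) (hT : 0 ≤ T)
    (hMT : T * (2 * M) ^ (2 * k) ≤ 1 / 2) {v₀ : WeightedL1 μ a} (hv₀ : ‖v₀‖ ≤ M) :
    ∃ v : ℝ → WeightedL1 μ a, v 0 = v₀ ∧ (∀ t ∈ Icc 0 T, ‖v t‖ ≤ 2 * M) ∧
      ∀ t ∈ Icc 0 T, HasDerivWithinAt v (field μ a Q hQ ε k t (v t)) (Icc 0 T) t := by
  have hball : ∀ x ∈ closedBall v₀ M, ‖x‖ ≤ 2 * M := fun x hx => by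
    have h1 := norm_sub_norm_le x v₀
    rw [mem_closedBall, dist_eq_norm] at hx
    linarith
  obtain ⟨r, hr⟩ : ∃ r : ℝ≥0, (r : ℝ) = M := ⟨M.toNNReal, Real.coe_toNNReal _ hM⟩
  obtain ⟨L, hL⟩ : ∃ L : ℝ≥0, (L : ℝ) = (2 * M) ^ (2 * k + 1) :=
    ⟨_, Real.coe_toNNReal _ (by positivity)⟩
  -- The ball of radius `M` around `v₀` lies in the ball of radius `2 * M` around zero, where the
  -- field is at most (2M)^{2k+1}; by `hMT` the displacement in time `T` is at most `M`.
  have hPL : IsPicardLindelof (field μ a Q hQ ε k) (tmin := 0) (tmax := T) ⟨0, by simp [hT]⟩ v₀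
      r 0 L
      (((2 * k + 1) * (2 * M) ^ (2 * k)).toNNReal) := by
    refine ⟨fun t _ => (lipschitzOnWith_field hε (by positivity) t).mono (hr ▸ hball), fun x _ =>
      continuousOn_field continuousOn_const, fun t _ x hx => ?_, ?_⟩
    · refine (norm_field_le hε t x).trans ?_
      rw [hL]
      have := hball x (hr ▸ hx)
      gcongr
    · rw [hL, hr, NNReal.coe_zero, sub_zero, sub_zero, sub_zero, max_eq_left hT]
      calc (2 * M) ^ (2 * k + 1) * T = (T * (2 * M) ^ (2 * k)) * (2 * M) := by ring
        _ ≤ 1 / 2 * (2 * M) := by gcongr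
        _ = M := by ring
  have hx : v₀ ∈ closedBall v₀ ((0 : ℝ≥0) : ℝ) := by simp
  -- The fixed point itself is kept, because the bound `2 * M` on the solution is read off from its
  -- values staying in the ball.
  obtain ⟨α, hα⟩ := ODE.FunSpace.exists_isFixedPt_next hPL hx
  have hmem : ∀ t, α.compProj t ∈ closedBall v₀ M := fun t =>
    hr ▸ α.compProj_mem_closedBall hPL.mul_max_le
  have heq : ∀ t ∈ Icc 0 T, α.compProj t =
      ODE.picard (field μ a Q hQ ε k) 0 v₀ α.compProj t := fun t ht => by
    have h1 : α.compProj t = (ODE.FunSpace.next hPL hx α).compProj t := by rw [hα]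
    rw [h1, ODE.FunSpace.compProj_of_mem ht, ODE.FunSpace.next_apply]
  refine ⟨α.compProj, ?_, fun t _ => hball _ (hmem t), fun t ht => ?_⟩
  · rw [heq 0 (by simp [hT]), ODE.picard_apply₀]
  · refine HasDerivWithinAt.congr_of_mem ?_ heq ht
    exact ODE.hasDerivWithinAt_picard_Icc (by simp [hT]) hPL.continuousOn_uncurry
      α.continuous_compProj.continuousOn (fun t _ => hr.symm ▸ hmem t) v₀ ht

/-- Uniqueness for the equation in the interaction representation. -/
theorem solution_unique (hε : |ε| = 1) {T : ℝ} {v w : ℝ → WeightedL1 μ a}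
    (hv : ∀ t ∈ Icc 0 T, HasDerivWithinAt v (field μ a Q hQ ε k t (v t)) (Icc 0 T) t)
    (hw : ∀ t ∈ Icc 0 T, HasDerivWithinAt w (field μ a Q hQ ε k t (w t)) (Icc 0 T) t)
    (h0 : v 0 = w 0) : ∀ t ∈ Icc 0 T, v t = w t := by
  have hvc : ContinuousOn v (Icc 0 T) := fun t ht => (hv t ht).continuousWithinAt
  have hwc : ContinuousOn w (Icc 0 T) := fun t ht => (hw t ht).continuousWithinAt
  obtain ⟨M₁, hM₁⟩ := isCompact_Icc.exists_bound_of_continuousOn hvc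
  obtain ⟨M₂, hM₂⟩ := isCompact_Icc.exists_bound_of_continuousOn hwc
  have hmem : ∀ t ∈ Ico 0 T, Icc 0 T ∈ 𝓝[Ici t] t := fun t ht =>
    mem_of_superset (Icc_mem_nhdsGE ht.2) (Icc_subset_Icc_left ht.1)
  refine ODE_solution_unique_of_mem_Icc_right (v := field μ a Q hQ ε k)
    (s := fun _ => {v | ‖v‖ ≤ max 0 (max M₁ M₂)})
    (fun t _ => lipschitzOnWith_field hε (le_max_left _ _) t) hvc
    (fun t ht => (hv t (Ico_subset_Icc_self ht)).mono_of_mem_nhdsWithin (hmem t ht))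
    (fun t ht => (hM₁ t (Ico_subset_Icc_self ht)).trans
      ((le_max_left _ _).trans (le_max_right _ _))) hwc
    (fun t ht => (hw t (Ico_subset_Icc_self ht)).mono_of_mem_nhdsWithin (hmem t ht))
    (fun t ht => (hM₂ t (Ico_subset_Icc_self ht)).trans
      ((le_max_right _ _).trans (le_max_right _ _))) h0

section Estimates

variable {M T : ℝ} {v : ℝ → WeightedL1 μ a}

lemma eq_add_integral
    (hv : ∀ t ∈ Icc 0 T, HasDerivWithinAt v (field μ a Q hQ ε k t (v t)) (Icc 0 T) t)
    {t : ℝ} (ht : t ∈ Icc 0 T) :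
    v t = v 0 + ∫ τ in (0 : ℝ)..t, field μ a Q hQ ε k τ (v τ) := by
  have hvc : ContinuousOn v (Icc 0 T) := fun t ht => (hv t ht).continuousWithinAt
  have hsub : Icc 0 t ⊆ Icc 0 T := Icc_subset_Icc_right ht.2
  have hc := (continuousOn_field (Q := Q) (hQ := hQ) (ε := ε) (k := k) hvc).mono hsub
  rw [intervalIntegral.integral_eq_sub_of_hasDeriv_right_of_le ht.1 (hvc.mono hsub)
    (fun x hx => (hv x (hsub (Ioo_subset_Icc_self hx))).mono_of_mem_nhdsWithin
      (mem_of_superset (Icc_mem_nhdsGT (hx.2.trans_le ht.2)) (Icc_subset_Icc_left hx.1.le))) ?_]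
  · abel
  · rw [← uIcc_of_le ht.1] at hc
    exact hc.intervalIntegrable

lemma dualBound_solution (hε : |ε| = 1) (hM : 0 ≤ M) (hMT : T * (2 * M) ^ (2 * k) ≤ 1 / 2)
    (hv : ∀ t ∈ Icc 0 T, HasDerivWithinAt v (field μ a Q hQ ε k t (v t)) (Icc 0 T) t)
    (hvM : ∀ t ∈ Icc 0 T, ‖v t‖ ≤ 2 * M) {K : ℝ≥0} {B : ℝ} (hB : 0 ≤ B)
    (h0 : DualBound K B (v 0)) : ∀ t ∈ Icc 0 T, DualBound K (2 * B) (v t) := by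
  have hP := isModuleBound_dualBound (μ := μ) (a := a) K
  have hvc : ContinuousOn v (Icc 0 T) := fun t ht => (hv t ht).continuousWithinAt
  -- The iteration starts from the crude bound K · 2M. Each use of the integral equation replaces a
  -- bound B' by B + B'/2, a contraction with fixed point 2B.
  have iter : ∀ n : ℕ, ∀ t ∈ Icc 0 T, DualBound K (2 * B + (1 / 2) ^ n * (K * (2 * M))) (v t) := by
    intro n
    induction n with
    | zero =>
      intro t ht
      refine hP.mono (dualBound_norm K (v t)) ?_
      have := hvM t ht
      have : (K : ℝ) * ‖v t‖ ≤ K * (2 * M) := by gcongr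
      rw [pow_zero, one_mul]
      linarith
    | succ n ih =>
      intro t ht
      have hsub : Icc 0 t ⊆ Icc 0 T := Icc_subset_Icc_right ht.2
      rw [eq_add_integral hv ht]
      set B' := 2 * B + (1 / 2) ^ n * (K * (2 * M)) with hB'
      have hB'0 : 0 ≤ B' := by positivity
      refine hP.mono (hP.add h0 (DualBound.integral ht.1 ((continuousOn_field hvc).mono hsub)
        (fun τ hτ => hP.field hε hB'0 (by positivity : (0 : ℝ) ≤ 2 * M) τ (hvM τ (hsub hτ))
          (ih τ (hsub hτ))))) ?_
      calc B + (2 * M) ^ (2 * k) * B' * t ≤ B + (2 * M) ^ (2 * k) * B' * T := by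
            gcongr; exact ht.2
        _ = B + T * (2 * M) ^ (2 * k) * B' := by ring
        _ ≤ B + 1 / 2 * B' := by gcongr
        _ = _ := by rw [hB', pow_succ]; ring
  intro t ht h hh
  have hlim : Tendsto (fun n : ℕ => 2 * B + (1 / 2 : ℝ) ^ n * (K * (2 * M))) atTop
      (𝓝 (2 * B + 0 * (K * (2 * M)))) :=
    ((tendsto_pow_atTop_nhds_zero_of_lt_one (by norm_num) (by norm_num)).mul_const _).const_add _
  rw [zero_mul, add_zero] at hlim
  exact ge_of_tendsto' hlim fun n => iter n t ht h hh

lemma ae_bound_solution (hε : |ε| = 1) (hM : 0 ≤ M) (hMT : T * (2 * M) ^ (2 * k) ≤ 1 / 2)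
    (hv : ∀ t ∈ Icc 0 T, HasDerivWithinAt v (field μ a Q hQ ε k t (v t)) (Icc 0 T) t)
    (hvM : ∀ t ∈ Icc 0 T, ‖v t‖ ≤ 2 * M) {B : ℝ} (hB : 0 ≤ B)
    (h0 : ∀ᵐ ξ ∂μ, ‖v 0 ξ‖ ≤ B) : ∀ t ∈ Icc 0 T, ∀ᵐ ξ ∂μ, ‖v t ξ‖ ≤ 2 * B := fun t ht =>
  ae_le_of_dualBound _ fun K =>
    dualBound_solution hε hM hMT hv hvM hB (dualBound_of_ae K hB h0) t ht

/-- The solution is close to the second Picard iterate. -/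
lemma dualBound_sub_picard (hε : |ε| = 1) (hM : 0 ≤ M) (hT : 0 ≤ T)
    (hMT : T * (2 * M) ^ (2 * k) ≤ 1 / 2)
    (hv : ∀ t ∈ Icc 0 T, HasDerivWithinAt v (field μ a Q hQ ε k t (v t)) (Icc 0 T) t)
    (hvM : ∀ t ∈ Icc 0 T, ‖v t‖ ≤ 2 * M) {K : ℝ≥0} {B : ℝ} (hB : 0 ≤ B)
    (h0 : DualBound K B (v 0)) :
    DualBound K (2 * (2 * k + 1) * (T * (2 * M) ^ (2 * k)) ^ 2 * B)
      (v T - v 0 - ∫ τ in (0 : ℝ)..T, field μ a Q hQ ε k τ (v 0)) := by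
  have hP := isModuleBound_dualBound (μ := μ) (a := a) K
  have hvc : ContinuousOn v (Icc 0 T) := fun t ht => (hv t ht).continuousWithinAt
  have hTT : T ∈ Icc 0 T := by simp [hT]
  have hM2 : (0 : ℝ) ≤ 2 * M := by positivity
  -- The displacement from the data already carries a factor T(2M)^{2k}; the Lipschitz bound for the
  -- field and a second time integration produce its square.
  have hdiff : ∀ t ∈ Icc 0 T, DualBound K ((2 * M) ^ (2 * k) * (2 * B) * T) (v t - v 0) := by
    intro t ht
    have hsub : Icc 0 t ⊆ Icc 0 T := Icc_subset_Icc_right ht.2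
    rw [eq_add_integral hv ht, add_sub_cancel_left]
    refine hP.mono (DualBound.integral ht.1 ((continuousOn_field hvc).mono hsub)
      (fun τ hτ => hP.field hε (by positivity) hM2 τ (hvM τ (hsub hτ))
          (dualBound_solution hε hM hMT hv hvM hB h0 τ (hsub hτ)))) ?_
    gcongr
    exact ht.2
  have hc1 : ContinuousOn (fun τ => field μ a Q hQ ε k τ (v τ)) (Icc 0 T) := continuousOn_field hvc
  have hc2 : ContinuousOn (fun τ => field μ a Q hQ ε k τ (v 0)) (Icc 0 T) :=
    continuousOn_field continuousOn_const
  have e : v T - v 0 - ∫ τ in (0 : ℝ)..T, field μ a Q hQ ε k τ (v 0) =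
      ∫ τ in (0 : ℝ)..T, (field μ a Q hQ ε k τ (v τ) - field μ a Q hQ ε k τ (v 0)) := by
    rw [intervalIntegral.integral_sub]
    · rw [eq_add_integral hv hTT]; abel
    · rw [← uIcc_of_le hT] at hc1; exact hc1.intervalIntegrable
    · rw [← uIcc_of_le hT] at hc2; exact hc2.intervalIntegrable
  rw [e]
  refine hP.mono (DualBound.integral hT (hc1.sub hc2) fun τ hτ =>
    hP.field_sub hε (by positivity) hM2 τ (hvM τ hτ) (hvM 0 (by simp [hT])) (hdiff τ hτ)) ?_
  apply le_of_eq
  ring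

end Estimates

end WeightedL1

end AbstractEquation

/-! ### The dual group and the synthesis of functions on Z from coefficients. -/

section Synthesis

open scoped NNReal ComplexConjugate

/-- The dual group `ℤ^{d₂} × ℝ^{d₁}`. -/
abbrev Freq (d₁ d₂ : ℕ) : Type := (Fin d₂ → ℤ) × EuclideanSpace ℝ (Fin d₁)

/-- The Haar measure of the dual group. -/
abbrev freqMeasure (d₁ d₂ : ℕ) : Measure (Freq d₁ d₂) :=
  (Measure.count : Measure (Fin d₂ → ℤ)).prod volume

variable {d₁ d₂ : ℕ}

instance : (freqMeasure d₁ d₂).IsNegInvariant where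
  neg_eq_self := by
    have h := (Measure.measurePreserving_neg (Measure.count : Measure (Fin d₂ → ℤ))).prod
      (Measure.measurePreserving_neg (volume : Measure (EuclideanSpace ℝ (Fin d₁))))
    exact h.map_eq

/-- The inclusion of the dual group in `ℝ^{d₁+d₂}`. -/
def freqEmb (ξ : Freq d₁ d₂) : NLSCover d₁ d₂ := NLSCover.mk ξ.2 fun j => (ξ.1 j : ℝ)

lemma freqEmb_inl (ξ : Freq d₁ d₂) (i : Fin d₁) : freqEmb ξ (Sum.inl i) = ξ.2 i := rfl

lemma freqEmb_inr (ξ : Freq d₁ d₂) (j : Fin d₂) : freqEmb ξ (Sum.inr j) = ξ.1 j := rfl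

lemma freqEmb_injective : Function.Injective (freqEmb : Freq d₁ d₂ → NLSCover d₁ d₂) := by
  intro ξ η h
  refine Prod.ext (funext fun j => ?_) (PiLp.ext fun i => ?_)
  · have h1 := congrArg (fun z : NLSCover d₁ d₂ => z (Sum.inr j)) h
    simp only [freqEmb_inr] at h1
    exact_mod_cast h1
  · exact congrArg (fun z : NLSCover d₁ d₂ => z (Sum.inl i)) h

lemma freqEmb_add (ξ η : Freq d₁ d₂) : freqEmb (ξ + η) = freqEmb ξ + freqEmb η := by
  refine PiLp.ext fun i => ?_
  rcases i with i | j
  · simp [freqEmb_inl]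
  · simp [freqEmb_inr]

lemma freqEmb_neg (ξ : Freq d₁ d₂) : freqEmb (-ξ) = -freqEmb ξ := by
  refine PiLp.ext fun i => ?_
  rcases i with i | j
  · simp [freqEmb_inl]
  · simp [freqEmb_inr]

lemma continuous_freqEmb : Continuous (freqEmb : Freq d₁ d₂ → NLSCover d₁ d₂) := by
  refine (PiLp.continuous_toLp 2 _).comp (continuous_pi fun i => ?_)
  rcases i with i | j
  · exact (EuclideanSpace.proj i).continuous.comp continuous_snd
  · exact (continuous_of_discreteTopology (f := fun n : ℤ => (n : ℝ))).comp
      ((continuous_apply j).comp continuous_fst)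

lemma measurableEmbedding_freqEmb :
    MeasurableEmbedding (freqEmb : Freq d₁ d₂ → NLSCover d₁ d₂) :=
  continuous_freqEmb.measurableEmbedding freqEmb_injective

/-- The symbol `|ξ|²` of `-Δ`. -/
def freqSq (ξ : Freq d₁ d₂) : ℝ := ‖ξ.2‖ ^ 2 + ∑ j, (ξ.1 j : ℝ) ^ 2

lemma norm_freqEmb_sq (ξ : Freq d₁ d₂) : ‖freqEmb ξ‖ ^ 2 = freqSq ξ := by
  simp [EuclideanSpace.norm_sq_eq, freqSq, freqEmb_inl, freqEmb_inr]

lemma freqNorm_eq (ξ : Freq d₁ d₂) : freqNorm ξ.1 ξ.2 = ‖freqEmb ξ‖ := by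
  rw [freqNorm, ← freqSq, ← norm_freqEmb_sq, Real.sqrt_sq (norm_nonneg _)]

lemma measurable_freqSq : Measurable (freqSq : Freq d₁ d₂ → ℝ) := by
  have : (freqSq : Freq d₁ d₂ → ℝ) = fun ξ => ‖freqEmb ξ‖ ^ 2 := by
    ext ξ; rw [norm_freqEmb_sq]
  rw [this]
  exact (continuous_freqEmb.norm.pow 2).measurable

/-- The character `ξ ↦ e^{i z·ξ}`. -/
def freqChar (z : NLSCover d₁ d₂) (ξ : Freq d₁ d₂) : ℂ :=
  Complex.exp (Complex.I * (inner ℝ (freqEmb ξ) z : ℝ))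

lemma continuous_freqChar (z : NLSCover d₁ d₂) : Continuous (freqChar z) := by
  unfold freqChar
  have := continuous_freqEmb (d₁ := d₁) (d₂ := d₂)
  fun_prop

lemma norm_freqChar (z : NLSCover d₁ d₂) (ξ : Freq d₁ d₂) : ‖freqChar z ξ‖ = 1 := by
  rw [freqChar, mul_comm, Complex.norm_exp_ofReal_mul_I]

lemma enorm_freqChar (z : NLSCover d₁ d₂) (ξ : Freq d₁ d₂) : ‖freqChar z ξ‖ₑ = 1 := by
  rw [← ofReal_norm, norm_freqChar, ENNReal.ofReal_one]

lemma freqChar_add (z : NLSCover d₁ d₂) (ξ η : Freq d₁ d₂) :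
    freqChar z (ξ + η) = freqChar z ξ * freqChar z η := by
  rw [freqChar, freqChar, freqChar, ← Complex.exp_add, freqEmb_add, inner_add_left]
  congr 1
  push_cast
  ring

lemma freqChar_neg (z : NLSCover d₁ d₂) (ξ : Freq d₁ d₂) :
    freqChar z (-ξ) = conj (freqChar z ξ) := by
  rw [freqChar, freqChar, ← Complex.exp_conj, freqEmb_neg, inner_neg_left]
  congr 1
  simp

/-- The function on `Z` with Fourier coefficients `f`, without normalization:
`z ↦ ∫ e^{i z·ξ} f(ξ) dμ(ξ)`. -/
def synth (f : Freq d₁ d₂ → ℂ) (z : NLSCover d₁ d₂) : ℂ :=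
  ∫ ξ, freqChar z ξ * f ξ ∂(freqMeasure d₁ d₂)

lemma synth_congr {f g : Freq d₁ d₂ → ℂ} (h : f =ᵐ[freqMeasure d₁ d₂] g) : synth f = synth g := by
  ext z
  refine integral_congr_ae ?_
  filter_upwards [h] with ξ hξ
  rw [hξ]

lemma integrable_freqChar_mul {f : Freq d₁ d₂ → ℂ} (hf : Integrable f (freqMeasure d₁ d₂))
    (z : NLSCover d₁ d₂) : Integrable (fun ξ => freqChar z ξ * f ξ) (freqMeasure d₁ d₂) :=
  hf.bdd_mul (c := 1) (continuous_freqChar z).aestronglyMeasurable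
    (Eventually.of_forall fun ξ => (norm_freqChar z ξ).le)

lemma synth_sub {f g : Freq d₁ d₂ → ℂ} (hf : Integrable f (freqMeasure d₁ d₂))
    (hg : Integrable g (freqMeasure d₁ d₂)) : synth (f - g) = synth f - synth g := by
  ext z
  rw [Pi.sub_apply, synth, synth, synth, ← integral_sub (integrable_freqChar_mul hf z)
    (integrable_freqChar_mul hg z)]
  simp [mul_sub]

lemma isPeriodicZ_synth (f : Freq d₁ d₂ → ℂ) : IsPeriodicZ (synth f) := by
  intro j z
  refine integral_congr_ae (Eventually.of_forall fun ξ => ?_)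
  simp only [freqChar, inner_add_right, EuclideanSpace.inner_single_right, freqEmb_inr]
  congr 1
  rw [Complex.exp_eq_exp_iff_exists_int]
  refine ⟨ξ.1 j, ?_⟩
  simp
  ring

section Smoothness

variable {f : Freq d₁ d₂ → ℂ}

/-- The bilinear form for which `VectorFourier.fourierIntegral` has the kernel `e^{i v·w}`. -/
def synthForm (d₁ d₂ : ℕ) : NLSCover d₁ d₂ →L[ℝ] NLSCover d₁ d₂ →L[ℝ] ℝ :=
  (-(2 * Real.pi)⁻¹) • innerSL ℝ

lemma synthForm_apply (v w : NLSCover d₁ d₂) :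
    synthForm d₁ d₂ v w = -(2 * Real.pi)⁻¹ * (inner ℝ v w : ℝ) := rfl

lemma fourierChar_synthForm (v w : NLSCover d₁ d₂) :
    (Real.fourierChar (-synthForm d₁ d₂ v w) : ℂ) =
      Complex.exp (Complex.I * (inner ℝ v w : ℝ)) := by
  rw [Real.fourierChar_apply, synthForm_apply]
  congr 1
  have : (Real.pi : ℂ) ≠ 0 := by exact_mod_cast Real.pi_ne_zero
  push_cast
  field_simp

/-- Pushing the Haar measure of the dual group forward to Euclidean space turns synthesis into a
Fourier integral, to which differentiation under moment conditions applies. Only the values of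
`Function.invFun freqEmb` on the range of `freqEmb` matter, where it is a genuine inverse. -/
lemma synth_eq_fourierIntegral (f : Freq d₁ d₂ → ℂ) :
    synth f = VectorFourier.fourierIntegral Real.fourierChar ((freqMeasure d₁ d₂).map freqEmb)
      (synthForm d₁ d₂).toLinearMap₁₂ (f ∘ Function.invFun freqEmb) := by
  ext z
  rw [VectorFourier.fourierIntegral, measurableEmbedding_freqEmb.integral_map, synth]
  refine integral_congr_ae (Eventually.of_forall fun ξ => ?_)
  simp only [Function.comp_apply, Function.leftInverse_invFun freqEmb_injective ξ]
  rw [freqChar, ← fourierChar_synthForm]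
  rfl

lemma integrable_moment (hf : ∀ n : ℕ, Integrable (fun ξ => ‖freqEmb ξ‖ ^ n * ‖f ξ‖)
    (freqMeasure d₁ d₂)) (n : ℕ) :
    Integrable (fun v => ‖v‖ ^ n * ‖(f ∘ Function.invFun freqEmb) v‖)
      ((freqMeasure d₁ d₂).map freqEmb) := by
  rw [measurableEmbedding_freqEmb.integrable_map_iff]
  refine (hf n).congr (Eventually.of_forall fun ξ => ?_)
  simp [Function.leftInverse_invFun freqEmb_injective ξ]

lemma contDiff_synth (hf : ∀ n : ℕ, Integrable (fun ξ => ‖freqEmb ξ‖ ^ n * ‖f ξ‖)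
    (freqMeasure d₁ d₂)) : ContDiff ℝ ∞ (synth f) := by
  rw [synth_eq_fourierIntegral]
  exact VectorFourier.contDiff_fourierIntegral _ fun n _ => integrable_moment hf n

/-- Two derivatives in the direction of a basis vector bring down minus the square of that
coordinate of the frequency; summing over an orthonormal basis gives the symbol. -/
lemma laplacian_synth (hm : AEStronglyMeasurable f (freqMeasure d₁ d₂))
    (hf : ∀ n : ℕ, Integrable (fun ξ => ‖freqEmb ξ‖ ^ n * ‖f ξ‖)
    (freqMeasure d₁ d₂)) (z : NLSCover d₁ d₂) :
    (Δ (synth f)) z = synth (fun ξ => -(freqSq ξ : ℂ) * f ξ) z := by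
  have hm' : AEStronglyMeasurable (f ∘ Function.invFun freqEmb)
      ((freqMeasure d₁ d₂).map freqEmb) := by
    rw [measurableEmbedding_freqEmb.aestronglyMeasurable_map_iff]
    refine hm.congr (Eventually.of_forall fun ξ => ?_)
    simp [Function.leftInverse_invFun freqEmb_injective ξ]
  rw [InnerProductSpace.laplacian_eq_iteratedFDeriv_orthonormalBasis _
    (EuclideanSpace.basisFun (Fin d₁ ⊕ Fin d₂) ℝ)]
  have hint : Integrable (fun v => VectorFourier.fourierPowSMulRight (synthForm d₁ d₂)
      (f ∘ Function.invFun freqEmb) v 2) ((freqMeasure d₁ d₂).map freqEmb) :=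
    VectorFourier.integrable_fourierPowSMulRight _ (integrable_moment hf 2) hm'
  simp only [synth_eq_fourierIntegral f]
  rw [VectorFourier.iteratedFDeriv_fourierIntegral (N := ⊤) _
    (fun n _ => integrable_moment hf n) hm' (n := 2) le_top]
  have e : ∀ i, (VectorFourier.fourierIntegral Real.fourierChar ((freqMeasure d₁ d₂).map freqEmb)
      (synthForm d₁ d₂).toLinearMap₁₂ (fun v => VectorFourier.fourierPowSMulRight
        (synthForm d₁ d₂) (f ∘ Function.invFun freqEmb) v 2) z)
        ![EuclideanSpace.basisFun (Fin d₁ ⊕ Fin d₂) ℝ i,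
          EuclideanSpace.basisFun (Fin d₁ ⊕ Fin d₂) ℝ i] =
      ∫ ξ, freqChar z ξ * (-(freqEmb ξ i : ℂ) ^ 2 * f ξ) ∂(freqMeasure d₁ d₂) := fun i => by
    rw [VectorFourier.fourierIntegral, ContinuousMultilinearMap.integral_apply,
      measurableEmbedding_freqEmb.integral_map]
    · refine integral_congr_ae (Eventually.of_forall fun ξ => ?_)
      have hpi : (Real.pi : ℂ) ≠ 0 := by exact_mod_cast Real.pi_ne_zero
      have hf0 : f (Function.invFun freqEmb (freqEmb ξ)) = f ξ := by
        rw [Function.leftInverse_invFun freqEmb_injective ξ]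
      have hin : (inner ℝ (freqEmb ξ) (EuclideanSpace.single i 1 : NLSCover d₁ d₂) : ℝ) =
          freqEmb ξ i := by simp [EuclideanSpace.inner_single_right]
      beta_reduce
      rw [freqChar, ← fourierChar_synthForm, Circle.smul_def, smul_apply,
        VectorFourier.fourierPowSMulRight_apply, Function.comp_apply, hf0, Fin.prod_univ_two,
        Matrix.cons_val_zero, Matrix.cons_val_one]
      have hs : synthForm d₁ d₂ (freqEmb ξ) (EuclideanSpace.basisFun (Fin d₁ ⊕ Fin d₂) ℝ i) =
          -(2 * Real.pi)⁻¹ * freqEmb ξ i := by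
        rw [EuclideanSpace.basisFun_apply, synthForm_apply, hin]
      simp only [Matrix.cons_val_fin_one, hs, ContinuousLinearMap.toLinearMap₁₂_apply, Complex.real_smul, smul_eq_mul]
      push_cast
      field_simp
      simp
      ring
    · exact (VectorFourier.fourierIntegral_convergent_iff Real.continuous_fourierChar
        (by exact (synthForm d₁ d₂).continuous₂) z).2 hint
  simp only [e]
  rw [← integral_finsetSum]
  · refine integral_congr_ae (Eventually.of_forall fun ξ => ?_)
    simp only
    rw [← Finset.mul_sum, ← Finset.sum_mul, ← norm_freqEmb_sq, EuclideanSpace.norm_sq_eq]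
    simp
  · intro i _
    refine integrable_freqChar_mul ?_ z
    refine ((hf 2).mono' (AEStronglyMeasurable.mul ?_ hm) (Eventually.of_forall fun ξ => ?_))
    · have h1 : Continuous fun ξ : Freq d₁ d₂ => freqEmb ξ i :=
        (EuclideanSpace.proj i).continuous.comp continuous_freqEmb
      exact ((Complex.continuous_ofReal.comp h1).pow 2).neg.aestronglyMeasurable
    · rw [norm_mul, norm_neg, norm_pow, Complex.norm_real]
      gcongr
      exact PiLp.norm_apply_le _ _

end Smoothness

section Algebra

variable {a : ℝ≥0}

open WeightedL1

/-- Characters are multiplicative, so synthesis is an algebra homomorphism; with `synth_conjRefl`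
this identifies `nonlin` with the pointwise power nonlinearity. -/
lemma synth_conv (f g : WeightedL1 (freqMeasure d₁ d₂) a) (z : NLSCover d₁ d₂) :
    synth (conv _ a f g) z = synth f z * synth g z := by
  rw [synth, integral_mul_conv (K := 1) (continuous_freqChar z).measurable
    (fun ξ => by rw [enorm_freqChar]; simp), synth, ← integral_mul_const]
  refine integral_congr_ae (Eventually.of_forall fun η => ?_)
  simp only [freqChar_add]
  rw [synth, mul_right_comm, ← integral_const_mul, ← integral_mul_const, ← integral_mul_const]
  refine integral_congr_ae (Eventually.of_forall fun ξ => ?_)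
  simp only
  ring

lemma synth_conjRefl (f : WeightedL1 (freqMeasure d₁ d₂) a) (z : NLSCover d₁ d₂) :
    synth (conjRefl _ a f) z = conj (synth f z) := by
  rw [synth, synth, ← integral_conj, ← integral_neg_eq_self]
  refine integral_congr_ae ?_
  filter_upwards [ae_neg (coe_conjRefl f)] with ξ hξ
  rw [hξ]
  simp [freqChar_neg]

lemma synth_nonlin (k : ℕ) (f : WeightedL1 (freqMeasure d₁ d₂) a) (z : NLSCover d₁ d₂) :
    synth (nonlin _ a k f) z = (‖synth f z‖ : ℂ) ^ (2 * k) * synth f z := by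
  induction k with
  | zero => simp [nonlin]
  | succ k ih =>
    rw [nonlin, synth_conv, synth_conv, synth_conjRefl, ih, Complex.mul_conj,
      Complex.normSq_eq_norm_sq]
    push_cast
    ring

end Algebra

end Synthesis

/-! ### Fourier integrals versus the Fourier–Plancherel transform. -/

section Plancherel

variable {V : Type*} [NormedAddCommGroup V] [InnerProductSpace ℝ V] [FiniteDimensional ℝ V]
  [MeasurableSpace V] [BorelSpace V]

open SchwartzMap

/-- Fubini: the inverse transform is the Fourier integral for minus the inner product, a form equal
to its flip. -/
lemma integral_fourierInv_mul_eq {f g : V → ℂ} (hf : Integrable f) (hg : Integrable g) :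
    ∫ x, 𝓕⁻ g x * f x = ∫ x, g x * 𝓕⁻ f x := by
  have hflip : (-innerₗ V).flip = -innerₗ V := by
    ext x y
    simp [real_inner_comm]
  have hc : Continuous fun p : V × V => (-innerₗ V) p.1 p.2 := by
    simp only [LinearMap.neg_apply, innerₗ_apply_apply]
    fun_prop
  have h := VectorFourier.integral_fourierIntegral_smul_eq_flip (μ := (volume : Measure V))
    (ν := (volume : Measure V)) (L := -innerₗ V) Real.continuous_fourierChar hc hg hf
  rw [hflip] at h
  exact h

lemma continuous_fourierInv {f : V → ℂ} (hf : Integrable f) : Continuous (𝓕⁻ f) := by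
  have hc : Continuous fun p : V × V => (-innerₗ V) p.1 p.2 := by
    simp only [LinearMap.neg_apply, innerₗ_apply_apply]
    fun_prop
  exact VectorFourier.fourierIntegral_continuous Real.continuous_fourierChar hc hf

/-- The inverse Fourier integral of a function of `L¹ ∩ L²` represents its inverse
Fourier-Plancherel transform. -/
lemma coe_fourierInv_toLp {f : V → ℂ} (hf : Integrable f) (hf2 : MemLp f 2) :
    (𝓕⁻ (hf2.toLp f) : Lp ℂ 2 (volume : Measure V)) =ᵐ[volume] 𝓕⁻ f := by
  refine ae_eq_of_integral_contDiff_smul_eq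
    ((Lp.memLp (𝓕⁻ (hf2.toLp f) : Lp ℂ 2 (volume : Measure V))).locallyIntegrable (by norm_num))
    (continuous_fourierInv hf).locallyIntegrable fun g hg hgc => ?_
  have hg₁ : HasCompactSupport (Complex.ofRealCLM ∘ g) := hgc.comp_left rfl
  have hg₂ : ContDiff ℝ ∞ (Complex.ofRealCLM ∘ g) := Complex.ofRealCLM.contDiff.comp hg
  set ψ : 𝓢(V, ℂ) := hg₁.toSchwartzMap hg₂
  have hψ : ∀ x, ψ x = (g x : ℂ) := fun x => rfl
  -- The Plancherel transform agrees with the transform of tempered distributions, which is defined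
  -- by duality; a smooth compactly supported test is a Schwartz function, so both candidates can be
  -- compared through this identity.
  have h1 := congrArg (fun F : TemperedDistribution V ℂ => F ψ)
    (Lp.fourierInv_toTemperedDistribution_eq (hf2.toLp f))
  simp only [TemperedDistribution.fourierInv_apply, Lp.toTemperedDistribution_apply] at h1
  calc ∫ x, g x • (𝓕⁻ (hf2.toLp f) : Lp ℂ 2 (volume : Measure V)) x
      = ∫ x, ψ x • (𝓕⁻ (hf2.toLp f) : Lp ℂ 2 (volume : Measure V)) x := by
        simp [hψ]
    _ = ∫ x, (𝓕⁻ ψ) x • (hf2.toLp f) x := h1.symm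
    _ = ∫ x, 𝓕⁻ (ψ : V → ℂ) x * f x := by
        refine integral_congr_ae ?_
        filter_upwards [hf2.coeFn_toLp] with x hx
        rw [hx, smul_eq_mul, SchwartzMap.fourierInv_coe]
    _ = ∫ x, ψ x * 𝓕⁻ f x := integral_fourierInv_mul_eq hf ψ.integrable
    _ = _ := by simp [hψ]

lemma memLp_fourierInv {f : V → ℂ} (hf : Integrable f) (hf2 : MemLp f 2) :
    MemLp (𝓕⁻ f) 2 :=
  (Lp.memLp (𝓕⁻ (hf2.toLp f) : Lp ℂ 2 (volume : Measure V))).ae_eq (coe_fourierInv_toLp hf hf2)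

lemma fourier_toLp_fourierInv {f : V → ℂ} (hf : Integrable f) (hf2 : MemLp f 2)
    (h : MemLp (𝓕⁻ f) 2) :
    (𝓕 (h.toLp (𝓕⁻ f)) : Lp ℂ 2 (volume : Measure V)) = hf2.toLp f := by
  have : h.toLp (𝓕⁻ f) = 𝓕⁻ (hf2.toLp f) :=
    Lp.ext (h.coeFn_toLp.trans (coe_fourierInv_toLp hf hf2).symm)
  rw [this, FourierTransform.fourier_fourierInv_eq]

/-- An integrable function whose inverse Fourier integral vanishes is zero. -/
lemma ae_eq_zero_of_fourierInv_eq_zero {f : V → ℂ} (hf : Integrable f) (h : ∀ x, 𝓕⁻ f x = 0) :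
    f =ᵐ[volume] 0 := by
  refine ae_eq_zero_of_integral_contDiff_smul_eq_zero hf.locallyIntegrable fun g hg hgc => ?_
  have hg₁ : HasCompactSupport (Complex.ofRealCLM ∘ g) := hgc.comp_left rfl
  have hg₂ : ContDiff ℝ ∞ (Complex.ofRealCLM ∘ g) := Complex.ofRealCLM.contDiff.comp hg
  set ψ : 𝓢(V, ℂ) := hg₁.toSchwartzMap hg₂
  have h1 := integral_fourierInv_mul_eq hf (𝓕 ψ).integrable
  simp only [h, mul_zero, integral_zero] at h1
  rw [← h1]
  refine integral_congr_ae (Eventually.of_forall fun x => ?_)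
  simp only
  rw [← SchwartzMap.fourierInv_coe, FourierTransform.fourierInv_fourier_eq, Complex.real_smul]
  rfl

end Plancherel

/-! ### The Fourier transform of a synthesized function. -/

section FourierOfSynthesis

variable {d₁ d₂ : ℕ}

/-- The box `(0, 2π]^{d₂}`. -/
abbrev torusBox (d₂ : ℕ) : Set (Fin d₂ → ℝ) :=
  Set.pi univ (fun _ : Fin d₂ => Ioc (0 : ℝ) (2 * Real.pi))

lemma volume_torusBox_lt_top : volume (torusBox d₂) < ⊤ := by
  rw [torusBox, volume_pi, Measure.pi_pi]
  exact ENNReal.prod_lt_top fun _ _ => by rw [Real.volume_Ioc]; exact ENNReal.ofReal_lt_top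

lemma integral_exp_int (n : ℤ) :
    ∫ y in Ioc (0 : ℝ) (2 * Real.pi), Complex.exp (Complex.I * ((n : ℝ) * y : ℝ)) =
      if n = 0 then 2 * Real.pi else 0 := by
  rw [← intervalIntegral.integral_of_le (by positivity)]
  split_ifs with h
  · simp [h]
  · have hc : Complex.I * n ≠ 0 := mul_ne_zero Complex.I_ne_zero (by exact_mod_cast h)
    have e : ∀ y : ℝ, Complex.exp (Complex.I * ((n : ℝ) * y : ℝ)) =
        Complex.exp (Complex.I * n * y) := fun y => by push_cast; ring_nf
    simp only [e]
    rw [integral_exp_mul_complex hc]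
    have : Complex.exp (Complex.I * n * (2 * Real.pi : ℝ)) = 1 := by
      rw [Complex.exp_eq_one_iff]
      exact ⟨n, by push_cast; ring⟩
    rw [this]
    simp

lemma integral_torusBox_exp (m : Fin d₂ → ℤ) :
    ∫ y in torusBox d₂, Complex.exp (Complex.I * ((∑ j, (m j : ℝ) * y j : ℝ) : ℂ)) =
      if m = 0 then ((2 * Real.pi) ^ d₂ : ℂ) else 0 := by
  have e : ∀ y : Fin d₂ → ℝ, Complex.exp (Complex.I * ((∑ j, (m j : ℝ) * y j : ℝ) : ℂ)) =
      ∏ j, Complex.exp (Complex.I * ((m j : ℝ) * y j : ℝ)) := fun y => by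
    rw [← Complex.exp_sum, Complex.ofReal_sum, Finset.mul_sum]
  simp only [e]
  rw [volume_pi, Measure.restrict_pi_pi,
    integral_fintype_prod_eq_prod (fun j (y : ℝ) => Complex.exp (Complex.I * ((m j : ℝ) * y : ℝ)))]
  simp only [integral_exp_int]
  split_ifs with h
  · simp [h]
  · obtain ⟨j, hj⟩ := Function.ne_iff.1 h
    refine Finset.prod_eq_zero (Finset.mem_univ j) ?_
    rw [if_neg (by simpa using hj), Complex.ofReal_zero]

lemma inner_freqEmb_mk (ξ : Freq d₁ d₂) (x : EuclideanSpace ℝ (Fin d₁)) (y : Fin d₂ → ℝ) :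
    (inner ℝ (freqEmb ξ) (NLSCover.mk x y) : ℝ) = inner ℝ ξ.2 x + ∑ j, (ξ.1 j : ℝ) * y j := by
  simp only [PiLp.inner_apply, Fintype.sum_sum_type]
  simp [freqEmb, NLSCover.mk, mul_comm]

lemma continuous_mk :
    Continuous fun p : EuclideanSpace ℝ (Fin d₁) × (Fin d₂ → ℝ) => NLSCover.mk p.1 p.2 := by
  refine (PiLp.continuous_toLp 2 _).comp (continuous_pi fun i => ?_)
  rcases i with i | j
  · exact (EuclideanSpace.proj i).continuous.comp continuous_fst
  · exact (continuous_apply j).comp continuous_snd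

lemma continuous_freqChar_uncurry :
    Continuous fun p : NLSCover d₁ d₂ × Freq d₁ d₂ => freqChar p.1 p.2 := by
  unfold freqChar
  have := continuous_freqEmb (d₁ := d₁) (d₂ := d₂)
  exact Complex.continuous_exp.comp (continuous_const.mul (Complex.continuous_ofReal.comp
    ((this.comp continuous_snd).inner continuous_fst)))

lemma continuous_freqChar_mk (x : EuclideanSpace ℝ (Fin d₁)) :
    Continuous fun p : (Fin d₂ → ℝ) × Freq d₁ d₂ => freqChar (NLSCover.mk x p.1) p.2 := by
  have h1 : Continuous fun y : Fin d₂ → ℝ => NLSCover.mk x y :=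
    continuous_mk.comp (continuous_const.prodMk continuous_id)
  unfold freqChar
  refine Complex.continuous_exp.comp (continuous_const.mul (Complex.continuous_ofReal.comp ?_))
  exact (continuous_freqEmb.comp continuous_snd).inner (h1.comp continuous_fst)

lemma integral_freqMeasure_single (k : Fin d₂ → ℤ) {F : Freq d₁ d₂ → ℂ}
    (hF : Integrable F (freqMeasure d₁ d₂)) (h : ∀ ξ, ξ.1 ≠ k → F ξ = 0) :
    ∫ ξ, F ξ ∂(freqMeasure d₁ d₂) = ∫ ξ, F (k, ξ) := by
  rw [integral_prod F hF, integral_countable hF.integral_prod_left, tsum_eq_single k]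
  · simp [Measure.real]
  · intro l hl
    have : ∀ ξ, F (l, ξ) = 0 := fun ξ => h _ hl
    simp [this]

lemma integrable_section {f : Freq d₁ d₂ → ℂ} (hf : Integrable f (freqMeasure d₁ d₂))
    (k : Fin d₂ → ℤ) : Integrable fun ξ => f (k, ξ) := by
  have h := hf.prod_right_ae
  rw [Measure.ae_count_iff] at h
  exact h k

lemma memLp_section {f : Freq d₁ d₂ → ℂ} (hf : MemLp f 2 (freqMeasure d₁ d₂))
    (k : Fin d₂ → ℤ) : MemLp (fun ξ => f (k, ξ)) 2 := by
  have h1 := hf.1.prodMk_left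
  rw [Measure.ae_count_iff] at h1
  rw [memLp_two_iff_integrable_sq_norm (h1 k)]
  have h2 := (memLp_two_iff_integrable_sq_norm hf.1).1 hf |>.prod_right_ae
  rw [Measure.ae_count_iff] at h2
  exact h2 k

/-- By Fubini and orthogonality of exponentials on the box, integration in the periodic variables
selects the slice with integer part `k` and contributes (2π)^{d₂}; the normalization of the
coefficient removes half of this power. -/
lemma periodicCoeff_synth {f : Freq d₁ d₂ → ℂ} (hf : Integrable f (freqMeasure d₁ d₂))
    (k : Fin d₂ → ℤ) (x : EuclideanSpace ℝ (Fin d₁)) :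
    periodicCoeff (synth f) k x = (Real.sqrt (2 * Real.pi) ^ d₂ : ℝ) *
      ∫ ξ, Complex.exp (Complex.I * (inner ℝ ξ x : ℝ)) * f (k, ξ) := by
  set e : (Fin d₂ → ℝ) → ℂ := fun y =>
    Complex.exp (-Complex.I * ((∑ j, (k j : ℝ) * y j : ℝ) : ℂ))
  have he : Continuous e := by fun_prop
  have hen : ∀ y, ‖e y‖ = 1 := fun y => by
    have := Complex.norm_exp_ofReal_mul_I (-∑ j, (k j : ℝ) * y j)
    rw [← this]
    simp only [e]
    congr 2
    push_cast
    ring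
  have hint : Integrable (fun p : (Fin d₂ → ℝ) × Freq d₁ d₂ =>
      (freqChar (NLSCover.mk x p.1) p.2 * e p.1) * f p.2)
      ((volume.restrict (torusBox d₂)).prod (freqMeasure d₁ d₂)) := by
    have : IsFiniteMeasure (volume.restrict (torusBox d₂)) :=
      ⟨by rw [Measure.restrict_apply_univ]; exact volume_torusBox_lt_top⟩
    have h1 : Integrable (fun p : (Fin d₂ → ℝ) × Freq d₁ d₂ => f p.2)
        ((volume.restrict (torusBox d₂)).prod (freqMeasure d₁ d₂)) := hf.comp_snd _
    refine h1.bdd_mul (c := 1) (Continuous.aestronglyMeasurable ?_)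
      (Eventually.of_forall fun p => ?_)
    · exact (continuous_freqChar_mk x).mul (he.comp continuous_fst)
    · rw [norm_mul, norm_freqChar, hen, one_mul]
  have hinner : ∀ ξ : Freq d₁ d₂, ∫ y in torusBox d₂,
      (freqChar (NLSCover.mk x y) ξ * e y) * f ξ =
      if ξ.1 = k then ((2 * Real.pi) ^ d₂ : ℂ) *
        (Complex.exp (Complex.I * (inner ℝ ξ.2 x : ℝ)) * f ξ) else 0 := by
    intro ξ
    have : ∀ y, (freqChar (NLSCover.mk x y) ξ * e y) * f ξ =
        (Complex.exp (Complex.I * (inner ℝ ξ.2 x : ℝ)) * f ξ) *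
        Complex.exp (Complex.I * ((∑ j, ((ξ.1 - k) j : ℝ) * y j : ℝ) : ℂ)) := by
      intro y
      have h2 : freqChar (NLSCover.mk x y) ξ * e y =
          Complex.exp (Complex.I * (inner ℝ ξ.2 x : ℝ)) *
          Complex.exp (Complex.I * ((∑ j, ((ξ.1 - k) j : ℝ) * y j : ℝ) : ℂ)) := by
        simp only [freqChar, e, inner_freqEmb_mk, ← Complex.exp_add]
        congr 1
        simp only [Pi.sub_apply, Int.cast_sub, sub_mul, Finset.sum_sub_distrib]
        push_cast
        ring
      rw [h2]; ring
    simp only [this]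
    rw [integral_const_mul, integral_torusBox_exp]
    simp only [sub_eq_zero]
    split_ifs <;> ring
  have hswap : ∫ y in torusBox d₂, synth f (NLSCover.mk x y) * e y =
      ((2 * Real.pi) ^ d₂ : ℂ) *
        ∫ ξ, Complex.exp (Complex.I * (inner ℝ ξ x : ℝ)) * f (k, ξ) := by
    calc ∫ y in torusBox d₂, synth f (NLSCover.mk x y) * e y
        = ∫ y in torusBox d₂, ∫ ξ, (freqChar (NLSCover.mk x y) ξ * e y) * f ξ
            ∂(freqMeasure d₁ d₂) := by
          refine integral_congr_ae (Eventually.of_forall fun y => ?_)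
          simp only [synth]
          rw [← integral_mul_const]
          refine integral_congr_ae (Eventually.of_forall fun ξ => ?_)
          simp only
          ring
      _ = ∫ ξ, (∫ y in torusBox d₂, (freqChar (NLSCover.mk x y) ξ * e y) * f ξ)
            ∂(freqMeasure d₁ d₂) := integral_integral_swap hint
      _ = _ := by
          have h3 := hint.integral_prod_right
          simp only [hinner] at h3 ⊢
          rw [integral_freqMeasure_single k h3 (fun ξ hξ => if_neg hξ)]
          simp only [if_true]
          rw [integral_const_mul]
  rw [periodicCoeff, hswap, ← mul_assoc]
  congr 1
  have h2 : (2 * Real.pi : ℂ) = ((Real.sqrt (2 * Real.pi) * Real.sqrt (2 * Real.pi) : ℝ) : ℂ) := by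
    rw [Real.mul_self_sqrt (by positivity)]; push_cast; ring
  rw [h2]
  have h4 : Real.sqrt (2 * Real.pi) ≠ 0 := (Real.sqrt_pos.2 (by positivity)).ne'
  rw [← Complex.ofReal_pow, ← Complex.ofReal_mul]
  congr 1
  rw [mul_pow, ← mul_assoc, ← mul_pow, inv_mul_cancel₀ h4, one_pow, one_mul]

/-- The partial Fourier coefficients of `synth f` as inverse Fourier integrals. -/
lemma periodicCoeff_synth_eq_fourierInv {f : Freq d₁ d₂ → ℂ}
    (hf : Integrable f (freqMeasure d₁ d₂)) (k : Fin d₂ → ℤ) :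
    periodicCoeff (synth f) k = 𝓕⁻ (fun η : EuclideanSpace ℝ (Fin d₁) =>
      ((Real.sqrt (2 * Real.pi) ^ d₂ * (2 * Real.pi) ^ d₁ : ℝ) : ℂ) *
        f (k, (2 * Real.pi) • η)) := by
  ext x
  rw [periodicCoeff_synth hf, Real.fourierInv_eq']
  have h := Measure.integral_comp_smul (volume : Measure (EuclideanSpace ℝ (Fin d₁)))
    (fun ξ => Complex.exp (Complex.I * (inner ℝ ξ x : ℝ)) * f (k, ξ)) (2 * Real.pi)
  rw [finrank_euclideanSpace_fin, abs_inv, abs_of_pos (by positivity : (0 : ℝ) < (2 * Real.pi) ^ d₁),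
    eq_inv_smul_iff₀ (by positivity)] at h
  rw [← h, Complex.real_smul, ← mul_assoc, ← Complex.ofReal_mul, ← integral_const_mul]
  refine integral_congr_ae (Eventually.of_forall fun η => ?_)
  simp only [smul_eq_mul, inner_smul_left]
  rw [mul_left_comm]
  congr 2
  simp [mul_comm]

lemma fourierZ_of_eq_fourierInv {g : NLSCover d₁ d₂ → ℂ} {k : Fin d₂ → ℤ}
    {F : EuclideanSpace ℝ (Fin d₁) → ℂ} (hF : Integrable F) (hF2 : MemLp F 2)
    (hg : periodicCoeff g k = 𝓕⁻ F) :
    fourierZ g k =ᵐ[volume] fun ξ =>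
      (((Real.sqrt (2 * Real.pi))⁻¹ ^ d₁ : ℝ) : ℂ) * F ((2 * Real.pi)⁻¹ • ξ) := by
  have hm : MemLp (periodicCoeff g k) 2 (volume : Measure (EuclideanSpace ℝ (Fin d₁))) :=
    hg ▸ memLp_fourierInv hF hF2
  have h1 : (𝓕 (hm.toLp (periodicCoeff g k)) : Lp ℂ 2
      (volume : Measure (EuclideanSpace ℝ (Fin d₁)))) =ᵐ[volume] F := by
    have : hm.toLp (periodicCoeff g k) = (memLp_fourierInv hF hF2).toLp (𝓕⁻ F) :=
      MemLp.toLp_congr _ _ (by rw [hg])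
    rw [this, fourier_toLp_fourierInv hF hF2]
    exact hF2.coeFn_toLp
  have hq := Measure.quasiMeasurePreserving_smul
    (volume : Measure (EuclideanSpace ℝ (Fin d₁))) (r := (2 * Real.pi)⁻¹) (by positivity)
  filter_upwards [hq.ae h1] with ξ hξ
  rw [fourierZ, dif_pos hm, hξ]

lemma comp_two_pi_smul {f : Freq d₁ d₂ → ℂ} (hf : Integrable f (freqMeasure d₁ d₂))
    (hf2 : MemLp f 2 (freqMeasure d₁ d₂)) (k : Fin d₂ → ℤ) (c : ℂ) :
    Integrable (fun η : EuclideanSpace ℝ (Fin d₁) => c * f (k, (2 * Real.pi) • η)) ∧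
    MemLp (fun η : EuclideanSpace ℝ (Fin d₁) => c * f (k, (2 * Real.pi) • η)) 2 := by
  have h2pi : (2 * Real.pi) ≠ 0 := by positivity
  refine ⟨((integrable_section hf k).comp_smul h2pi).const_mul c, MemLp.const_mul ?_ c⟩
  have h1 := memLp_section hf2 k
  have hm : AEStronglyMeasurable (fun η : EuclideanSpace ℝ (Fin d₁) => f (k, (2 * Real.pi) • η)) :=
    h1.1.comp_quasiMeasurePreserving (Measure.quasiMeasurePreserving_smul _ h2pi)
  rw [memLp_two_iff_integrable_sq_norm hm]
  exact ((memLp_two_iff_integrable_sq_norm h1.1).1 h1).comp_smul h2pi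

/-- The Fourier transform of `synth f` is a multiple of `f`. -/
lemma fourierZ_synth {f : Freq d₁ d₂ → ℂ} (hf : Integrable f (freqMeasure d₁ d₂))
    (hf2 : MemLp f 2 (freqMeasure d₁ d₂)) (k : Fin d₂ → ℤ) :
    fourierZ (synth f) k =ᵐ[volume] fun ξ =>
      ((Real.sqrt (2 * Real.pi) ^ (d₁ + d₂) : ℝ) : ℂ) * f (k, ξ) := by
  obtain ⟨h1, h2⟩ := comp_two_pi_smul hf hf2 k
    ((Real.sqrt (2 * Real.pi) ^ d₂ * (2 * Real.pi) ^ d₁ : ℝ) : ℂ)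
  filter_upwards [fourierZ_of_eq_fourierInv h1 h2 (periodicCoeff_synth_eq_fourierInv hf k)]
    with ξ hξ
  have h4 : Real.sqrt (2 * Real.pi) ≠ 0 := (Real.sqrt_pos.2 (by positivity)).ne'
  rw [hξ, ← mul_assoc, ← Complex.ofReal_mul, smul_inv_smul₀ (by positivity)]
  congr 2
  have h5 : (2 * Real.pi) ^ d₁ = Real.sqrt (2 * Real.pi) ^ d₁ * Real.sqrt (2 * Real.pi) ^ d₁ := by
    rw [← mul_pow, Real.mul_self_sqrt (by positivity)]
  rw [h5, inv_pow, pow_add]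
  field_simp

end FourierOfSynthesis

/-! ### Sobolev norms and low-frequency norms in terms of coefficients. -/

section Norms

open scoped NNReal ComplexConjugate
open WeightedL1

variable {d₁ d₂ : ℕ}

lemma measurable_fourierZ (g : NLSCover d₁ d₂ → ℂ) :
    Measurable fun ξ : Freq d₁ d₂ => fourierZ g ξ.1 ξ.2 := by
  refine measurable_from_prod_countable_right fun k => ?_
  by_cases h : MemLp (periodicCoeff g k) 2 (volume : Measure (EuclideanSpace ℝ (Fin d₁)))
  · simp only [fourierZ, dif_pos h]
    refine Measurable.const_mul ?_ _
    exact (Lp.stronglyMeasurable _).measurable.comp (measurable_const_smul _)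
  · simp only [fourierZ, dif_neg h]
    exact measurable_const

lemma measurable_sobolevWeight (σ : ℝ) : Measurable (sobolevWeight σ) := by
  unfold sobolevWeight
  split_ifs <;> fun_prop

lemma lintegral_freqMeasure {F : Freq d₁ d₂ → ℝ≥0∞} (hF : Measurable F) :
    ∫⁻ ξ, F ξ ∂(freqMeasure d₁ d₂) = ∑' k, ∫⁻ ξ, F (k, ξ) := by
  rw [lintegral_prod _ hF.aemeasurable, lintegral_count]

/-- The weight `w_σ`, as a function of the frequency. -/
def freqWeight (σ : ℝ) (ξ : Freq d₁ d₂) : ℝ≥0∞ := ENNReal.ofReal (sobolevWeight σ ‖freqEmb ξ‖)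

lemma measurable_freqWeight (σ : ℝ) : Measurable (freqWeight σ : Freq d₁ d₂ → ℝ≥0∞) :=
  ((measurable_sobolevWeight σ).comp continuous_freqEmb.norm.measurable).ennreal_ofReal

lemma sobolevNorm_eq (σ : ℝ) (g : NLSCover d₁ d₂ → ℂ) :
    sobolevNorm σ g = (∫⁻ ξ, (freqWeight σ ξ * ‖fourierZ g ξ.1 ξ.2‖ₑ) ^ 2
      ∂(freqMeasure d₁ d₂)) ^ (1 / 2 : ℝ) := by
  have hm : Measurable fun ξ : Freq d₁ d₂ => (freqWeight σ ξ * ‖fourierZ g ξ.1 ξ.2‖ₑ) ^ 2 :=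
    ((measurable_freqWeight σ).mul (measurable_fourierZ g).enorm).pow_const 2
  rw [lintegral_freqMeasure hm, sobolevNorm]
  simp only [freqWeight, ← freqNorm_eq]

lemma one_le_sobolevWeight (σ : ℝ) {r : ℝ} (hr : r ≤ 1) : 1 ≤ sobolevWeight σ r := by
  unfold sobolevWeight
  split_ifs with h
  · exact Real.one_le_rpow (by nlinarith [sq_nonneg r]) (by positivity)
  · rw [max_eq_left hr, Real.one_rpow]

/-- All weights are at least 1 on frequencies of length at most 1. One lower bound at low
frequencies thus serves every σ simultaneously, which is the infinite loss of regularity. -/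
lemma lowFreqNorm_le_sobolevNorm (σ : ℝ) (g : NLSCover d₁ d₂ → ℂ) :
    lowFreqNorm g ≤ sobolevNorm σ g := by
  unfold lowFreqNorm sobolevNorm
  refine ENNReal.rpow_le_rpow (ENNReal.tsum_le_tsum fun k => ?_) (by norm_num)
  have hms : MeasurableSet {ξ : EuclideanSpace ℝ (Fin d₁) | freqNorm k ξ ≤ 1} := by
    unfold freqNorm
    exact measurableSet_le (by fun_prop) measurable_const
  refine (setLIntegral_mono' hms fun ξ hξ => ?_).trans (setLIntegral_le_lintegral _ _)
  gcongr
  refine le_mul_of_one_le_left' ?_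
  rw [← ENNReal.ofReal_one]
  exact ENNReal.ofReal_le_ofReal (one_le_sobolevWeight σ hξ)

variable (d₁ d₂) in
/-- The constant `(2π)^{d/2}`. -/
def synthConst : ℝ := Real.sqrt (2 * Real.pi) ^ (d₁ + d₂)

lemma synthConst_pos : 0 < synthConst d₁ d₂ := by unfold synthConst; positivity

lemma ae_fourierZ_synth {f : Freq d₁ d₂ → ℂ} (hf : Integrable f (freqMeasure d₁ d₂))
    (hf2 : MemLp f 2 (freqMeasure d₁ d₂)) :
    ∀ k, ∀ᵐ ξ, fourierZ (synth f) k ξ = (synthConst d₁ d₂ : ℂ) * f (k, ξ) :=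
  fun k => fourierZ_synth hf hf2 k

/-- No measurability of `p` is assumed, so each exceptional slice is enlarged to a measurable null
set; countably many slices assemble to a measurable null set of the product. -/
lemma ae_freqMeasure_of_section {p : Freq d₁ d₂ → Prop}
    (h : ∀ k, ∀ᵐ ξ : EuclideanSpace ℝ (Fin d₁), p (k, ξ)) : ∀ᵐ ξ ∂(freqMeasure d₁ d₂), p ξ := by
  have hN : ∀ k, volume (toMeasurable volume {ξ : EuclideanSpace ℝ (Fin d₁) | ¬p (k, ξ)}) = 0 :=
    fun k => by rw [measure_toMeasurable]; exact h k
  have hm : MeasurableSet {ξ : Freq d₁ d₂ |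
      ξ.2 ∈ toMeasurable volume {η : EuclideanSpace ℝ (Fin d₁) | ¬p (ξ.1, η)}} := by
    have hind : Measurable fun ξ : Freq d₁ d₂ => (toMeasurable volume
        {η : EuclideanSpace ℝ (Fin d₁) | ¬p (ξ.1, η)}).indicator (fun _ => (1 : ℝ)) ξ.2 :=
      measurable_from_prod_countable_right fun k => by
        change Measurable ((toMeasurable volume
          {η : EuclideanSpace ℝ (Fin d₁) | ¬p (k, η)}).indicator fun _ => (1 : ℝ))
        exact measurable_const.indicator (measurableSet_toMeasurable _ _)
    convert hind (measurableSet_singleton (1 : ℝ)) using 1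
    ext ξ
    simp
  have h0 : freqMeasure d₁ d₂ {ξ : Freq d₁ d₂ |
      ξ.2 ∈ toMeasurable volume {η : EuclideanSpace ℝ (Fin d₁) | ¬p (ξ.1, η)}} = 0 := by
    rw [Measure.prod_apply hm, lintegral_count]
    simp only [Set.preimage_ofPred_eq, Set.ofPred_mem_eq, hN, tsum_zero]
  refine measure_mono_null (fun ξ hξ => ?_) h0
  exact subset_toMeasurable volume {η : EuclideanSpace ℝ (Fin d₁) | ¬p (ξ.1, η)} hξ

lemma sobolevNorm_synth (σ : ℝ) {f : Freq d₁ d₂ → ℂ} (hf : Integrable f (freqMeasure d₁ d₂))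
    (hf2 : MemLp f 2 (freqMeasure d₁ d₂)) :
    sobolevNorm σ (synth f) = ENNReal.ofReal (synthConst d₁ d₂) *
      (∫⁻ ξ, (freqWeight σ ξ * ‖f ξ‖ₑ) ^ 2 ∂(freqMeasure d₁ d₂)) ^ (1 / 2 : ℝ) := by
  have h : ∫⁻ ξ, (freqWeight σ ξ * ‖fourierZ (synth f) ξ.1 ξ.2‖ₑ) ^ 2 ∂(freqMeasure d₁ d₂) =
      ENNReal.ofReal (synthConst d₁ d₂) ^ 2 *
        ∫⁻ ξ, (freqWeight σ ξ * ‖f ξ‖ₑ) ^ 2 ∂(freqMeasure d₁ d₂) := by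
    rw [← lintegral_const_mul' _ _ (by finiteness)]
    refine lintegral_congr_ae ?_
    filter_upwards [ae_freqMeasure_of_section
      (p := fun ξ => fourierZ (synth f) ξ.1 ξ.2 = (synthConst d₁ d₂ : ℂ) * f ξ)
      (ae_fourierZ_synth hf hf2)] with ξ hξ
    rw [hξ, enorm_mul, ← ofReal_norm (synthConst d₁ d₂ : ℂ), Complex.norm_real,
      Real.norm_of_nonneg synthConst_pos.le]
    ring
  rw [sobolevNorm_eq, h, ENNReal.mul_rpow_of_nonneg _ _ (by norm_num), ← ENNReal.rpow_natCast,
    ← ENNReal.rpow_mul]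
  norm_num

lemma lowFreqNorm_synth {f : Freq d₁ d₂ → ℂ} (hf : Integrable f (freqMeasure d₁ d₂))
    (hf2 : MemLp f 2 (freqMeasure d₁ d₂)) :
    lowFreqNorm (synth f) = ENNReal.ofReal (synthConst d₁ d₂) *
      (∫⁻ ξ in {ξ | ‖freqEmb ξ‖ ≤ 1}, ‖f ξ‖ₑ ^ 2 ∂(freqMeasure d₁ d₂)) ^ (1 / 2 : ℝ) := by
  have hms : MeasurableSet {ξ : Freq d₁ d₂ | ‖freqEmb ξ‖ ≤ 1} :=
    measurableSet_le continuous_freqEmb.norm.measurable measurable_const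
  have h1 : ∑' k, ∫⁻ ξ in {ξ : EuclideanSpace ℝ (Fin d₁) | freqNorm k ξ ≤ 1},
      ‖fourierZ (synth f) k ξ‖ₑ ^ 2 =
      ∫⁻ ξ in {ξ | ‖freqEmb ξ‖ ≤ 1}, ‖fourierZ (synth f) ξ.1 ξ.2‖ₑ ^ 2 ∂(freqMeasure d₁ d₂) := by
    rw [← lintegral_indicator hms, lintegral_freqMeasure
      (((measurable_fourierZ (synth f)).enorm.pow_const 2).indicator hms)]
    refine tsum_congr fun k => ?_
    have hmk : MeasurableSet {ξ : EuclideanSpace ℝ (Fin d₁) | freqNorm k ξ ≤ 1} :=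
      hms.preimage (measurable_prodMk_left (x := k)) |> fun h => by
        simpa [← freqNorm_eq] using h
    rw [← lintegral_indicator hmk]
    refine lintegral_congr fun ξ => ?_
    simp only [indicator_apply, Set.mem_ofPred_eq, ← freqNorm_eq]
  have h2 : ∫⁻ ξ in {ξ | ‖freqEmb ξ‖ ≤ 1}, ‖fourierZ (synth f) ξ.1 ξ.2‖ₑ ^ 2
      ∂(freqMeasure d₁ d₂) = ENNReal.ofReal (synthConst d₁ d₂) ^ 2 *
        ∫⁻ ξ in {ξ | ‖freqEmb ξ‖ ≤ 1}, ‖f ξ‖ₑ ^ 2 ∂(freqMeasure d₁ d₂) := by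
    rw [← lintegral_const_mul' _ _ (by finiteness)]
    refine lintegral_congr_ae (ae_restrict_of_ae ?_)
    filter_upwards [ae_freqMeasure_of_section
      (p := fun ξ => fourierZ (synth f) ξ.1 ξ.2 = (synthConst d₁ d₂ : ℂ) * f ξ)
      (ae_fourierZ_synth hf hf2)] with ξ hξ
    rw [hξ, enorm_mul, ← ofReal_norm (synthConst d₁ d₂ : ℂ), Complex.norm_real,
      Real.norm_of_nonneg synthConst_pos.le]
    ring
  rw [lowFreqNorm, h1, h2, ENNReal.mul_rpow_of_nonneg _ _ (by norm_num), ← ENNReal.rpow_natCast,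
    ← ENNReal.rpow_mul]
  norm_num

/-! ### Growth of the weights -/

lemma norm_freqEmb_le (ξ : Freq d₁ d₂) : ‖freqEmb ξ‖ ≤ (1 + d₂) * ‖ξ‖ := by
  have h1 : ‖freqEmb ξ‖ ^ 2 ≤ ((1 + d₂) * ‖ξ‖) ^ 2 := by
    rw [norm_freqEmb_sq, freqSq]
    have h2 : ‖ξ.2‖ ^ 2 ≤ ‖ξ‖ ^ 2 := by gcongr; exact norm_snd_le ξ
    have h3 : ∀ j, (ξ.1 j : ℝ) ^ 2 ≤ ‖ξ‖ ^ 2 := fun j => by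
      have : |(ξ.1 j : ℝ)| ≤ ‖ξ‖ := by
        have := (norm_le_pi_norm ξ.1 j).trans (norm_fst_le ξ)
        rwa [Int.norm_eq_abs] at this
      rw [← sq_abs]
      gcongr
    calc ‖ξ.2‖ ^ 2 + ∑ j, (ξ.1 j : ℝ) ^ 2 ≤ ‖ξ‖ ^ 2 + ∑ _j : Fin d₂, ‖ξ‖ ^ 2 := by
          exact add_le_add h2 (Finset.sum_le_sum fun j _ => h3 j)
      _ = (1 + d₂) * ‖ξ‖ ^ 2 := by simp; ring
      _ ≤ (1 + d₂) ^ 2 * ‖ξ‖ ^ 2 := by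
          gcongr
          nlinarith [(Nat.cast_nonneg d₂ : (0 : ℝ) ≤ d₂)]
      _ = _ := by ring
  exact (pow_le_pow_iff_left₀ (norm_nonneg _) (by positivity) two_ne_zero).1 h1

/-- The inequality 1 + x ≤ e^x at x = br/(n+1), raised to the power `n`; the denominator `n + 1`
avoids dividing by zero. -/
lemma exists_one_add_pow_le_exp (n : ℕ) {b : ℝ} (hb : 0 < b) :
    ∃ C : ℝ≥0, ∀ r : ℝ, 0 ≤ r → (1 + r) ^ n ≤ C * Real.exp (b * r) := by
  set m : ℝ := max 1 ((n + 1) / b) with hm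
  have hm1 : 1 ≤ m := le_max_left _ _
  refine ⟨(m ^ n).toNNReal, fun r hr => ?_⟩
  rw [Real.coe_toNNReal _ (by positivity)]
  have h1 : 1 + r ≤ m * Real.exp (b * r / (n + 1)) := by
    have h2 : (n + 1) / b ≤ m := le_max_right _ _
    calc 1 + r = 1 + (n + 1) / b * (b * r / (n + 1)) := by field_simp
      _ ≤ m * 1 + m * (b * r / (n + 1)) := by
          rw [mul_one]
          gcongr
      _ = m * (b * r / (n + 1) + 1) := by ring
      _ ≤ _ := by gcongr; exact Real.add_one_le_exp _
  calc (1 + r) ^ n ≤ (m * Real.exp (b * r / (n + 1))) ^ n := by gcongr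
    _ = m ^ n * Real.exp (n * (b * r / (n + 1))) := by rw [mul_pow, ← Real.exp_nat_mul]
    _ ≤ m ^ n * Real.exp (b * r) := by
        refine mul_le_mul_of_nonneg_left (Real.exp_le_exp.2 ?_) (by positivity)
        rw [mul_div_assoc', div_le_iff₀ (by positivity)]
        nlinarith [mul_nonneg hb.le hr]

lemma exists_freq_pow_le_expWeight (n : ℕ) {a : ℝ≥0} (ha : 0 < a) :
    ∃ C : ℝ≥0, ∀ ξ : Freq d₁ d₂,
      ENNReal.ofReal ((1 + ‖freqEmb ξ‖) ^ n) ≤ C * expWeight a ξ := by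
  obtain ⟨C, hC⟩ := exists_one_add_pow_le_exp n (b := a / (1 + d₂))
    (div_pos (NNReal.coe_pos.2 ha) (by positivity))
  refine ⟨C, fun ξ => ?_⟩
  rw [expWeight, ← ENNReal.ofReal_coe_nnreal, ← ENNReal.ofReal_mul C.coe_nonneg]
  refine ENNReal.ofReal_le_ofReal ((hC _ (norm_nonneg _)).trans ?_)
  refine mul_le_mul_of_nonneg_left (Real.exp_le_exp.2 ?_) C.coe_nonneg
  rw [div_mul_eq_mul_div, div_le_iff₀ (by positivity)]
  calc (a : ℝ) * ‖freqEmb ξ‖ ≤ a * ((1 + d₂) * ‖ξ‖) := by gcongr; exact norm_freqEmb_le ξ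
    _ = _ := by ring

lemma sobolevWeight_le_pow {σ : ℝ} {n : ℕ} (hn : σ ≤ n) {r : ℝ} (hr : 0 ≤ r) :
    sobolevWeight σ r ≤ (1 + r) ^ n := by
  have h1 : 1 ≤ (1 + r) ^ n := one_le_pow₀ (by linarith)
  unfold sobolevWeight
  split_ifs with h
  · calc (1 + r ^ 2) ^ (σ / 2) ≤ ((1 + r) ^ 2) ^ (σ / 2) := by
          refine Real.rpow_le_rpow (by positivity) (by nlinarith) (by positivity)
      _ = (1 + r) ^ σ := by
          rw [← Real.rpow_natCast, ← Real.rpow_mul (by positivity)]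
          congr 1
          push_cast
          ring
      _ ≤ (1 + r) ^ (n : ℝ) := Real.rpow_le_rpow_of_exponent_le (by linarith) hn
      _ = _ := Real.rpow_natCast _ _
  · exact (Real.rpow_le_one_of_one_le_of_nonpos (le_max_left _ _) (not_le.1 h).le).trans h1

lemma freqWeight_sq_le {σ : ℝ} {n : ℕ} (hn : σ ≤ n) (ξ : Freq d₁ d₂) :
    freqWeight σ ξ ^ 2 ≤ ENNReal.ofReal ((1 + ‖freqEmb ξ‖) ^ (2 * n)) := by
  rw [mul_comm, pow_mul, ENNReal.ofReal_pow (by positivity)]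
  gcongr
  exact ENNReal.ofReal_le_ofReal (sobolevWeight_le_pow hn (norm_nonneg _))

lemma exists_freqWeight_le_expWeight (σ : ℝ) {a : ℝ≥0} (ha : 0 < a) :
    ∃ C : ℝ≥0, ∀ ξ : Freq d₁ d₂, freqWeight σ ξ ^ 2 ≤ C * expWeight a ξ := by
  obtain ⟨n, hn⟩ := exists_nat_ge σ
  obtain ⟨C, hC⟩ := exists_freq_pow_le_expWeight (d₁ := d₁) (d₂ := d₂) (2 * n) ha
  exact ⟨C, fun ξ => (freqWeight_sq_le hn ξ).trans (hC ξ)⟩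

section Bounded

variable {a : ℝ≥0} {B : ℝ} (f : WeightedL1 (freqMeasure d₁ d₂) a)

/-- Interpolation between L^∞ and weighted L¹: one of the two factors of `f` is estimated by `B`,
and the exponential weight absorbs `W`. This is how sup bounds and algebra norms give
square-integrability in every Sobolev norm. -/
lemma lintegral_weight_sq_le {W : Freq d₁ d₂ → ℝ≥0∞} {C : ℝ≥0} (hW : ∀ ξ, W ξ ≤ C * expWeight a ξ)
    (hB : ∀ᵐ ξ ∂(freqMeasure d₁ d₂), ‖f ξ‖ ≤ B) :
    ∫⁻ ξ, W ξ * ‖f ξ‖ₑ ^ 2 ∂(freqMeasure d₁ d₂) ≤ C * ENNReal.ofReal B * ‖f‖ₑ := by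
  rw [enorm_eq, ← lintegral_const_mul' _ _ (by finiteness)]
  refine lintegral_mono_ae ?_
  filter_upwards [hB] with ξ hξ
  have h1 : ‖f ξ‖ₑ ≤ ENNReal.ofReal B := by
    rw [← ofReal_norm]; exact ENNReal.ofReal_le_ofReal hξ
  calc W ξ * ‖f ξ‖ₑ ^ 2 ≤ (C * expWeight a ξ) * (ENNReal.ofReal B * ‖f ξ‖ₑ) := by
        rw [sq]
        gcongr
        exact hW ξ
    _ = _ := by ring

lemma memLp_two_of_bounded (hB : ∀ᵐ ξ ∂(freqMeasure d₁ d₂), ‖f ξ‖ ≤ B) :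
    MemLp f 2 (freqMeasure d₁ d₂) := by
  refine ⟨f.aesm, ?_⟩
  rw [eLpNorm_lt_top_iff_lintegral_rpow_enorm_lt_top two_ne_zero ENNReal.ofNat_ne_top]
  have h := lintegral_weight_sq_le f (W := 1) (C := 1)
    (fun ξ => by simpa using one_le_expWeight a ξ) hB
  refine lt_of_le_of_lt ?_ (h.trans_lt (by finiteness))
  simp

lemma sobolevNorm_synth_lt_top (ha : 0 < a) (hB : ∀ᵐ ξ ∂(freqMeasure d₁ d₂), ‖f ξ‖ ≤ B) (σ : ℝ) :
    sobolevNorm σ (synth f) < ⊤ := by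
  obtain ⟨C, hC⟩ := exists_freqWeight_le_expWeight (d₁ := d₁) (d₂ := d₂) σ ha
  rw [sobolevNorm_synth σ f.integrable (memLp_two_of_bounded f hB)]
  simp only [mul_pow]
  have h := (lintegral_weight_sq_le f hC hB).trans_lt (by finiteness : _ < ⊤)
  exact ENNReal.mul_lt_top ENNReal.ofReal_lt_top (ENNReal.rpow_lt_top_of_nonneg (by norm_num) h.ne)

lemma integrable_moment_weightedL1 (ha : 0 < a) (n : ℕ) :
    Integrable (fun ξ => ‖freqEmb ξ‖ ^ n * ‖f ξ‖) (freqMeasure d₁ d₂) := by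
  obtain ⟨C, hC⟩ := exists_freq_pow_le_expWeight (d₁ := d₁) (d₂ := d₂) n ha
  have h := integrable_mul (a := a) (μ := freqMeasure d₁ d₂)
    (h := fun ξ => ((‖freqEmb ξ‖ ^ n : ℝ) : ℂ)) (C := C)
    (Complex.measurable_ofReal.comp (continuous_freqEmb.norm.measurable.pow_const n))
    (fun ξ => by
      rw [← ofReal_norm, Complex.norm_real, Real.norm_of_nonneg (by positivity)]
      refine le_trans (ENNReal.ofReal_le_ofReal ?_) (hC ξ)
      gcongr
      linarith) f
  refine h.norm.congr (Eventually.of_forall fun ξ => ?_)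
  simp only [norm_mul, Complex.norm_real, Real.norm_of_nonneg (pow_nonneg (norm_nonneg _) n)]

end Bounded

end Norms

/-! ### Integrable weights on the dual group and weighted Cauchy–Schwarz. -/

section Summability

open scoped NNReal
open WeightedL1

variable {d₁ d₂ : ℕ}

lemma tsum_pi_prod_le {n : ℕ} (g : ℤ → ℝ≥0∞) :
    ∑' k : Fin n → ℤ, ∏ j, g (k j) ≤ (∑' m, g m) ^ n := by
  classical
  rw [ENNReal.tsum_eq_iSup_sum]
  refine iSup_le fun s => ?_
  calc ∑ k ∈ s, ∏ j, g (k j)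
      ≤ ∑ k ∈ Fintype.piFinset fun j => s.image fun k => k j, ∏ j, g (k j) := by
        refine Finset.sum_le_sum_of_subset fun k hk => ?_
        exact Fintype.mem_piFinset.2 fun j => Finset.mem_image_of_mem _ hk
    _ = ∏ j, ∑ m ∈ s.image fun k => k j, g m := (Finset.prod_univ_sum _ _).symm
    _ ≤ ∏ _j : Fin n, ∑' m, g m := Finset.prod_le_prod' fun j _ => ENNReal.sum_le_tsum _
    _ = _ := by simp

/-- A summable weight on `ℤⁿ`. -/
def latticeWeight {n : ℕ} (k : Fin n → ℤ) : ℝ := ∏ j, (1 + (k j : ℝ) ^ 2)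

lemma one_le_latticeWeight {n : ℕ} (k : Fin n → ℤ) : 1 ≤ latticeWeight k := by
  calc (1 : ℝ) = ∏ _j : Fin n, 1 := by simp
    _ ≤ _ := Finset.prod_le_prod (fun _ _ => zero_le_one) fun j _ => by
      nlinarith [sq_nonneg (k j : ℝ)]

lemma tsum_inv_latticeWeight_lt_top (n : ℕ) :
    ∑' k : Fin n → ℤ, (ENNReal.ofReal (latticeWeight k))⁻¹ < ⊤ := by
  have h1 : ∀ k : Fin n → ℤ, (ENNReal.ofReal (latticeWeight k))⁻¹ =
      ∏ j, ENNReal.ofReal ((1 + (k j : ℝ) ^ 2)⁻¹) := fun k => by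
    rw [← ENNReal.ofReal_prod_of_nonneg fun j _ => by positivity, Finset.prod_inv_distrib,
      ← ENNReal.ofReal_inv_of_pos (zero_lt_one.trans_le (one_le_latticeWeight k)), latticeWeight]
  simp only [h1]
  refine (tsum_pi_prod_le fun m : ℤ => ENNReal.ofReal ((1 + (m : ℝ) ^ 2)⁻¹)).trans_lt ?_
  refine ENNReal.pow_lt_top ?_
  have hs : Summable fun m : ℤ => (1 + (m : ℝ) ^ 2)⁻¹ := by
    have h2 : Summable fun m : ℤ => 1 / (m : ℝ) ^ 2 := Real.summable_one_div_int_pow.2 (by norm_num)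
    have h3 : Summable fun m : ℤ => if m = 0 then (1 : ℝ) else 0 :=
      (hasSum_ite_eq (0 : ℤ) (1 : ℝ)).summable
    refine Summable.of_nonneg_of_le (fun m => by positivity) (fun m => ?_) (h2.add h3)
    by_cases hm : m = 0
    · simp [hm]
    · have : (0 : ℝ) < (m : ℝ) ^ 2 := by positivity
      rw [if_neg hm, add_zero, one_div]
      gcongr
      linarith
  rw [← ENNReal.ofReal_tsum_of_nonneg (fun m => by positivity) hs]
  exact ENNReal.ofReal_lt_top

/-- A weight on the dual group whose inverse is integrable. -/
def freqJ (ξ : Freq d₁ d₂) : ℝ := latticeWeight ξ.1 * (1 + ‖ξ.2‖ ^ 2) ^ (d₁ + 1)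

lemma one_le_freqJ (ξ : Freq d₁ d₂) : 1 ≤ freqJ ξ :=
  one_le_mul_of_one_le_of_one_le (one_le_latticeWeight _)
    (one_le_pow₀ (by nlinarith [sq_nonneg ‖ξ.2‖]))

lemma measurable_freqJ : Measurable (freqJ : Freq d₁ d₂ → ℝ) := by
  refine measurable_from_prod_countable_right fun k => ?_
  simp only [freqJ]
  fun_prop

lemma lintegral_inv_freqJ_lt_top :
    ∫⁻ ξ, (ENNReal.ofReal (freqJ ξ))⁻¹ ∂(freqMeasure d₁ d₂) < ⊤ := by
  have h1 : ∀ ξ : Freq d₁ d₂, (ENNReal.ofReal (freqJ ξ))⁻¹ =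
      (ENNReal.ofReal (latticeWeight ξ.1))⁻¹ *
        ENNReal.ofReal ((1 + ‖ξ.2‖ ^ 2) ^ (-(2 * d₁ + 2 : ℝ) / 2)) := fun ξ => by
    have h0 : (0 : ℝ) < 1 + ‖ξ.2‖ ^ 2 := by positivity
    rw [freqJ, ENNReal.ofReal_mul (zero_le_one.trans (one_le_latticeWeight _)),
      ENNReal.mul_inv (by right; finiteness) (by left; finiteness),
      ← ENNReal.ofReal_inv_of_pos (pow_pos h0 _)]
    congr 2
    rw [show -(2 * d₁ + 2 : ℝ) / 2 = -((d₁ + 1 : ℕ) : ℝ) by push_cast; ring,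
      Real.rpow_neg h0.le, Real.rpow_natCast]
  have h2 : Integrable (fun ξ : EuclideanSpace ℝ (Fin d₁) =>
      (1 + ‖ξ‖ ^ 2) ^ (-(2 * d₁ + 2 : ℝ) / 2)) :=
    integrable_rpow_neg_one_add_norm_sq (by
      rw [finrank_euclideanSpace_fin]; linarith [(Nat.cast_nonneg d₁ : (0 : ℝ) ≤ d₁)])
  simp only [h1]
  have h3 := lintegral_prod_mul (μ := (Measure.count : Measure (Fin d₂ → ℤ)))
    (f := fun k => (ENNReal.ofReal (latticeWeight k))⁻¹) (measurable_of_countable _).aemeasurable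
    h2.aestronglyMeasurable.aemeasurable.ennreal_ofReal
  rw [h3, lintegral_count]
  exact ENNReal.mul_lt_top (tsum_inv_latticeWeight_lt_top _) h2.lintegral_lt_top

lemma latticeWeight_le (ξ : Freq d₁ d₂) : latticeWeight ξ.1 ≤ (1 + ‖freqEmb ξ‖) ^ (2 * d₂) := by
  have h : ∀ j, 1 + (ξ.1 j : ℝ) ^ 2 ≤ (1 + ‖freqEmb ξ‖) ^ 2 := fun j => by
    have h1 : (ξ.1 j : ℝ) ^ 2 ≤ ‖freqEmb ξ‖ ^ 2 := by
      rw [norm_freqEmb_sq, freqSq]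
      have := Finset.single_le_sum (f := fun j => (ξ.1 j : ℝ) ^ 2) (fun i _ => sq_nonneg _)
        (Finset.mem_univ j)
      nlinarith [sq_nonneg ‖ξ.2‖]
    nlinarith [norm_nonneg (freqEmb ξ)]
  calc latticeWeight ξ.1 ≤ ∏ _j : Fin d₂, (1 + ‖freqEmb ξ‖) ^ 2 :=
        Finset.prod_le_prod (fun j _ => by positivity) fun j _ => h j
    _ = _ := by simp [pow_mul]

lemma freqJ_le (ξ : Freq d₁ d₂) : freqJ ξ ≤ (1 + ‖freqEmb ξ‖) ^ (2 * (d₂ + (d₁ + 1))) := by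
  rw [freqJ, mul_add 2, pow_add (1 + ‖freqEmb ξ‖), pow_mul (1 + ‖freqEmb ξ‖) 2 (d₁ + 1)]
  have h : 1 + ‖ξ.2‖ ^ 2 ≤ (1 + ‖freqEmb ξ‖) ^ 2 := by
    have h1 : ‖ξ.2‖ ^ 2 ≤ ‖freqEmb ξ‖ ^ 2 := by
      rw [norm_freqEmb_sq, freqSq]
      exact le_add_of_nonneg_right (Finset.sum_nonneg fun i _ => sq_nonneg _)
    nlinarith [norm_nonneg (freqEmb ξ)]
  gcongr
  exact latticeWeight_le ξ

lemma lintegral_mul_sq_le {α : Type*} [MeasurableSpace α] (μ : Measure α) {f g : α → ℝ≥0∞}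
    (hf : AEMeasurable f μ) (hg : AEMeasurable g μ) :
    (∫⁻ x, f x * g x ∂μ) ^ 2 ≤ (∫⁻ x, f x ^ 2 ∂μ) * ∫⁻ x, g x ^ 2 ∂μ := by
  have h := ENNReal.lintegral_mul_le_Lp_mul_Lq μ Real.HolderConjugate.two_two hf hg
  simp only [ENNReal.rpow_two, Pi.mul_apply] at h
  calc (∫⁻ x, f x * g x ∂μ) ^ 2
      ≤ ((∫⁻ x, f x ^ 2 ∂μ) ^ (1 / 2 : ℝ) * (∫⁻ x, g x ^ 2 ∂μ) ^ (1 / 2 : ℝ)) ^ 2 := by gcongr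
    _ = _ := by
      rw [mul_pow, ← ENNReal.rpow_natCast, ← ENNReal.rpow_natCast, ← ENNReal.rpow_mul,
        ← ENNReal.rpow_mul]
      norm_num

/-- Cauchy–Schwarz with the weight `w`. -/
lemma lintegral_sq_le_weight {α : Type*} [MeasurableSpace α] (μ : Measure α) {f w : α → ℝ≥0∞}
    (hf : AEMeasurable f μ) (hw : AEMeasurable w μ) (hw₀ : ∀ x, w x ≠ 0) (hw₁ : ∀ x, w x ≠ ⊤) :
    (∫⁻ x, f x ∂μ) ^ 2 ≤ (∫⁻ x, (w x)⁻¹ ∂μ) * ∫⁻ x, w x * f x ^ 2 ∂μ := by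
  have h1 : ∀ x, (w x ^ (1 / 2 : ℝ)) ^ 2 = w x := fun x => by
    rw [← ENNReal.rpow_natCast, ← ENNReal.rpow_mul]; norm_num
  have h := lintegral_mul_sq_le μ (f := fun x => (w x ^ (1 / 2 : ℝ))⁻¹)
    (g := fun x => w x ^ (1 / 2 : ℝ) * f x) (hw.pow_const _).inv ((hw.pow_const _).mul hf)
  simp only [mul_pow, h1, ← ENNReal.inv_pow] at h
  refine le_trans (le_of_eq ?_) h
  congr 1
  refine lintegral_congr fun x => ?_
  rw [← mul_assoc, ENNReal.inv_mul_cancel, one_mul]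
  · exact (ENNReal.rpow_pos (pos_iff_ne_zero.2 (hw₀ x)) (hw₁ x)).ne'
  · exact ENNReal.rpow_ne_top_of_nonneg (by norm_num) (hw₁ x)

end Summability

/-! ### Integration over the fundamental domain. -/

section FundamentalDomain

open WeightedL1
open scoped NNReal

variable {d₁ d₂ : ℕ}

lemma lintegral_fundDomainZ {G : NLSCover d₁ d₂ → ℝ≥0∞} (hG : Measurable G) :
    ∫⁻ z in fundDomainZ d₁ d₂, G z = ∫⁻ x, ∫⁻ y in torusBox d₂, G (NLSCover.mk x y) := by
  set e : EuclideanSpace ℝ (Fin d₁) × (Fin d₂ → ℝ) → NLSCover d₁ d₂ :=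
    fun p => NLSCover.mk p.1 p.2 with he
  have hmp : MeasurePreserving e (volume.prod volume) volume := by
    have h1 := (PiLp.volume_preserving_ofLp (Fin d₁)).prod
      (MeasurePreserving.id (volume : Measure (Fin d₂ → ℝ)))
    have h2 := volume_measurePreserving_sumPiEquivProdPi_symm
      (fun _ : Fin d₁ ⊕ Fin d₂ => ℝ)
    have h3 := PiLp.volume_preserving_toLp (Fin d₁ ⊕ Fin d₂)
    exact h3.comp (h2.comp h1)
  have hem : MeasurableEmbedding e := by
    refine continuous_mk.measurableEmbedding fun p q h => Prod.ext (PiLp.ext fun i => ?_)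
      (funext fun j => ?_)
    · exact congrArg (fun z : NLSCover d₁ d₂ => z (Sum.inl i)) h
    · exact congrArg (fun z : NLSCover d₁ d₂ => z (Sum.inr j)) h
  have hpre : e ⁻¹' fundDomainZ d₁ d₂ = univ ×ˢ torusBox d₂ := by
    ext p
    simp [he, fundDomainZ, NLSCover.mk, torusBox]
  rw [← hmp.setLIntegral_comp_preimage_emb hem, hpre,
    ← Measure.prod_restrict, Measure.restrict_univ,
    lintegral_prod (fun p => G (e p)) (hG.comp continuous_mk.measurable).aemeasurable]

lemma memLp_fundDomainZ_iff {g : NLSCover d₁ d₂ → ℂ} (hg : Continuous g) :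
    MemLp g 2 (volume.restrict (fundDomainZ d₁ d₂)) ↔
      ∫⁻ x, ∫⁻ y in torusBox d₂, ‖g (NLSCover.mk x y)‖ₑ ^ 2 < ⊤ := by
  rw [MemLp, and_iff_right hg.aestronglyMeasurable,
    eLpNorm_lt_top_iff_lintegral_rpow_enorm_lt_top two_ne_zero ENNReal.ofNat_ne_top,
    ← lintegral_fundDomainZ (hg.enorm.measurable.pow_const 2)]
  simp

lemma continuous_comp_mk {g : NLSCover d₁ d₂ → ℂ} (hg : Continuous g)
    (x : EuclideanSpace ℝ (Fin d₁)) : Continuous fun y : Fin d₂ → ℝ => g (NLSCover.mk x y) :=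
  hg.comp (continuous_mk.comp (continuous_const.prodMk continuous_id))

lemma enorm_periodicCoeff_sq_le {g : NLSCover d₁ d₂ → ℂ} (hg : Continuous g) (k : Fin d₂ → ℤ)
    (x : EuclideanSpace ℝ (Fin d₁)) : ‖periodicCoeff g k x‖ₑ ^ 2 ≤
      ENNReal.ofReal ((Real.sqrt (2 * Real.pi))⁻¹ ^ d₂) ^ 2 * (volume (torusBox d₂) *
        ∫⁻ y in torusBox d₂, ‖g (NLSCover.mk x y)‖ₑ ^ 2) := by
  rw [periodicCoeff, enorm_mul, mul_pow, ← ofReal_norm (((Real.sqrt (2 * Real.pi))⁻¹ ^ d₂ : ℝ) : ℂ),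
    Complex.norm_real, Real.norm_of_nonneg (by positivity)]
  gcongr
  refine le_trans (pow_le_pow_left' (enorm_integral_le_lintegral_enorm _) 2) ?_
  have h := lintegral_mul_sq_le (volume.restrict (torusBox d₂)) (f := fun _ => 1)
    (g := fun y => ‖g (NLSCover.mk x y)‖ₑ) aemeasurable_const
    (continuous_comp_mk hg x).enorm.aemeasurable
  simp only [one_mul, one_pow, lintegral_one, Measure.restrict_apply_univ] at h
  refine le_trans (le_of_eq ?_) h
  congr 1
  refine lintegral_congr fun y => ?_
  rw [enorm_mul, neg_mul, enorm_phase, mul_one]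

lemma stronglyMeasurable_periodicCoeff {g : NLSCover d₁ d₂ → ℂ} (hg : Continuous g)
    (k : Fin d₂ → ℤ) : StronglyMeasurable (periodicCoeff g k) := by
  refine StronglyMeasurable.const_mul ?_ _
  refine StronglyMeasurable.integral_prod_right (f := fun (x : EuclideanSpace ℝ (Fin d₁))
    (y : Fin d₂ → ℝ) => g (NLSCover.mk x y) *
      Complex.exp (-Complex.I * ((∑ j, (k j : ℝ) * y j : ℝ) : ℂ))) ?_
  refine Continuous.stronglyMeasurable ?_
  exact (hg.comp continuous_mk).mul (by fun_prop)

lemma memLp_periodicCoeff {g : NLSCover d₁ d₂ → ℂ} (hg : Continuous g)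
    (hg2 : MemLp g 2 (volume.restrict (fundDomainZ d₁ d₂))) (k : Fin d₂ → ℤ) :
    MemLp (periodicCoeff g k) 2 := by
  refine ⟨(stronglyMeasurable_periodicCoeff hg k).aestronglyMeasurable, ?_⟩
  rw [eLpNorm_lt_top_iff_lintegral_rpow_enorm_lt_top two_ne_zero ENNReal.ofNat_ne_top]
  simp only [ENNReal.toReal_ofNat, ENNReal.rpow_ofNat]
  refine (lintegral_mono (enorm_periodicCoeff_sq_le hg k)).trans_lt ?_
  have hm : Measurable fun x => ∫⁻ y in torusBox d₂, ‖g (NLSCover.mk x y)‖ₑ ^ 2 :=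
    ((hg.comp continuous_mk).enorm.measurable.pow_const 2).lintegral_prod_right'
  rw [lintegral_const_mul _ (hm.const_mul _), lintegral_const_mul _ hm]
  exact ENNReal.mul_lt_top (by finiteness)
    (ENNReal.mul_lt_top volume_torusBox_lt_top ((memLp_fundDomainZ_iff hg).1 hg2))

end FundamentalDomain

/-! ### Bounded elements of the weighted algebra synthesize functions in H^∞. -/

section Smooth

open scoped NNReal
open WeightedL1

lemma lintegral_enorm_fourierInv_sq {V : Type*} [NormedAddCommGroup V] [InnerProductSpace ℝ V]
    [MeasurableSpace V] [BorelSpace V] [FiniteDimensional ℝ V] {F : V → ℂ} (hF : Integrable F)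
    (hF2 : MemLp F 2) : ∫⁻ x, ‖𝓕⁻ F x‖ₑ ^ 2 = ∫⁻ x, ‖F x‖ₑ ^ 2 := by
  have h1 : eLpNorm (𝓕⁻ F) 2 volume = eLpNorm F 2 volume := by
    rw [← eLpNorm_congr_ae (coe_fourierInv_toLp hF hF2), ← eLpNorm_congr_ae hF2.coeFn_toLp,
      ← Lp.enorm_def, ← Lp.enorm_def, ← ofReal_norm, ← ofReal_norm]
    congr 1
    have := Lp.norm_fourier_eq (𝓕⁻ (hF2.toLp F) : Lp ℂ 2 (volume : Measure V))
    rw [FourierTransform.fourier_fourierInv_eq] at this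
    exact this.symm
  rw [eLpNorm_eq_lintegral_rpow_enorm_toReal two_ne_zero ENNReal.ofNat_ne_top,
    eLpNorm_eq_lintegral_rpow_enorm_toReal two_ne_zero ENNReal.ofNat_ne_top] at h1
  simp only [ENNReal.toReal_ofNat, ENNReal.rpow_ofNat] at h1
  exact ENNReal.rpow_left_injective (x := 1 / 2) (by norm_num) h1

variable {d₁ d₂ : ℕ}

lemma lintegral_comp_smul {V : Type*} [NormedAddCommGroup V] [NormedSpace ℝ V]
    [MeasurableSpace V] [BorelSpace V] [FiniteDimensional ℝ V] (ν : Measure V)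
    [ν.IsAddHaarMeasure] (g : V → ℝ≥0∞) {r : ℝ} (hr : r ≠ 0) :
    ∫⁻ x, g (r • x) ∂ν = ENNReal.ofReal |(r ^ Module.finrank ℝ V)⁻¹| * ∫⁻ x, g x ∂ν := by
  rw [← smul_eq_mul, ← lintegral_smul_measure, ← Measure.map_addHaar_smul ν hr,
    (measurableEmbedding_const_smul₀ hr).lintegral_map]

variable {a : ℝ≥0} {B : ℝ} (f : WeightedL1 (freqMeasure d₁ d₂) a)

lemma exists_lintegral_periodicCoeff_sq_le (d₁ d₂ : ℕ) : ∃ C : ℝ≥0, ∀ {f : Freq d₁ d₂ → ℂ},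
    Integrable f (freqMeasure d₁ d₂) → MemLp f 2 (freqMeasure d₁ d₂) → ∀ k,
      ∫⁻ x, ‖periodicCoeff (synth f) k x‖ₑ ^ 2 = C * ∫⁻ ξ, ‖f (k, ξ)‖ₑ ^ 2 := by
  set c : ℂ := ((Real.sqrt (2 * Real.pi) ^ d₂ * (2 * Real.pi) ^ d₁ : ℝ) : ℂ) with hc
  set r : ℝ := |((2 * Real.pi) ^ d₁)⁻¹| with hr
  refine ⟨‖c‖₊ ^ 2 * r.toNNReal, fun {f} hf hf2 k => ?_⟩
  obtain ⟨h1, h2⟩ := comp_two_pi_smul hf hf2 k c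
  rw [periodicCoeff_synth_eq_fourierInv hf k, lintegral_enorm_fourierInv_sq h1 h2]
  simp only [enorm_mul, mul_pow]
  rw [lintegral_const_mul' _ _ (by finiteness),
    lintegral_comp_smul volume (fun ξ => ‖f (k, ξ)‖ₑ ^ 2) (by positivity),
    finrank_euclideanSpace_fin, ← hr, ← mul_assoc, ENNReal.coe_mul, ENNReal.coe_pow]
  rfl

/-- The triangle inequality for the Fourier series in the periodic variables; a factor (2π)^{-d₂/2}
is dropped, being at most 1. -/
lemma enorm_synth_mk_le {f : Freq d₁ d₂ → ℂ} (hf : Integrable f (freqMeasure d₁ d₂))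
    (x : EuclideanSpace ℝ (Fin d₁)) (y : Fin d₂ → ℝ) :
    ‖synth f (NLSCover.mk x y)‖ₑ ≤ ∑' k, ‖periodicCoeff (synth f) k x‖ₑ := by
  have hi := integrable_freqChar_mul hf (NLSCover.mk x y)
  rw [synth, integral_prod _ hi]
  refine (enorm_integral_le_lintegral_enorm _).trans ?_
  rw [lintegral_count]
  refine ENNReal.tsum_le_tsum fun k => ?_
  rw [periodicCoeff_synth hf]
  have h1 : ∀ ξ : EuclideanSpace ℝ (Fin d₁), freqChar (NLSCover.mk x y) (k, ξ) * f (k, ξ) =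
      Complex.exp (Complex.I * ((∑ j, (k j : ℝ) * y j : ℝ) : ℂ)) *
        (Complex.exp (Complex.I * (inner ℝ ξ x : ℝ)) * f (k, ξ)) := fun ξ => by
    rw [freqChar, inner_freqEmb_mk, ← mul_assoc, ← Complex.exp_add]
    push_cast
    ring_nf
  simp only [h1]
  rw [integral_const_mul, enorm_mul, enorm_mul]
  gcongr
  rw [← ofReal_norm, ← ofReal_norm, mul_comm Complex.I, Complex.norm_exp_ofReal_mul_I,
    Complex.norm_real]
  refine ENNReal.ofReal_le_ofReal ?_
  rw [Real.norm_of_nonneg (by positivity)]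
  refine one_le_pow₀ (Real.one_le_sqrt.2 ?_)
  linarith [Real.pi_gt_three]

lemma continuous_synth {f : Freq d₁ d₂ → ℂ} (hf : Integrable f (freqMeasure d₁ d₂)) :
    Continuous (synth f) := by
  refine continuous_of_dominated (F := fun z ξ => freqChar z ξ * f ξ) (bound := fun ξ => ‖f ξ‖)
    (fun z => (integrable_freqChar_mul hf z).1) (fun z => Eventually.of_forall fun ξ => ?_) hf.norm
    (Eventually.of_forall fun ξ => ?_)
  · rw [norm_mul, norm_freqChar, one_mul]
  · exact (continuous_freqChar_uncurry.comp (continuous_id.prodMk continuous_const)).mul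
      continuous_const

/-- Cauchy–Schwarz over the lattice with the summable `latticeWeight` takes the place of Parseval in
the periodic variables. The polynomial loss is absorbed by the exponential weight; in the other
variables Plancherel is applied slice by slice. -/
lemma memLp_synth (ha : 0 < a) (hB : ∀ᵐ ξ ∂(freqMeasure d₁ d₂), ‖f ξ‖ ≤ B) :
    MemLp (synth f) 2 (volume.restrict (fundDomainZ d₁ d₂)) := by
  have hf := f.integrable
  have hf2 := memLp_two_of_bounded f hB
  have hc := continuous_synth hf
  rw [memLp_fundDomainZ_iff hc]
  obtain ⟨C, hC⟩ := exists_lintegral_periodicCoeff_sq_le d₁ d₂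
  obtain ⟨C', hC'⟩ := exists_freq_pow_le_expWeight (d₁ := d₁) (d₂ := d₂) (2 * d₂) ha
  set S : ℝ≥0∞ := ∑' k : Fin d₂ → ℤ, (ENNReal.ofReal (latticeWeight k))⁻¹ with hS
  have hS' : S < ⊤ := tsum_inv_latticeWeight_lt_top d₂
  have hpos : ∀ k : Fin d₂ → ℤ, ENNReal.ofReal (latticeWeight k) ≠ 0 := fun k =>
    (ENNReal.ofReal_pos.2 (zero_lt_one.trans_le (one_le_latticeWeight k))).ne'
  have h1 : ∀ x : EuclideanSpace ℝ (Fin d₁), ∀ y, ‖synth f (NLSCover.mk x y)‖ₑ ^ 2 ≤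
      S * ∑' k, ENNReal.ofReal (latticeWeight k) * ‖periodicCoeff (synth f) k x‖ₑ ^ 2 := by
    intro x y
    have h2 := lintegral_sq_le_weight (Measure.count : Measure (Fin d₂ → ℤ))
      (f := fun k => ‖periodicCoeff (synth f) k x‖ₑ)
      (w := fun k => ENNReal.ofReal (latticeWeight k)) (measurable_of_countable _).aemeasurable
      (measurable_of_countable _).aemeasurable hpos fun k => ENNReal.ofReal_ne_top
    rw [lintegral_count, lintegral_count, lintegral_count] at h2
    exact (pow_le_pow_left' (enorm_synth_mk_le hf x y) 2).trans h2
  have hm : ∀ k, Measurable fun x : EuclideanSpace ℝ (Fin d₁) =>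
      ‖periodicCoeff (synth f) k x‖ₑ ^ 2 := fun k =>
    (stronglyMeasurable_periodicCoeff hc k).measurable.enorm.pow_const 2
  calc ∫⁻ x, ∫⁻ y in torusBox d₂, ‖synth f (NLSCover.mk x y)‖ₑ ^ 2
      ≤ ∫⁻ x, ∫⁻ _y in torusBox d₂, S * ∑' k, ENNReal.ofReal (latticeWeight k) *
          ‖periodicCoeff (synth f) k x‖ₑ ^ 2 :=
        lintegral_mono fun x => lintegral_mono fun y => h1 x y
    _ = S * volume (torusBox d₂) * ∑' k, ENNReal.ofReal (latticeWeight k) *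
          ∫⁻ x, ‖periodicCoeff (synth f) k x‖ₑ ^ 2 := by
        simp only [lintegral_const, Measure.restrict_apply_univ]
        rw [lintegral_mul_const' _ _ volume_torusBox_lt_top.ne, lintegral_const_mul' _ _ hS'.ne,
          lintegral_tsum fun k => ((hm k).const_mul _).aemeasurable]
        simp only [lintegral_const_mul' _ _ ENNReal.ofReal_ne_top]
        ring
    _ = S * volume (torusBox d₂) * (C * ∫⁻ ξ, ENNReal.ofReal (latticeWeight ξ.1) * ‖f ξ‖ₑ ^ 2
          ∂(freqMeasure d₁ d₂)) := by
        have hmf : Measurable fun ξ : Freq d₁ d₂ =>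
            ENNReal.ofReal (latticeWeight ξ.1) * ‖f ξ‖ₑ ^ 2 :=
          ((measurable_of_countable fun k : Fin d₂ → ℤ => ENNReal.ofReal (latticeWeight k)).comp
            measurable_fst).mul ((Lp.stronglyMeasurable f).measurable.enorm.pow_const 2)
        rw [lintegral_freqMeasure hmf, ← ENNReal.tsum_mul_left (a := (C : ℝ≥0∞))]
        congr 1
        refine tsum_congr fun k => ?_
        rw [hC hf hf2, mul_left_comm]
        exact congrArg _ (lintegral_const_mul' _ _ ENNReal.ofReal_ne_top).symm
    _ < ⊤ := by
        refine ENNReal.mul_lt_top (ENNReal.mul_lt_top hS' volume_torusBox_lt_top)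
          (ENNReal.mul_lt_top ENNReal.coe_lt_top ?_)
        exact (lintegral_weight_sq_le f (fun ξ => (ENNReal.ofReal_le_ofReal
          (latticeWeight_le ξ)).trans (hC' ξ)) hB).trans_lt (by finiteness)

lemma memHInfty_synth (ha : 0 < a) (hB : ∀ᵐ ξ ∂(freqMeasure d₁ d₂), ‖f ξ‖ ≤ B) :
    MemHInfty (synth f) where
  contDiff := contDiff_synth fun n => integrable_moment_weightedL1 f ha n
  periodic := isPeriodicZ_synth f
  memLp := memLp_synth f ha hB
  sobolevNorm_lt_top := sobolevNorm_synth_lt_top f ha hB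

end Smooth

/-! ### Differentiation in time of oscillating integrals. -/

section TimeDerivative

open scoped NNReal
open WeightedL1

lemma norm_exp_I_sub_one_sub_le (x : ℝ) :
    ‖Complex.exp (-(Complex.I * x)) - 1 + Complex.I * x‖ ≤ 3 * x ^ 2 := by
  have hn : ‖-(Complex.I * (x : ℂ))‖ = |x| := by simp
  rcases le_or_gt |x| 1 with h | h
  · have h1 := Complex.norm_exp_sub_one_sub_id_le (x := -(Complex.I * x)) (by rwa [hn])
    rw [hn, sq_abs, sub_neg_eq_add] at h1
    nlinarith [sq_nonneg x]
  · have h1 : ‖Complex.exp (-(Complex.I * x))‖ = 1 := by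
      rw [← mul_neg, ← Complex.ofReal_neg, mul_comm, Complex.norm_exp_ofReal_mul_I]
    calc _ ≤ ‖Complex.exp (-(Complex.I * x))‖ + ‖(1 : ℂ)‖ + ‖Complex.I * x‖ :=
          (norm_add_le _ _).trans (by gcongr; exact norm_sub_le _ _)
      _ = 2 + |x| := by rw [h1]; simp; norm_num
      _ ≤ 3 * x ^ 2 := by rw [← sq_abs x]; nlinarith

variable {G : Type*} [NormedAddCommGroup G] [MeasurableSpace G] [BorelSpace G]
  [SecondCountableTopology G] {μ : Measure G} {a : ℝ≥0}

/-- Differentiation of `t ↦ ∫ p(ξ) e^{-itQ(ξ)} v(t,ξ) dμ(ξ)`. -/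
lemma hasDerivWithinAt_integral_phase {p : G → ℂ} (hp : Measurable p) (hp1 : ∀ ξ, ‖p ξ‖ₑ = 1)
    {Q : G → ℝ} (hQ : Measurable Q) {C : ℝ≥0} (hQC : ∀ ξ, ENNReal.ofReal |Q ξ| ≤ C * expWeight a ξ)
    (hQC2 : ∀ ξ, ENNReal.ofReal (Q ξ ^ 2) ≤ C * expWeight a ξ) {v : ℝ → WeightedL1 μ a}
    {v' : WeightedL1 μ a} {s : Set ℝ} {t : ℝ} (hv : HasDerivWithinAt v v' s t) :
    HasDerivWithinAt (fun τ => ∫ ξ, p ξ * flow μ a Q hQ τ (v τ) ξ ∂μ)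
      ((∫ ξ, p ξ * flow μ a Q hQ t v' ξ ∂μ) -
        Complex.I * ∫ ξ, p ξ * ((Q ξ : ℂ) * flow μ a Q hQ t (v t) ξ) ∂μ) s t := by
  have hmE : ∀ τ : ℝ, Measurable fun ξ => Complex.exp (-(Complex.I * (τ * Q ξ : ℝ))) := fun τ =>
    measurable_phase (hQ.const_mul τ)
  have hbE : ∀ (τ : ℝ) ξ, ‖p ξ * Complex.exp (-(Complex.I * (τ * Q ξ : ℝ)))‖ₑ ≤
      (1 : ℝ≥0) * expWeight a ξ := fun τ ξ => by
    rw [enorm_mul, hp1, enorm_phase]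
    simpa using one_le_expWeight a ξ
  have hmQ : Measurable fun ξ => p ξ * ((Q ξ : ℂ) * Complex.exp (-(Complex.I * (t * Q ξ : ℝ)))) :=
    hp.mul ((Complex.measurable_ofReal.comp hQ).mul (hmE t))
  have hbQ : ∀ ξ, ‖p ξ * ((Q ξ : ℂ) * Complex.exp (-(Complex.I * (t * Q ξ : ℝ))))‖ₑ ≤
      C * expWeight a ξ := fun ξ => by
    rw [enorm_mul, enorm_mul, hp1, enorm_phase, one_mul, mul_one, ← ofReal_norm,
      Complex.norm_real, Real.norm_eq_abs]
    exact hQC ξ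
  set Λ : ℝ → WeightedL1 μ a →L[ℂ] ℂ := fun τ => pairing μ a _ (hp.mul (hmE τ)) 1 (hbE τ) with hΛ
  set D : WeightedL1 μ a →L[ℂ] ℂ := pairing μ a _ hmQ C hbQ with hD
  have hΛf : ∀ τ f, Λ τ f = ∫ ξ, p ξ * flow μ a Q hQ τ f ξ ∂μ := fun τ f => by
    rw [hΛ]
    simp only [pairing_apply]
    refine integral_congr_ae ?_
    filter_upwards [coe_flow (hQ := hQ) τ f] with ξ hξ
    rw [hξ]
    simp only [Pi.mul_apply]
    ring
  have hDf : ∀ f, D f = ∫ ξ, p ξ * ((Q ξ : ℂ) * flow μ a Q hQ t f ξ) ∂μ := fun f => by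
    rw [hD, pairing_apply]
    refine integral_congr_ae ?_
    filter_upwards [coe_flow (hQ := hQ) t f] with ξ hξ
    rw [hξ]
    ring
  -- The functionals Λ τ are differentiable in operator norm, although the flow itself need not be:
  -- the remainder of the phase is at most three times the square of its argument, and Q² is
  -- dominated by the exponential weight.
  have hbound : ∀ τ, ‖Λ τ - Λ t + ((τ - t : ℝ) * Complex.I) • D‖ ≤ 3 * C * (τ - t) ^ 2 := by
    intro τ
    refine ContinuousLinearMap.opNorm_le_bound _ (by positivity) fun f => ?_
    have e : (Λ τ - Λ t + ((τ - t : ℝ) * Complex.I) • D) f = ∫ ξ, p ξ *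
        ((Complex.exp (-(Complex.I * ((τ - t) * Q ξ : ℝ))) - 1 + Complex.I * ((τ - t) * Q ξ : ℝ)) *
          Complex.exp (-(Complex.I * (t * Q ξ : ℝ)))) * f ξ ∂μ := by
      rw [add_apply, sub_apply, smul_apply, hΛ, hD]
      simp only [pairing_apply]
      rw [smul_eq_mul, ← integral_const_mul, ← integral_sub, ← integral_add]
      · refine integral_congr_ae (Eventually.of_forall fun ξ => ?_)
        have h1 : Complex.exp (-(Complex.I * (τ * Q ξ : ℝ))) =
            Complex.exp (-(Complex.I * ((τ - t) * Q ξ : ℝ))) *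
              Complex.exp (-(Complex.I * (t * Q ξ : ℝ))) := by
          rw [← Complex.exp_add]
          congr 1
          push_cast
          ring
        simp only [Pi.mul_apply, h1]
        push_cast
        ring
      · exact (integrable_mul (hp.mul (hmE τ)) (hbE τ) f).sub
          (integrable_mul (hp.mul (hmE t)) (hbE t) f)
      · exact (integrable_mul hmQ hbQ f).const_mul _
      · exact integrable_mul (hp.mul (hmE τ)) (hbE τ) f
      · exact integrable_mul (hp.mul (hmE t)) (hbE t) f
    rw [e]
    have h2 := enorm_integral_mul_le (μ := μ) (a := a) (C := 3 * Real.toNNReal ((τ - t) ^ 2) * C)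
      (h := fun ξ => p ξ * ((Complex.exp (-(Complex.I * ((τ - t) * Q ξ : ℝ))) - 1 +
        Complex.I * ((τ - t) * Q ξ : ℝ)) * Complex.exp (-(Complex.I * (t * Q ξ : ℝ)))))
      (fun ξ => ?_) f
    · have h3 := ENNReal.toReal_mono (by finiteness) h2
      simp only [ENNReal.toReal_mul, toReal_enorm, ENNReal.coe_toReal, NNReal.coe_mul,
        Real.coe_toNNReal _ (sq_nonneg (τ - t))] at h3
      refine h3.trans (le_of_eq ?_)
      push_cast
      ring
    · rw [enorm_mul, enorm_mul, hp1, enorm_phase, one_mul, mul_one, ← ofReal_norm]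
      refine (ENNReal.ofReal_le_ofReal (norm_exp_I_sub_one_sub_le _)).trans ?_
      rw [mul_pow, ← mul_assoc, ENNReal.ofReal_mul (by positivity),
        ENNReal.ofReal_mul (by norm_num), ENNReal.coe_mul, mul_assoc _ (C : ℝ≥0∞)]
      gcongr
      · rw [ENNReal.coe_mul, ENNReal.ofReal, ENNReal.ofReal]
        simp
      · exact hQC2 ξ
  have hΛd : HasDerivAt Λ (-(Complex.I • D)) t := by
    have h1 : HasDerivAt (fun τ => Λ τ - Λ t + ((τ - t : ℝ) * Complex.I) • D) 0 t := by
      rw [hasDerivAt_iff_isLittleO]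
      have h2 : (fun τ => Λ τ - Λ t + ((τ - t : ℝ) * Complex.I) • D) =O[𝓝 t]
          fun τ => (τ - t) ^ 2 :=
        Asymptotics.IsBigO.of_bound (3 * C) (Eventually.of_forall fun τ => by
          rw [Real.norm_of_nonneg (sq_nonneg (τ - t))]; exact hbound τ)
      have h3 : (fun τ : ℝ => (τ - t) ^ 2) =o[𝓝 t] fun τ => τ - t := by
        have h4 : Tendsto (fun τ : ℝ => τ - t) (𝓝 t) (𝓝 0) := by
          have h5 : Continuous fun τ : ℝ => τ - t := by fun_prop
          simpa using h5.tendsto t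
        exact (Asymptotics.isLittleO_pow_id (𝕜 := ℝ) (n := 2) (by norm_num)).comp_tendsto h4
      have hz : Λ t - Λ t + ((t - t : ℝ) * Complex.I) • D = 0 := by
        ext f
        simp
      refine (h2.trans_isLittleO h3).congr (fun τ => ?_) fun _ => rfl
      rw [hz, smul_zero, sub_zero, sub_zero]
    have h5 : HasDerivAt (fun τ : ℝ => Λ t - ((τ - t : ℝ) * Complex.I) • D) (-(Complex.I • D)) t := by
      have h6 : HasDerivAt (fun τ : ℝ => ((τ - t : ℝ) : ℂ) * Complex.I) (1 * Complex.I) t :=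
        (((hasDerivAt_id t).sub_const t).ofReal_comp).mul_const Complex.I
      have h7 := (h6.smul_const D).const_sub (Λ t)
      simpa using h7
    have h8 := h1.add h5
    rw [zero_add] at h8
    refine h8.congr_of_eventuallyEq (Eventually.of_forall fun τ => ?_)
    simp
  -- Time is real while the functionals are complex linear; scalars are restricted so that the
  -- product rule for a moving functional applied to a moving vector is available.
  have hR := (ContinuousLinearMap.restrictScalarsL ℂ (WeightedL1 μ a) ℂ ℝ ℝ).hasFDerivAt
    |>.comp_hasDerivWithinAt t (hΛd.hasDerivWithinAt (s := s))
  have hfin : HasDerivWithinAt (fun τ => Λ τ (v τ)) ((-(Complex.I • D)) (v t) + Λ t v') s t :=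
    hR.clm_apply hv
  simp only [neg_apply, smul_apply, hΛf, hDf, smul_eq_mul] at hfin
  rwa [neg_add_eq_sub] at hfin

end TimeDerivative

/-! ### From the interaction equation to smooth solutions. -/

section Solution

open scoped NNReal
open WeightedL1

variable {d₁ d₂ : ℕ} {a : ℝ≥0}

lemma flow_neg_flow {G : Type*} [NormedAddCommGroup G] [MeasurableSpace G] [BorelSpace G]
    [SecondCountableTopology G] {μ : Measure G} {Q : G → ℝ} {hQ : Measurable Q} (t : ℝ)
    (f : WeightedL1 μ a) : flow μ a Q hQ t (flow μ a Q hQ (-t) f) = f := by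
  rw [flow_flow, add_neg_cancel, flow_zero]

lemma ae_flow_bound {G : Type*} [NormedAddCommGroup G] [MeasurableSpace G] [BorelSpace G]
    [SecondCountableTopology G] {μ : Measure G} {Q : G → ℝ} {hQ : Measurable Q} (t : ℝ)
    {f : WeightedL1 μ a} {B : ℝ} (hB : ∀ᵐ ξ ∂μ, ‖f ξ‖ ≤ B) :
    ∀ᵐ ξ ∂μ, ‖flow μ a Q hQ t f ξ‖ ≤ B := by
  filter_upwards [hB, coe_flow (hQ := hQ) t f] with ξ h1 h2
  rw [h2, norm_mul, ← toReal_enorm (Complex.exp _), enorm_phase]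
  simpa using h1

lemma exists_freqSq_le_expWeight (ha : 0 < a) : ∃ C : ℝ≥0, ∀ ξ : Freq d₁ d₂,
    ENNReal.ofReal |freqSq ξ| ≤ C * expWeight a ξ ∧
      ENNReal.ofReal (freqSq ξ ^ 2) ≤ C * expWeight a ξ := by
  obtain ⟨C, hC⟩ := exists_freq_pow_le_expWeight (d₁ := d₁) (d₂ := d₂) 4 ha
  refine ⟨C, fun ξ => ⟨(ENNReal.ofReal_le_ofReal ?_).trans (hC ξ),
    (ENNReal.ofReal_le_ofReal ?_).trans (hC ξ)⟩⟩
  · rw [← norm_freqEmb_sq, abs_of_nonneg (sq_nonneg _)]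
    calc ‖freqEmb ξ‖ ^ 2 ≤ (1 + ‖freqEmb ξ‖) ^ 2 := by gcongr; linarith
      _ ≤ (1 + ‖freqEmb ξ‖) ^ 4 :=
        pow_le_pow_right₀ (by linarith [norm_nonneg (freqEmb ξ)]) (by norm_num)
  · rw [← norm_freqEmb_sq, ← pow_mul]
    gcongr
    linarith

variable (d₁ d₂) in
/-- The field of the equation in the interaction representation. -/
abbrev fieldZ (a : ℝ≥0) (ε : ℝ) (k : ℕ) :
    ℝ → WeightedL1 (freqMeasure d₁ d₂) a → WeightedL1 (freqMeasure d₁ d₂) a :=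
  field (freqMeasure d₁ d₂) a freqSq measurable_freqSq ε k

variable (d₁ d₂) in
/-- The free evolution on the Fourier side. -/
abbrev flowZ (a : ℝ≥0) (t : ℝ) :
    WeightedL1 (freqMeasure d₁ d₂) a →ₗᵢ[ℂ] WeightedL1 (freqMeasure d₁ d₂) a :=
  flow (freqMeasure d₁ d₂) a freqSq measurable_freqSq t

/-- Convergence in the algebra together with a uniform sup bound gives convergence in every weighted
L² space, by the interpolation in `lintegral_weight_sq_le`. -/
lemma tendsto_sobolevNorm_synth_sub (ha : 0 < a) {B : ℝ} {f : ℝ → WeightedL1 (freqMeasure d₁ d₂) a}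
    {s : Set ℝ} {t₀ : ℝ} (hf : ContinuousWithinAt f s t₀) (ht₀ : t₀ ∈ s)
    (hB : ∀ t ∈ s, ∀ᵐ ξ ∂(freqMeasure d₁ d₂), ‖f t ξ‖ ≤ B) (σ : ℝ) :
    Tendsto (fun t => sobolevNorm σ (synth (f t) - synth (f t₀))) (𝓝[s] t₀) (𝓝 0) := by
  obtain ⟨C, hC⟩ := exists_freqWeight_le_expWeight (d₁ := d₁) (d₂ := d₂) σ ha
  have h1 : Tendsto (fun t => ENNReal.ofReal (synthConst d₁ d₂) *
      (C * ENNReal.ofReal (B + B) * ‖f t - f t₀‖ₑ) ^ (1 / 2 : ℝ)) (𝓝[s] t₀) (𝓝 0) := by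
    have h2 : Tendsto (fun t => ‖f t - f t₀‖ₑ) (𝓝[s] t₀) (𝓝 0) := by
      have h3 := (hf.tendsto.sub_const (f t₀)).enorm
      simpa using h3
    have h4 := ENNReal.Tendsto.const_mul (a := C * ENNReal.ofReal (B + B)) h2
      (Or.inr (by finiteness))
    have h5 := (ENNReal.continuous_rpow_const (y := (1 / 2 : ℝ))).tendsto _ |>.comp h4
    have h6 := ENNReal.Tendsto.const_mul (a := ENNReal.ofReal (synthConst d₁ d₂)) h5
      (Or.inr (by finiteness))
    simpa using h6
  refine tendsto_of_tendsto_of_tendsto_of_le_of_le' tendsto_const_nhds h1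
    (Eventually.of_forall fun _ => zero_le) ?_
  filter_upwards [self_mem_nhdsWithin] with t ht
  have hb : ∀ᵐ ξ ∂(freqMeasure d₁ d₂), ‖(f t - f t₀ : WeightedL1 (freqMeasure d₁ d₂) a) ξ‖ ≤
      B + B := by
    filter_upwards [hB t ht, hB t₀ ht₀, coe_sub (f t) (f t₀)] with ξ h1 h2 h3
    rw [h3, Pi.sub_apply]
    exact (norm_sub_le _ _).trans (add_le_add h1 h2)
  rw [← synth_sub (f t).integrable (f t₀).integrable, ← synth_congr (coe_sub (f t) (f t₀)),
    sobolevNorm_synth σ (f t - f t₀).integrable (memLp_two_of_bounded _ hb)]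
  gcongr
  simp only [mul_pow]
  exact lintegral_weight_sq_le _ hC hb

theorem isSmoothNLSSolution_synth (ha : 0 < a) {ε T B : ℝ} {k : ℕ}
    {v : ℝ → WeightedL1 (freqMeasure d₁ d₂) a}
    (hv : ∀ t ∈ Icc 0 T, HasDerivWithinAt v (fieldZ d₁ d₂ a ε k t (v t)) (Icc 0 T) t)
    (hB : ∀ t ∈ Icc 0 T, ∀ᵐ ξ ∂(freqMeasure d₁ d₂), ‖v t ξ‖ ≤ B) :
    IsSmoothNLSSolution k ε T (synth (v 0)) fun t => synth (flowZ d₁ d₂ a t (v t)) where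
  memHInfty t ht := memHInfty_synth _ ha (ae_flow_bound t (hB t ht))
  continuous σ t₀ ht₀ := by
    have hc : ContinuousOn v (Icc 0 T) := fun t ht => (hv t ht).continuousWithinAt
    exact tendsto_sobolevNorm_synth_sub ha
      (continuousOn_flow (hQ := measurable_freqSq) continuousOn_id hc t₀ ht₀) ht₀
      (fun t ht => ae_flow_bound t (hB t ht)) σ
  equation t ht z := by
    obtain ⟨C, hC⟩ := exists_freqSq_le_expWeight (d₁ := d₁) (d₂ := d₂) ha
    refine ⟨_, hasDerivWithinAt_integral_phase (continuous_freqChar z).measurable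
      (enorm_freqChar z) measurable_freqSq (fun ξ => (hC ξ).1) (fun ξ => (hC ξ).2) (hv t ht), ?_⟩
    set f := flowZ d₁ d₂ a t (v t) with hf
    have h1 : ∫ ξ, freqChar z ξ * flowZ d₁ d₂ a t (fieldZ d₁ d₂ a ε k t (v t)) ξ
        ∂(freqMeasure d₁ d₂) = -(Complex.I * ε) * ((‖synth f z‖ : ℂ) ^ (2 * k) * synth f z) := by
      have h3 : flowZ d₁ d₂ a t (fieldZ d₁ d₂ a ε k t (v t)) =
          (-(Complex.I * (ε : ℂ))) • nonlin (freqMeasure d₁ d₂) a k f := by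
        change flow _ a freqSq _ t ((-(Complex.I * (ε : ℂ))) • flow _ a freqSq _ (-t)
          (nonlin (freqMeasure d₁ d₂) a k f)) = _
        rw [map_smul, flow_neg_flow]
      rw [h3, ← synth_nonlin, synth, ← integral_const_mul]
      refine integral_congr_ae ?_
      filter_upwards [coe_smul (-(Complex.I * ε)) (nonlin (freqMeasure d₁ d₂) a k f)] with ξ hξ
      rw [hξ, Pi.smul_apply, smul_eq_mul]
      ring
    have h2 : (Δ (synth f)) z = -∫ ξ, freqChar z ξ * ((freqSq ξ : ℂ) * f ξ)
        ∂(freqMeasure d₁ d₂) := by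
      rw [laplacian_synth f.aesm (integrable_moment_weightedL1 f ha), synth, ← integral_neg]
      refine integral_congr_ae (Eventually.of_forall fun ξ => ?_)
      simp only
      ring
    rw [h1, h2, mul_sub, ← mul_assoc, ← mul_assoc, ← mul_assoc, Complex.I_mul_I]
    have hI : Complex.I * -(Complex.I * ε) = ε := by
      rw [mul_neg, ← mul_assoc, Complex.I_mul_I]; simp
    rw [hI]
    ring
  initial := by
    simp only [flow_zero]

end Solution

/-! ### Continuous periodic functions are determined by their Fourier coefficients. -/

section TorusUniqueness

open scoped Pointwise

variable {n : ℕ}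

lemma apply_add_lattice {F : (Fin n → ℝ) → ℂ} {c : ℝ} (hp : ∀ j y, F (y + Pi.single j c) = F y)
    (m : Fin n → ℤ) (y : Fin n → ℝ) : F (y + fun j => (m j : ℝ) * c) = F y := by
  have h : ∀ s : Finset (Fin n), Function.Periodic F (∑ j ∈ s, m j • Pi.single j c) := by
    intro s
    induction s using Finset.induction_on with
    | empty => intro y; simp
    | insert j s hj ih =>
      rw [Finset.sum_insert hj]
      exact (Function.Periodic.zsmul (fun y => hp j y) (m j)).add_period ih
  have e : (fun j => (m j : ℝ) * c) = ∑ j, m j • (Pi.single j c : Fin n → ℝ) := by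
    ext i
    simp [Finset.sum_apply, Pi.single_apply]
  rw [e]
  exact h _ y

lemma mFourier_coe (k : Fin n → ℤ) (x : Fin n → ℝ) :
    UnitAddTorus.mFourier k (fun i => (x i : UnitAddCircle)) =
      Complex.exp (Complex.I * ((∑ j, (k j : ℝ) * (2 * Real.pi * x j) : ℝ) : ℂ)) := by
  simp only [UnitAddTorus.mFourier, ContinuousMap.coe_mk, fourier_coe_apply]
  rw [← Complex.exp_sum]
  congr 1
  push_cast
  rw [Finset.mul_sum]
  refine Finset.sum_congr rfl fun j _ => ?_
  ring

/-- A continuous periodic function is determined by its Fourier coefficients. -/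
lemma eq_zero_of_integral_torusBox_eq_zero {F : (Fin n → ℝ) → ℂ} (hc : Continuous F)
    (hp : ∀ j y, F (y + Pi.single j (2 * Real.pi)) = F y)
    (h : ∀ k : Fin n → ℤ, ∫ y in torusBox n,
      F y * Complex.exp (-Complex.I * ((∑ j, (k j : ℝ) * y j : ℝ) : ℂ)) = 0)
    (y : Fin n → ℝ) : F y = 0 := by
  have h2pi : (0 : ℝ) < 2 * Real.pi := by positivity
  set q : (Fin n → ℝ) → UnitAddTorus (Fin n) := fun x i => (x i : UnitAddCircle) with hq
  have hqm : IsQuotientMap q :=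
    (IsOpenQuotientMap.piMap fun _ : Fin n =>
      QuotientAddGroup.isOpenQuotientMap_mk (N := AddSubgroup.zmultiples (1 : ℝ))).isQuotientMap
  -- Rescaling turns the periods 2π into 1, so that the function descends to a continuous function
  -- on the unit torus.
  set F' : C(Fin n → ℝ, ℂ) := ⟨fun x => F ((2 * Real.pi) • x), by fun_prop⟩ with hF'
  have hlift : ∀ x x', q x = q x' → F' x = F' x' := by
    intro x x' hx
    have h1 : ∀ i, ∃ m : ℤ, (m : ℝ) = x i - x' i := fun i => by
      have h2 : ((x i - x' i : ℝ) : UnitAddCircle) = 0 := by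
        rw [AddCircle.coe_sub, sub_eq_zero]; exact congrFun hx i
      obtain ⟨m, hm⟩ := (AddCircle.coe_eq_zero_iff (1 : ℝ)).1 h2
      exact ⟨m, by simpa using hm⟩
    choose m hm using h1
    have h3 : (2 * Real.pi) • x = (2 * Real.pi) • x' + fun j => (m j : ℝ) * (2 * Real.pi) := by
      ext i
      simp only [Pi.smul_apply, Pi.add_apply, smul_eq_mul, hm]
      ring
    simp only [hF', ContinuousMap.coe_mk]
    rw [h3, apply_add_lattice hp]
  set qc : C(Fin n → ℝ, UnitAddTorus (Fin n)) := ⟨q, hqm.continuous⟩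
  have hqc : IsQuotientMap qc := hqm
  set Φ : C(UnitAddTorus (Fin n), ℂ) := hqc.lift F' fun x x' h => hlift x x' h
  have hΦ : ∀ x, Φ (q x) = F ((2 * Real.pi) • x) := fun x =>
    congrArg (fun g : C(Fin n → ℝ, ℂ) => g x) (hqc.lift_comp F' fun x x' h => hlift x x' h)
  have hcoef : UnitAddTorus.mFourierCoeff Φ = 0 := by
    ext k
    rw [UnitAddTorus.mFourierCoeff_eq_integral _ k 0]
    have hs : (2 * Real.pi) • {x : Fin n → ℝ | ∀ i, x i ∈ Ioc ((0 : Fin n → ℝ) i)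
        ((0 : Fin n → ℝ) i + 1)} = torusBox n := by
      ext x
      rw [Set.mem_smul_set_iff_inv_smul_mem₀ h2pi.ne']
      simp only [Set.mem_ofPred_eq, Pi.zero_apply, zero_add, Pi.smul_apply, smul_eq_mul, mem_Ioc,
        torusBox, Set.mem_pi, mem_univ, true_implies]
      refine forall_congr' fun i => ?_
      rw [inv_mul_le_iff₀ h2pi, mul_one]
      refine and_congr_left fun _ => ?_
      exact ⟨fun h => (pos_iff_pos_of_mul_pos h).1 (by positivity), fun h => by positivity⟩
    have h3 := Measure.setIntegral_comp_smul_of_pos (volume : Measure (Fin n → ℝ))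
      (fun y => F y * Complex.exp (-Complex.I * ((∑ j, (k j : ℝ) * y j : ℝ) : ℂ)))
      {x : Fin n → ℝ | ∀ i, x i ∈ Ioc ((0 : Fin n → ℝ) i) ((0 : Fin n → ℝ) i + 1)} h2pi
    rw [hs, h k, smul_zero] at h3
    rw [Pi.zero_apply, ← h3]
    congr 1
    ext x
    have h4 := hΦ x
    simp only [hq] at h4
    rw [h4, mFourier_coe, smul_eq_mul, mul_comm]
    simp
  -- Since all coefficients vanish the Fourier series is trivially summable, hence converges
  -- pointwise to the function, which is therefore zero.
  have hsum := UnitAddTorus.hasSum_mFourier_series_apply_of_summable (f := Φ)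
    (by rw [hcoef]; exact summable_zero) (q ((2 * Real.pi)⁻¹ • y))
  rw [hΦ, smul_inv_smul₀ h2pi.ne', hcoef] at hsum
  simpa using hsum.unique (by simp [hasSum_zero])

end TorusUniqueness

/-! ### Fourier inversion on H^∞(Z). -/

section Inversion

open scoped NNReal
open WeightedL1

variable {d₁ d₂ : ℕ}

lemma exists_lintegral_fourierZ_sq_le (n : ℕ) : ∃ (C : ℝ≥0) (σ : ℝ),
    ∀ g : NLSCover d₁ d₂ → ℂ, (∫⁻ ξ, ENNReal.ofReal ((1 + ‖freqEmb ξ‖) ^ n) *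
      ‖fourierZ g ξ.1 ξ.2‖ₑ ∂(freqMeasure d₁ d₂)) ^ 2 ≤ C * sobolevNorm σ g ^ 2 := by
  -- After Cauchy–Schwarz with weight `freqJ`, that weight and the squared moment together cost (1 +
  -- r)^{2m}, at most 2^m (1 + r²)^m, which is 2^m times the squared Sobolev weight of order `m`.
  set m : ℕ := d₂ + (d₁ + 1) + n with hm
  set S := ∫⁻ ξ, (ENNReal.ofReal (freqJ ξ))⁻¹ ∂(freqMeasure d₁ d₂) with hS
  have hS' : S < ⊤ := lintegral_inv_freqJ_lt_top
  refine ⟨S.toNNReal * 2 ^ m, m, fun g => ?_⟩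
  have hw : ∀ ξ : Freq d₁ d₂, ENNReal.ofReal (freqJ ξ) *
      ENNReal.ofReal ((1 + ‖freqEmb ξ‖) ^ n) ^ 2 ≤ 2 ^ m * freqWeight (m : ℝ) ξ ^ 2 := fun ξ => by
    have h0 := norm_nonneg (freqEmb ξ)
    have h1 : freqJ ξ * ((1 + ‖freqEmb ξ‖) ^ n) ^ 2 ≤
        2 ^ m * (sobolevWeight (m : ℝ) ‖freqEmb ξ‖) ^ 2 := by
      have h2 : (sobolevWeight (m : ℝ) ‖freqEmb ξ‖) ^ 2 = (1 + ‖freqEmb ξ‖ ^ 2) ^ m := by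
        rw [sobolevWeight, if_pos (Nat.cast_nonneg m),
          ← Real.rpow_natCast ((1 + ‖freqEmb ξ‖ ^ 2) ^ ((m : ℝ) / 2)) 2, ← Real.rpow_mul
          (by positivity), ← Real.rpow_natCast _ m]
        congr 1
        push_cast
        ring
      calc freqJ ξ * ((1 + ‖freqEmb ξ‖) ^ n) ^ 2
          ≤ (1 + ‖freqEmb ξ‖) ^ (2 * (d₂ + (d₁ + 1))) * ((1 + ‖freqEmb ξ‖) ^ n) ^ 2 := by
            gcongr; exact freqJ_le ξ
        _ = ((1 + ‖freqEmb ξ‖) ^ 2) ^ m := by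
            rw [hm, ← pow_mul, ← pow_mul, ← pow_add]; congr 1; ring
        _ ≤ (2 * (1 + ‖freqEmb ξ‖ ^ 2)) ^ m := by
            gcongr
            nlinarith [sq_nonneg (1 - ‖freqEmb ξ‖)]
        _ = _ := by rw [h2, mul_pow]
    have hW : 0 ≤ sobolevWeight (m : ℝ) ‖freqEmb ξ‖ := by
      unfold sobolevWeight
      split_ifs <;> positivity
    have hP : 0 ≤ (1 + ‖freqEmb ξ‖) ^ n := by positivity
    have h3 := ENNReal.ofReal_le_ofReal h1
    rw [ENNReal.ofReal_mul (zero_le_one.trans (one_le_freqJ ξ)), ENNReal.ofReal_mul (by positivity),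
      ENNReal.ofReal_pow (p := (1 + ‖freqEmb ξ‖) ^ n) hP,
      ENNReal.ofReal_pow hW, ENNReal.ofReal_pow (p := 2) (by norm_num)] at h3
    simpa only [freqWeight, ENNReal.ofReal_ofNat] using h3
  have hmf : Measurable fun ξ : Freq d₁ d₂ => ENNReal.ofReal ((1 + ‖freqEmb ξ‖) ^ n) *
      ‖fourierZ g ξ.1 ξ.2‖ₑ :=
    ((continuous_freqEmb.norm.const_add 1).pow n).measurable.ennreal_ofReal.mul
      (measurable_fourierZ g).enorm
  have h := lintegral_sq_le_weight (freqMeasure d₁ d₂) hmf.aemeasurable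
    (w := fun ξ => ENNReal.ofReal (freqJ ξ)) measurable_freqJ.ennreal_ofReal.aemeasurable
    (fun ξ => (ENNReal.ofReal_pos.2 (zero_lt_one.trans_le (one_le_freqJ ξ))).ne')
    fun ξ => ENNReal.ofReal_ne_top
  refine h.trans ?_
  rw [ENNReal.coe_mul, ENNReal.coe_toNNReal hS'.ne, mul_assoc]
  gcongr
  have hsq : sobolevNorm (m : ℝ) g ^ 2 = ∫⁻ ξ, (freqWeight (m : ℝ) ξ * ‖fourierZ g ξ.1 ξ.2‖ₑ) ^ 2
      ∂(freqMeasure d₁ d₂) := by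
    rw [sobolevNorm_eq, ← ENNReal.rpow_natCast, ← ENNReal.rpow_mul]
    norm_num
  rw [hsq, ← lintegral_const_mul' _ _ (by finiteness)]
  refine lintegral_mono fun ξ => ?_
  simp only [mul_pow, ← mul_assoc]
  exact mul_le_mul' (hw ξ) le_rfl

/-- The coefficients `f` for which `synth f = g`. -/
def invSynth (g : NLSCover d₁ d₂ → ℂ) (ξ : Freq d₁ d₂) : ℂ :=
  (synthConst d₁ d₂ : ℂ)⁻¹ * fourierZ g ξ.1 ξ.2

lemma measurable_invSynth (g : NLSCover d₁ d₂ → ℂ) : Measurable (invSynth g) :=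
  (measurable_fourierZ g).const_mul _

lemma exists_lintegral_invSynth_sq_le (n : ℕ) : ∃ (C : ℝ≥0) (σ : ℝ),
    ∀ g : NLSCover d₁ d₂ → ℂ, (∫⁻ ξ, ENNReal.ofReal ((1 + ‖freqEmb ξ‖) ^ n) *
      ‖invSynth g ξ‖ₑ ∂(freqMeasure d₁ d₂)) ^ 2 ≤ C * sobolevNorm σ g ^ 2 := by
  obtain ⟨C, σ, h⟩ := exists_lintegral_fourierZ_sq_le (d₁ := d₁) (d₂ := d₂) n
  refine ⟨‖(synthConst d₁ d₂ : ℂ)⁻¹‖₊ ^ 2 * C, σ, fun g => ?_⟩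
  simp only [invSynth, enorm_mul, mul_left_comm (ENNReal.ofReal _)]
  rw [lintegral_const_mul' _ _ (by finiteness), mul_pow, ENNReal.coe_mul, mul_assoc,
    ENNReal.coe_pow]
  gcongr
  · exact le_rfl
  · exact h g

lemma integrable_moment_invSynth {g : NLSCover d₁ d₂ → ℂ} (hg : ∀ σ, sobolevNorm σ g < ⊤) (n : ℕ) :
    Integrable (fun ξ => ((1 + ‖freqEmb ξ‖) ^ n : ℝ) * ‖invSynth g ξ‖) (freqMeasure d₁ d₂) := by
  obtain ⟨C, σ, h⟩ := exists_lintegral_invSynth_sq_le (d₁ := d₁) (d₂ := d₂) n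
  refine ⟨(((continuous_freqEmb.norm.const_add 1).pow n).measurable.mul
    (measurable_invSynth g).norm).aestronglyMeasurable, ?_⟩
  have h1 := (h g).trans_lt (ENNReal.mul_lt_top ENNReal.coe_lt_top (ENNReal.pow_lt_top (hg σ)))
  rw [ENNReal.pow_lt_top_iff] at h1
  rw [HasFiniteIntegral]
  refine lt_of_le_of_lt (le_of_eq (lintegral_congr fun ξ => ?_)) (h1.resolve_right (by norm_num))
  rw [enorm_mul, enorm_norm, ← ofReal_norm ((1 + ‖freqEmb ξ‖) ^ n),
    Real.norm_of_nonneg (by positivity)]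

lemma integrable_invSynth {g : NLSCover d₁ d₂ → ℂ} (hg : ∀ σ, sobolevNorm σ g < ⊤) :
    Integrable (invSynth g) (freqMeasure d₁ d₂) := by
  have h := integrable_moment_invSynth hg 0
  simp only [pow_zero, one_mul] at h
  exact (integrable_norm_iff (measurable_invSynth g).aestronglyMeasurable).1 h

lemma memLp_two_invSynth {g : NLSCover d₁ d₂ → ℂ} (hg : ∀ σ, sobolevNorm σ g < ⊤) :
    MemLp (invSynth g) 2 (freqMeasure d₁ d₂) := by
  refine MemLp.const_mul ⟨(measurable_fourierZ g).aestronglyMeasurable, ?_⟩ _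
  rw [eLpNorm_lt_top_iff_lintegral_rpow_enorm_lt_top two_ne_zero ENNReal.ofNat_ne_top]
  have h := hg 0
  rw [sobolevNorm_eq, ENNReal.rpow_lt_top_iff_of_pos (by norm_num)] at h
  simpa [freqWeight, sobolevWeight] using h

/-- Fourier inversion on `H^∞(Z)`. -/
theorem synth_invSynth {g : NLSCover d₁ d₂ → ℂ} (hg : MemHInfty g) : synth (invSynth g) = g := by
  have hi := integrable_invSynth hg.sobolevNorm_lt_top
  have hi2 := memLp_two_invSynth hg.sobolevNorm_lt_top
  have hgc : Continuous g := hg.contDiff.continuous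
  have hsc := continuous_synth hi
  -- Both functions have the same `fourierZ`, and the Plancherel transform is injective on each
  -- slice.
  have hk : ∀ k, ∀ᵐ x, periodicCoeff (synth (invSynth g)) k x = periodicCoeff g k x := by
    intro k
    obtain ⟨h1, h2⟩ := comp_two_pi_smul hi hi2 k
      ((Real.sqrt (2 * Real.pi) ^ d₂ * (2 * Real.pi) ^ d₁ : ℝ) : ℂ)
    have hm1 : MemLp (periodicCoeff (synth (invSynth g)) k) 2
        (volume : Measure (EuclideanSpace ℝ (Fin d₁))) := by
      rw [periodicCoeff_synth_eq_fourierInv hi k]; exact memLp_fourierInv h1 h2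
    have hm2 := memLp_periodicCoeff hgc hg.memLp k
    have h3 : ∀ᵐ ξ, fourierZ (synth (invSynth g)) k ξ = fourierZ g k ξ := by
      filter_upwards [ae_fourierZ_synth hi hi2 k] with ξ hξ
      rw [hξ, invSynth, ← mul_assoc, mul_inv_cancel₀ (by exact_mod_cast synthConst_pos.ne'), one_mul]
    have h4 : (𝓕 (hm1.toLp _) : Lp ℂ 2 (volume : Measure (EuclideanSpace ℝ (Fin d₁)))) =
        𝓕 (hm2.toLp _) := by
      refine Lp.ext ?_
      have h5 : ∀ᵐ ξ : EuclideanSpace ℝ (Fin d₁),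
          (𝓕 (hm1.toLp _) : Lp ℂ 2 (volume : Measure (EuclideanSpace ℝ (Fin d₁))))
            ((2 * Real.pi)⁻¹ • ξ) =
          (𝓕 (hm2.toLp _) : Lp ℂ 2 (volume : Measure (EuclideanSpace ℝ (Fin d₁))))
            ((2 * Real.pi)⁻¹ • ξ) := by
        filter_upwards [h3] with ξ hξ
        rw [fourierZ, fourierZ, dif_pos hm1, dif_pos hm2] at hξ
        refine mul_left_cancel₀ ?_ hξ
        have : (Real.sqrt (2 * Real.pi))⁻¹ ^ d₁ ≠ 0 := by positivity
        exact_mod_cast this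
      have h6 := (Measure.quasiMeasurePreserving_smul (volume : Measure
        (EuclideanSpace ℝ (Fin d₁))) (r := 2 * Real.pi) (by positivity)).ae h5
      filter_upwards [h6] with ξ hξ
      rwa [inv_smul_smul₀ (by positivity : (2 * Real.pi) ≠ 0)] at hξ
    have h7 : hm1.toLp _ = hm2.toLp _ := by
      have := congrArg (fun F : Lp ℂ 2 (volume : Measure (EuclideanSpace ℝ (Fin d₁))) => 𝓕⁻ F) h4
      simpa only [FourierTransform.fourierInv_fourier_eq] using this
    exact (MemLp.toLp_eq_toLp_iff hm1 hm2).1 h7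
  have hall : ∀ᵐ x : EuclideanSpace ℝ (Fin d₁), ∀ k,
      periodicCoeff (synth (invSynth g)) k x = periodicCoeff g k x := ae_all_iff.2 hk
  -- At such `x` two continuous periodic functions of `y` have equal Fourier coefficients and so
  -- coincide. These `x` form a dense set, and continuity in `x` covers the rest.
  have hx : ∀ x : EuclideanSpace ℝ (Fin d₁), (∀ k, periodicCoeff (synth (invSynth g)) k x =
      periodicCoeff g k x) → ∀ y, synth (invSynth g) (NLSCover.mk x y) = g (NLSCover.mk x y) := by
    intro x hx y
    have hper : ∀ {f : NLSCover d₁ d₂ → ℂ}, IsPeriodicZ f → ∀ (j : Fin d₂) y,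
        f (NLSCover.mk x (y + Pi.single j (2 * Real.pi))) = f (NLSCover.mk x y) := by
      intro f hf j y
      rw [← hf j (NLSCover.mk x y)]
      congr 1
      refine PiLp.ext fun i => ?_
      rcases i with i | i <;> simp [NLSCover.mk, Pi.single_apply]
    refine sub_eq_zero.1 (eq_zero_of_integral_torusBox_eq_zero
      (F := fun y => synth (invSynth g) (NLSCover.mk x y) - g (NLSCover.mk x y))
      ((continuous_comp_mk hsc x).sub (continuous_comp_mk hgc x)) (fun j y => ?_) (fun k => ?_) y)
    · rw [hper (isPeriodicZ_synth _), hper hg.periodic]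
    · have hint : ∀ {f : NLSCover d₁ d₂ → ℂ}, Continuous f → IntegrableOn (fun y : Fin d₂ → ℝ =>
          f (NLSCover.mk x y) * Complex.exp (-Complex.I * ((∑ j, (k j : ℝ) * y j : ℝ) : ℂ)))
          (torusBox d₂) := fun {f} hf => by
        have h1 : Continuous fun y : Fin d₂ → ℝ => f (NLSCover.mk x y) *
            Complex.exp (-Complex.I * ((∑ j, (k j : ℝ) * y j : ℝ) : ℂ)) :=
          (continuous_comp_mk hf x).mul (by fun_prop)
        refine (h1.continuousOn.integrableOn_compact (isCompact_univ_pi fun _ : Fin d₂ =>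
          isCompact_Icc (a := (0 : ℝ)) (b := 2 * Real.pi))).mono_set ?_
        exact Set.pi_mono fun _ _ => Ioc_subset_Icc_self
      simp only [sub_mul]
      rw [integral_sub (hint hsc) (hint hgc), sub_eq_zero]
      have := hx k
      rw [periodicCoeff, periodicCoeff] at this
      refine mul_left_cancel₀ ?_ this
      have h0 : (Real.sqrt (2 * Real.pi))⁻¹ ^ d₂ ≠ 0 := by positivity
      exact_mod_cast h0
  have hmk : ∀ z : NLSCover d₁ d₂, z = NLSCover.mk (WithLp.toLp 2 fun i => z (Sum.inl i))
      fun j => z (Sum.inr j) := fun z => by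
    refine PiLp.ext fun i => ?_
    rcases i with i | i <;> rfl
  ext z
  rw [hmk z]
  have hcx : ∀ {f : NLSCover d₁ d₂ → ℂ}, Continuous f → Continuous fun x => f (NLSCover.mk x
      fun j => z (Sum.inr j)) := fun hf =>
    hf.comp (continuous_mk.comp (continuous_id.prodMk continuous_const))
  exact congrFun ((hcx hsc).ext_on (Measure.dense_of_ae hall) (hcx hgc) fun x hx' => hx x hx' _) _

end Inversion

/-! ### Differentiability of the free evolution along regular vectors. -/

section FlowDerivative

open scoped NNReal
open WeightedL1

variable {G : Type*} [NormedAddCommGroup G] [MeasurableSpace G] [BorelSpace G]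
  [SecondCountableTopology G] {μ : Measure G} {a : ℝ≥0} {Q : G → ℝ} {hQ : Measurable Q}

/-- The second moment `Q ^ 2 * f` bounds the Taylor remainder of the phase quadratically in time, so
no limiting argument under the integral is needed. -/
lemma hasDerivAt_flow_neg {f q : WeightedL1 μ a} (hq : q =ᵐ[μ] fun ξ => (Q ξ : ℂ) * f ξ)
    (h2 : Integrable (fun ξ => ((Q ξ ^ 2 : ℝ) : ℂ) * f ξ) (expMeasure μ a)) (t : ℝ) :
    HasDerivAt (fun τ => flow μ a Q hQ (-τ) f) (flow μ a Q hQ (-t) (Complex.I • q)) t := by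
  rw [hasDerivAt_iff_isLittleO]
  have hb : ∀ τ, ‖flow μ a Q hQ (-τ) f - flow μ a Q hQ (-t) f -
      (τ - t) • flow μ a Q hQ (-t) (Complex.I • q)‖ ≤ 3 * ‖h2.toL1 _‖ * ‖(τ - t) ^ 2‖ := by
    intro τ
    have e1 : (τ - t) • flow μ a Q hQ (-t) (Complex.I • q) =
        flow μ a Q hQ (-t) ((((τ - t : ℝ) : ℂ) * Complex.I) • q) := by
      rw [← algebraMap_smul ℂ (τ - t), ← map_smul, smul_smul]
      rfl
    rw [e1, Real.norm_of_nonneg (sq_nonneg (τ - t)), ← toReal_enorm, ← toReal_enorm (h2.toL1 _)]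
    have h3 : ‖flow μ a Q hQ (-τ) f - flow μ a Q hQ (-t) f -
        flow μ a Q hQ (-t) ((((τ - t : ℝ) : ℂ) * Complex.I) • q)‖ₑ ≤
        ENNReal.ofReal (3 * (τ - t) ^ 2) * ‖h2.toL1 _‖ₑ := by
      rw [enorm_toL1, enorm_eq, ← lintegral_const_mul' _ _ ENNReal.ofReal_ne_top]
      refine lintegral_mono_ae ?_
      filter_upwards [coe_sub (flow μ a Q hQ (-τ) f - flow μ a Q hQ (-t) f)
        (flow μ a Q hQ (-t) ((((τ - t : ℝ) : ℂ) * Complex.I) • q)),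
        coe_sub (flow μ a Q hQ (-τ) f) (flow μ a Q hQ (-t) f), coe_flow (hQ := hQ) (-τ) f,
        coe_flow (hQ := hQ) (-t) f, coe_flow (hQ := hQ) (-t)
          ((((τ - t : ℝ) : ℂ) * Complex.I) • q), coe_smul (((τ - t : ℝ) : ℂ) * Complex.I) q, hq]
        with ξ k1 k2 k3 k4 k5 k6 k7
      rw [k1, Pi.sub_apply, k2, Pi.sub_apply, k3, k4, k5, k6, Pi.smul_apply, k7, mul_left_comm]
      gcongr
      have e2 : Complex.exp (-(Complex.I * (-τ * Q ξ : ℝ))) * f ξ -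
          Complex.exp (-(Complex.I * (-t * Q ξ : ℝ))) * f ξ -
          Complex.exp (-(Complex.I * (-t * Q ξ : ℝ))) *
            ((((τ - t : ℝ) : ℂ) * Complex.I) • ((Q ξ : ℂ) * f ξ)) =
          Complex.exp (-(Complex.I * (-t * Q ξ : ℝ))) *
            (Complex.exp (-(Complex.I * (-((τ - t) * Q ξ) : ℝ))) - 1 +
              Complex.I * (-((τ - t) * Q ξ) : ℝ)) * f ξ := by
        have e3 : Complex.exp (-(Complex.I * (-τ * Q ξ : ℝ))) =
            Complex.exp (-(Complex.I * (-t * Q ξ : ℝ))) *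
              Complex.exp (-(Complex.I * (-((τ - t) * Q ξ) : ℝ))) := by
          rw [← Complex.exp_add]
          congr 1
          push_cast
          ring
        rw [e3, smul_eq_mul]
        push_cast
        ring
      rw [e2, enorm_mul, enorm_mul, enorm_phase, one_mul, enorm_mul, ← mul_assoc]
      gcongr
      rw [← ofReal_norm, ← ofReal_norm, ← ENNReal.ofReal_mul (by positivity), Complex.norm_real,
        Real.norm_of_nonneg (sq_nonneg (Q ξ))]
      refine ENNReal.ofReal_le_ofReal ((norm_exp_I_sub_one_sub_le _).trans (le_of_eq ?_))
      ring
    have h4 := ENNReal.toReal_mono (by finiteness) h3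
    rw [ENNReal.toReal_mul, ENNReal.toReal_ofReal (by positivity)] at h4
    linarith
  have h3 : (fun τ : ℝ => (τ - t) ^ 2) =o[𝓝 t] fun τ => τ - t := by
    have h4 : Tendsto (fun τ : ℝ => τ - t) (𝓝 t) (𝓝 0) := by
      have h5 : Continuous fun τ : ℝ => τ - t := by fun_prop
      simpa using h5.tendsto t
    exact (Asymptotics.isLittleO_pow_id (𝕜 := ℝ) (n := 2) (by norm_num)).comp_tendsto h4
  exact (Asymptotics.IsBigO.of_bound _ (Eventually.of_forall hb)).trans_isLittleO h3

lemma tendsto_flow_apply {l : Filter ℝ} {c : ℝ → ℝ} {t : ℝ} (hc : Tendsto c l (𝓝 t))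
    {x : ℝ → WeightedL1 μ a} {y : WeightedL1 μ a} (hx : Tendsto x l (𝓝 y)) :
    Tendsto (fun τ => flow μ a Q hQ (c τ) (x τ)) l (𝓝 (flow μ a Q hQ t y)) := by
  rw [tendsto_iff_norm_sub_tendsto_zero]
  have h1 := tendsto_iff_norm_sub_tendsto_zero.1 ((tendsto_flow (hQ := hQ) y t).comp hc)
  have h2 := tendsto_iff_norm_sub_tendsto_zero.1 hx
  refine squeeze_zero (fun _ => norm_nonneg _) (fun τ => ?_) (by simpa using h2.add h1)
  calc _ = ‖flow μ a Q hQ (c τ) (x τ - y) +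
        (flow μ a Q hQ (c τ) y - flow μ a Q hQ t y)‖ := by
        rw [map_sub, sub_add_sub_cancel]
    _ ≤ _ := (norm_add_le _ _).trans (by rw [LinearIsometry.norm_map])

/-- Passage to the interaction representation. -/
lemma hasDerivWithinAt_flow_neg {b : ℝ → WeightedL1 μ a} {b' q : WeightedL1 μ a} {s : Set ℝ}
    {t : ℝ} (hb : HasDerivWithinAt b b' s t) (hq : q =ᵐ[μ] fun ξ => (Q ξ : ℂ) * b t ξ)
    (h2 : Integrable (fun ξ => ((Q ξ ^ 2 : ℝ) : ℂ) * b t ξ) (expMeasure μ a)) :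
    HasDerivWithinAt (fun τ => flow μ a Q hQ (-τ) (b τ))
      (flow μ a Q hQ (-t) (b' + Complex.I • q)) s t := by
  -- The flow is only strongly continuous, so the increment of `b` and the fixed vector `b t` are
  -- differentiated separately. For the increment the slopes converge and the flow, being isometric,
  -- passes to the limit.
  have h1 : HasDerivWithinAt (fun τ => flow μ a Q hQ (-τ) (b τ - b t))
      (flow μ a Q hQ (-t) b') s t := by
    rw [hasDerivWithinAt_iff_tendsto_slope] at hb ⊢
    have hc : Tendsto (fun τ : ℝ => -τ) (𝓝[s \ {t}] t) (𝓝 (-t)) :=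
      (continuous_neg.tendsto t).mono_left nhdsWithin_le_nhds
    refine (tendsto_flow_apply (hQ := hQ) hc hb).congr fun τ => ?_
    rw [slope_def_module, slope_def_module, sub_self, map_zero, sub_zero]
    exact (flow μ a Q hQ (-τ)).toLinearMap.map_smul_of_tower _ _
  have h3 := h1.add (hasDerivAt_flow_neg (hQ := hQ) hq h2 t).hasDerivWithinAt
  rw [map_add]
  refine h3.congr_of_eventuallyEq (Eventually.of_forall fun τ => ?_) ?_
  · simp only [map_sub, Pi.add_apply, sub_add_cancel]
  · simp only [map_sub, Pi.add_apply, sub_add_cancel]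

end FlowDerivative

/-! ### Fourier coefficients of curves in H^∞. -/

section Uniqueness

open scoped NNReal
open WeightedL1

variable {d₁ d₂ : ℕ}

lemma ae_eq_zero_of_synth_eq_zero {f : Freq d₁ d₂ → ℂ} (hf : Integrable f (freqMeasure d₁ d₂))
    (h : synth f = 0) : f =ᵐ[freqMeasure d₁ d₂] 0 := by
  refine ae_freqMeasure_of_section (p := fun ξ => f ξ = (0 : Freq d₁ d₂ → ℂ) ξ) fun k => ?_
  have h2pi : (2 * Real.pi) ≠ 0 := by positivity
  set c : ℂ := ((Real.sqrt (2 * Real.pi) ^ d₂ * (2 * Real.pi) ^ d₁ : ℝ) : ℂ) with hc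
  have hc0 : c ≠ 0 := by
    rw [hc]
    have : Real.sqrt (2 * Real.pi) ^ d₂ * (2 * Real.pi) ^ d₁ ≠ 0 := by positivity
    exact_mod_cast this
  have h1 := ((integrable_section hf k).comp_smul h2pi).const_mul c
  have h3 := periodicCoeff_synth_eq_fourierInv hf k
  have h4 := ae_eq_zero_of_fourierInv_eq_zero h1 fun x => by
    rw [← h3, h]
    simp [periodicCoeff]
  have h5 := (Measure.quasiMeasurePreserving_smul (volume : Measure
    (EuclideanSpace ℝ (Fin d₁))) (r := (2 * Real.pi)⁻¹) (by positivity)).ae h4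
  filter_upwards [h5] with ξ hξ
  rw [smul_inv_smul₀ h2pi] at hξ
  exact (mul_eq_zero.1 hξ).resolve_left hc0

lemma ae_eq_of_synth_eq {f g : Freq d₁ d₂ → ℂ} (hf : Integrable f (freqMeasure d₁ d₂))
    (hg : Integrable g (freqMeasure d₁ d₂)) (h : synth f = synth g) :
    f =ᵐ[freqMeasure d₁ d₂] g := by
  have := ae_eq_zero_of_synth_eq_zero (hf.sub hg) (by rw [synth_sub hf hg, h, sub_self])
  filter_upwards [this] with ξ hξ
  exact sub_eq_zero.1 hξ

/-- Because `fourierZ` is defined by cases, additivity is not immediate; it is deduced from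
inversion and the linearity of `synth`. -/
lemma invSynth_sub {g h : NLSCover d₁ d₂ → ℂ} (hg : MemHInfty g) (hh : MemHInfty h) :
    invSynth (g - h) =ᵐ[freqMeasure d₁ d₂] invSynth g - invSynth h := by
  have hig := integrable_invSynth hg.sobolevNorm_lt_top
  have hih := integrable_invSynth hh.sobolevNorm_lt_top
  have hs := synth_sub hig hih
  rw [synth_invSynth hg, synth_invSynth hh] at hs
  filter_upwards [ae_freqMeasure_of_section (p := fun ξ => fourierZ (synth (invSynth g -
    invSynth h)) ξ.1 ξ.2 = (synthConst d₁ d₂ : ℂ) * (invSynth g - invSynth h) ξ)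
    (ae_fourierZ_synth (hig.sub hih) ((memLp_two_invSynth hg.sobolevNorm_lt_top).sub
      (memLp_two_invSynth hh.sobolevNorm_lt_top)))] with ξ hξ
  rw [hs] at hξ
  rw [invSynth, hξ, ← mul_assoc, inv_mul_cancel₀ (by exact_mod_cast synthConst_pos.ne'), one_mul]

lemma integrable_mul_invSynth {m : Freq d₁ d₂ → ℝ} (hm : Measurable m) {n : ℕ}
    (hn : ∀ ξ, |m ξ| ≤ (1 + ‖freqEmb ξ‖) ^ n) {g : NLSCover d₁ d₂ → ℂ} (hg : MemHInfty g) :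
    Integrable (fun ξ => (m ξ : ℂ) * invSynth g ξ) (expMeasure (freqMeasure d₁ d₂) 0) := by
  rw [expMeasure_zero]
  refine (integrable_moment_invSynth hg.sobolevNorm_lt_top n).mono'
    ((Complex.measurable_ofReal.comp hm).mul (measurable_invSynth g)).aestronglyMeasurable
    (Eventually.of_forall fun ξ => ?_)
  rw [norm_mul, Complex.norm_real]
  gcongr
  exact hn ξ

/-- A Sobolev norm of sufficiently high order controls the L¹ norm of the coefficients times a
polynomially bounded multiplier, so continuity in all H^σ transfers to L¹. -/
lemma continuousOn_mul_invSynth {m : Freq d₁ d₂ → ℝ} {n : ℕ}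
    (hn : ∀ ξ, |m ξ| ≤ (1 + ‖freqEmb ξ‖) ^ n) {w : ℝ → NLSCover d₁ d₂ → ℂ} {s : Set ℝ}
    (hw : ∀ t ∈ s, MemHInfty (w t)) (hc : ∀ σ : ℝ, ∀ t₀ ∈ s,
      Tendsto (fun t => sobolevNorm σ (w t - w t₀)) (𝓝[s] t₀) (𝓝 0))
    {X : ℝ → WeightedL1 (freqMeasure d₁ d₂) 0}
    (hX : ∀ t ∈ s, X t =ᵐ[freqMeasure d₁ d₂] fun ξ => (m ξ : ℂ) * invSynth (w t) ξ) :
    ContinuousOn X s := by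
  intro t₀ ht₀
  obtain ⟨C, σ, hC⟩ := exists_lintegral_invSynth_sq_le (d₁ := d₁) (d₂ := d₂) n
  rw [ContinuousWithinAt, tendsto_iff_edist_tendsto_0]
  have h1 : Tendsto (fun t => (C * sobolevNorm σ (w t - w t₀) ^ 2) ^ (1 / 2 : ℝ)) (𝓝[s] t₀)
      (𝓝 0) := by
    have h2 := ENNReal.Tendsto.const_mul (a := (C : ℝ≥0∞)) (ENNReal.Tendsto.pow (n := 2) (hc σ t₀ ht₀))
      (Or.inr (by finiteness))
    have h3 := (ENNReal.continuous_rpow_const (y := (1 / 2 : ℝ))).tendsto _ |>.comp h2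
    simpa [Function.comp_def] using h3
  refine tendsto_of_tendsto_of_tendsto_of_le_of_le' tendsto_const_nhds h1
    (Eventually.of_forall fun _ => zero_le) ?_
  filter_upwards [self_mem_nhdsWithin] with t ht
  have h4 : edist (X t) (X t₀) ≤ ∫⁻ ξ, ENNReal.ofReal ((1 + ‖freqEmb ξ‖) ^ n) *
      ‖invSynth (w t - w t₀) ξ‖ₑ ∂(freqMeasure d₁ d₂) := by
    rw [edist_eq_enorm_sub, enorm_eq]
    refine lintegral_mono_ae ?_
    filter_upwards [coe_sub (X t) (X t₀), hX t ht, hX t₀ ht₀, invSynth_sub (hw t ht) (hw t₀ ht₀)]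
      with ξ k1 k2 k3 k4
    rw [k1, Pi.sub_apply, k2, k3, k4, Pi.sub_apply, ← mul_sub, enorm_mul]
    have h5 : expWeight 0 ξ = 1 := by simp [expWeight]
    rw [h5, one_mul]
    gcongr
    rw [← ofReal_norm, Complex.norm_real]
    exact ENNReal.ofReal_le_ofReal (hn ξ)
  calc edist (X t) (X t₀) ≤ _ := h4
    _ = ((∫⁻ ξ, ENNReal.ofReal ((1 + ‖freqEmb ξ‖) ^ n) *
      ‖invSynth (w t - w t₀) ξ‖ₑ ∂(freqMeasure d₁ d₂)) ^ 2) ^ (1 / 2 : ℝ) := by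
        rw [← ENNReal.rpow_natCast, ← ENNReal.rpow_mul]
        norm_num
    _ ≤ _ := ENNReal.rpow_le_rpow (hC _) (by norm_num)

lemma hasDerivWithinAt_of_eq_integral {E : Type*} [NormedAddCommGroup E] [NormedSpace ℝ E]
    [CompleteSpace E] {b g : ℝ → E} {T : ℝ} (hg : ContinuousOn g (Icc 0 T))
    (hb : ∀ t ∈ Icc 0 T, b t = b 0 + ∫ τ in (0 : ℝ)..t, g τ) {t : ℝ} (ht : t ∈ Icc 0 T) :
    HasDerivWithinAt b (g t) (Icc 0 T) t := by
  have hT : 0 ≤ T := ht.1.trans ht.2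
  -- Extension by constants beyond the end points makes the integrand continuous on the line, so the
  -- two-sided fundamental theorem applies at the end points too.
  set g' : ℝ → E := fun τ => g (projIcc 0 T hT τ) with hg'
  have hgc : Continuous g' := by
    have := continuousOn_iff_continuous_domRestrict.1 hg
    exact this.comp continuous_projIcc
  have h1 : HasDerivAt (fun x => b 0 + ∫ τ in (0 : ℝ)..x, g' τ) (g' t) t :=
    (intervalIntegral.integral_hasDerivAt_right (hgc.intervalIntegrable _ _)
      (hgc.stronglyMeasurableAtFilter _ _) hgc.continuousAt).const_add _
  have h2 : g' t = g t := by simp only [hg', projIcc_of_mem hT ht]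
  rw [← h2]
  have h3 : ∀ x ∈ Icc 0 T, b x = b 0 + ∫ τ in (0 : ℝ)..x, g' τ := fun x hx => by
    rw [hb x hx]
    congr 1
    refine intervalIntegral.integral_congr fun τ hτ => ?_
    rw [uIcc_of_le hx.1] at hτ
    simp only [hg', projIcc_of_mem hT ⟨hτ.1, hτ.2.trans hx.2⟩]
  exact h1.hasDerivWithinAt.congr h3 (h3 t ht)

end Uniqueness

/-! ### Uniqueness of smooth solutions. -/

section Uniqueness

open scoped NNReal
open WeightedL1

variable {d₁ d₂ : ℕ}

lemma freqSq_nonneg (ξ : Freq d₁ d₂) : 0 ≤ freqSq ξ := by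
  rw [← norm_freqEmb_sq]; positivity

lemma abs_freqSq_le (ξ : Freq d₁ d₂) : |freqSq ξ| ≤ (1 + ‖freqEmb ξ‖) ^ 2 := by
  rw [abs_of_nonneg (freqSq_nonneg ξ), ← norm_freqEmb_sq]
  gcongr
  linarith

lemma abs_freqSq_sq_le (ξ : Freq d₁ d₂) : |freqSq ξ ^ 2| ≤ (1 + ‖freqEmb ξ‖) ^ 4 := by
  rw [abs_pow, pow_mul (1 + ‖freqEmb ξ‖) 2 2]
  gcongr
  exact abs_freqSq_le ξ

lemma laplacian_eq_neg_synth {g : NLSCover d₁ d₂ → ℂ} (hg : MemHInfty g) {q : Freq d₁ d₂ → ℂ}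
    (hq : q =ᵐ[freqMeasure d₁ d₂] fun ξ => (freqSq ξ : ℂ) * invSynth g ξ) (z : NLSCover d₁ d₂) :
    (Δ g) z = -synth q z := by
  have hmom : ∀ n : ℕ, Integrable (fun ξ => ‖freqEmb ξ‖ ^ n * ‖invSynth g ξ‖)
      (freqMeasure d₁ d₂) := fun n => by
    refine (integrable_moment_invSynth hg.sobolevNorm_lt_top n).mono'
      ((continuous_freqEmb.norm.measurable.pow_const n).mul
        (measurable_invSynth g).norm).aestronglyMeasurable
      (Eventually.of_forall fun ξ => ?_)
    rw [norm_mul, norm_norm, norm_pow, norm_norm]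
    gcongr
    linarith
  conv_lhs => rw [← synth_invSynth hg]
  rw [laplacian_synth (measurable_invSynth g).aestronglyMeasurable hmom,
    synth_congr hq, synth, synth, ← integral_neg]
  refine integral_congr_ae (Eventually.of_forall fun ξ => ?_)
  simp only
  ring

/-- The value of `synth f` at `z`, as a functional on `L¹`. -/
def synthEval (z : NLSCover d₁ d₂) : WeightedL1 (freqMeasure d₁ d₂) 0 →L[ℂ] ℂ :=
  pairing _ 0 (freqChar z) (continuous_freqChar z).measurable 1
    fun ξ => by rw [enorm_freqChar]; simpa using one_le_expWeight 0 ξ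

lemma synthEval_apply (z : NLSCover d₁ d₂) (f : WeightedL1 (freqMeasure d₁ d₂) 0) :
    synthEval z f = synth f z := rfl

lemma exists_multiplier_invSynth {w : ℝ → NLSCover d₁ d₂ → ℂ} {s : Set ℝ}
    (hw : ∀ t ∈ s, MemHInfty (w t)) {m : Freq d₁ d₂ → ℝ} (hm : Measurable m) {n : ℕ}
    (hn : ∀ ξ, |m ξ| ≤ (1 + ‖freqEmb ξ‖) ^ n) : ∃ X : ℝ → WeightedL1 (freqMeasure d₁ d₂) 0,
    ∀ t ∈ s, X t =ᵐ[freqMeasure d₁ d₂] fun ξ => (m ξ : ℂ) * invSynth (w t) ξ := by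
  classical
  refine ⟨fun t => if ht : t ∈ s then
    (integrable_mul_invSynth hm hn (hw t ht)).toL1 _ else 0, fun t ht => ?_⟩
  simp only [dif_pos ht]
  exact coe_toL1 _

/-- The right-hand side of the equation for the Fourier coefficients. -/
def coeffField (k : ℕ) (ε : ℝ) (b q : WeightedL1 (freqMeasure d₁ d₂) 0) :
    WeightedL1 (freqMeasure d₁ d₂) 0 :=
  (-(Complex.I * ε)) • nonlin (freqMeasure d₁ d₂) 0 k b - Complex.I • q

section

variable {k : ℕ} {ε T : ℝ} {φ : NLSCover d₁ d₂ → ℂ} {w : ℝ → NLSCover d₁ d₂ → ℂ}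
  {b q : ℝ → WeightedL1 (freqMeasure d₁ d₂) 0}

lemma IsSmoothNLSSolution.hasDerivWithinAt_synthEval (hw : IsSmoothNLSSolution k ε T φ w)
    (hb : ∀ t ∈ Icc 0 T, synth (b t) = w t)
    (hq : ∀ t ∈ Icc 0 T, q t =ᵐ[freqMeasure d₁ d₂] fun ξ => (freqSq ξ : ℂ) * invSynth (w t) ξ)
    (z : NLSCover d₁ d₂) {t : ℝ} (ht : t ∈ Icc 0 T) :
    HasDerivWithinAt (fun τ => w τ z) (synthEval z (coeffField k ε (b t) (q t))) (Icc 0 T) t := by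
  obtain ⟨v, hv, he⟩ := hw.equation t ht z
  have h1 : synthEval z (coeffField k ε (b t) (q t)) = v := by
    rw [coeffField, map_sub, map_smul, map_smul, synthEval_apply, synthEval_apply, synth_nonlin,
      hb t ht, smul_eq_mul, smul_eq_mul]
    rw [laplacian_eq_neg_synth (hw.memHInfty t ht) (hq t ht) z] at he
    have h2 : v = -Complex.I * (Complex.I * v) := by
      rw [← mul_assoc, neg_mul, Complex.I_mul_I]; ring
    rw [h2, eq_sub_of_add_eq he]
    ring
  rw [h1]
  exact hv

/-- The equation is known only pointwise in `z`. Evaluations at points are continuous functionals on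
L¹ which separate its elements, so the scalar integral identities combine into one in L¹. -/
lemma IsSmoothNLSSolution.coeff_eq_integral (hw : IsSmoothNLSSolution k ε T φ w)
    (hb : ∀ t ∈ Icc 0 T, synth (b t) = w t)
    (hq : ∀ t ∈ Icc 0 T, q t =ᵐ[freqMeasure d₁ d₂] fun ξ => (freqSq ξ : ℂ) * invSynth (w t) ξ)
    (hgc : ContinuousOn (fun t => coeffField k ε (b t) (q t)) (Icc 0 T)) {t : ℝ}
    (ht : t ∈ Icc 0 T) :
    b t = b 0 + ∫ τ in (0 : ℝ)..t, coeffField k ε (b τ) (q τ) := by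
  have hsub : Icc 0 t ⊆ Icc 0 T := Icc_subset_Icc_right ht.2
  have hgi : IntervalIntegrable (fun t => coeffField k ε (b t) (q t)) volume 0 t :=
    ContinuousOn.intervalIntegrable (by rw [uIcc_of_le ht.1]; exact hgc.mono hsub)
  have hder := fun z x hx => hw.hasDerivWithinAt_synthEval hb hq z (t := x) hx
  refine ext_ae (ae_eq_of_synth_eq (b t).integrable (integrable _) ?_)
  ext z
  rw [← synthEval_apply z (b 0 + _), map_add,
    ← ContinuousLinearMap.intervalIntegral_comp_comm _ hgi, synthEval_apply, hb t ht,
    hb 0 ⟨le_rfl, ht.1.trans ht.2⟩]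
  have hgz : ContinuousOn (fun τ => synthEval z (coeffField k ε (b τ) (q τ))) (Icc 0 t) :=
    (synthEval z).continuous.comp_continuousOn (hgc.mono hsub)
  rw [intervalIntegral.integral_eq_sub_of_hasDeriv_right_of_le ht.1
    (fun x hx => ((hder z x (hsub hx)).continuousWithinAt).mono hsub)
    (fun x hx => (hder z x (hsub (Ioo_subset_Icc_self hx))).mono_of_mem_nhdsWithin
      (mem_of_superset (Icc_mem_nhdsGT (hx.2.trans_le ht.2)) (Icc_subset_Icc_left hx.1.le)))
    (ContinuousOn.intervalIntegrable (by rwa [uIcc_of_le ht.1]))]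
  ring

/-- The derivative of the flow cancels the unbounded term involving `q`, leaving the locally
Lipschitz field. -/
lemma IsSmoothNLSSolution.hasDerivWithinAt_interaction (hw : IsSmoothNLSSolution k ε T φ w)
    (hb : ∀ t ∈ Icc 0 T, b t =ᵐ[freqMeasure d₁ d₂] invSynth (w t))
    (hq : ∀ t ∈ Icc 0 T, q t =ᵐ[freqMeasure d₁ d₂] fun ξ => (freqSq ξ : ℂ) * invSynth (w t) ξ)
    {t : ℝ} (ht : t ∈ Icc 0 T)
    (hd : HasDerivWithinAt b (coeffField k ε (b t) (q t)) (Icc 0 T) t) :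
    HasDerivWithinAt (fun t => flowZ d₁ d₂ 0 (-t) (b t))
      (fieldZ d₁ d₂ 0 ε k t (flowZ d₁ d₂ 0 (-t) (b t))) (Icc 0 T) t := by
  have h2 : Integrable (fun ξ => ((freqSq ξ ^ 2 : ℝ) : ℂ) * b t ξ)
      (expMeasure (freqMeasure d₁ d₂) 0) := by
    refine (integrable_mul_invSynth (measurable_freqSq.pow_const 2) abs_freqSq_sq_le
      (hw.memHInfty t ht)).congr ((ae_expMeasure_iff 0).2 ?_)
    filter_upwards [hb t ht] with ξ hξ
    rw [hξ]
  have hqb : q t =ᵐ[freqMeasure d₁ d₂] fun ξ => (freqSq ξ : ℂ) * b t ξ := by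
    filter_upwards [hq t ht, hb t ht] with ξ h1 h2
    rw [h1, h2]
  have h3 := hasDerivWithinAt_flow_neg (hQ := measurable_freqSq) hd hqb h2
  have h4 : fieldZ d₁ d₂ 0 ε k t (flowZ d₁ d₂ 0 (-t) (b t)) =
      flowZ d₁ d₂ 0 (-t) (coeffField k ε (b t) (q t) + Complex.I • q t) := by
    rw [coeffField, sub_add_cancel, map_smul]
    change (-(Complex.I * (ε : ℂ))) • flow _ 0 freqSq _ (-t) (nonlin _ 0 k
      (flow _ 0 freqSq _ t (flow _ 0 freqSq _ (-t) (b t)))) = _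
    rw [flow_neg_flow]
  rw [h4]
  exact h3

/-- In the interaction representation, the Fourier coefficients of a smooth solution solve an
ordinary differential equation in `L¹`. -/
theorem IsSmoothNLSSolution.exists_interaction (hw : IsSmoothNLSSolution k ε T φ w) (hT : 0 ≤ T) :
    ∃ D : ℝ → WeightedL1 (freqMeasure d₁ d₂) 0,
      (∀ t ∈ Icc 0 T, HasDerivWithinAt D (fieldZ d₁ d₂ 0 ε k t (D t)) (Icc 0 T) t) ∧
      D 0 =ᵐ[freqMeasure d₁ d₂] invSynth φ ∧
      ∀ t ∈ Icc 0 T, synth (flowZ d₁ d₂ 0 t (D t)) = w t := by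
  obtain ⟨b, hb⟩ := exists_multiplier_invSynth hw.memHInfty (m := fun _ => 1) measurable_const
    (n := 0) (by simp)
  obtain ⟨q, hq⟩ := exists_multiplier_invSynth hw.memHInfty measurable_freqSq abs_freqSq_le
  have hbc : ContinuousOn b (Icc 0 T) :=
    continuousOn_mul_invSynth (m := fun _ => 1) (n := 0) (by simp) hw.memHInfty hw.continuous hb
  have hqc : ContinuousOn q (Icc 0 T) :=
    continuousOn_mul_invSynth abs_freqSq_le hw.memHInfty hw.continuous hq
  have hb' : ∀ t ∈ Icc 0 T, b t =ᵐ[freqMeasure d₁ d₂] invSynth (w t) := fun t ht => by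
    simpa using hb t ht
  have hbw : ∀ t ∈ Icc 0 T, synth (b t) = w t := fun t ht => by
    rw [synth_congr (hb' t ht), synth_invSynth (hw.memHInfty t ht)]
  have hgc : ContinuousOn (fun t => coeffField k ε (b t) (q t)) (Icc 0 T) :=
    (((continuous_nonlin k).comp_continuousOn hbc).const_smul (-(Complex.I * (ε : ℂ)))).sub
      (hqc.const_smul Complex.I)
  refine ⟨fun t => flowZ d₁ d₂ 0 (-t) (b t), fun t ht => ?_, ?_, fun t ht => ?_⟩
  · exact hw.hasDerivWithinAt_interaction hb' hq ht
      (hasDerivWithinAt_of_eq_integral hgc (fun t ht => hw.coeff_eq_integral hbw hq hgc ht) ht)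
  · simp only [neg_zero, flow_zero]
    rw [← hw.initial]
    exact hb' 0 ⟨le_rfl, hT⟩
  · simp only [flow_neg_flow]
    exact hbw t ht

end

/-- A competing solution is not known to have exponentially decaying coefficients, so both are
compared in the unweighted algebra, `a = 0`. -/
theorem IsSmoothNLSSolution.unique {k : ℕ} {ε T : ℝ} (hε : |ε| = 1) {φ : NLSCover d₁ d₂ → ℂ}
    {u w : ℝ → NLSCover d₁ d₂ → ℂ} (hu : IsSmoothNLSSolution k ε T φ u)
    (hw : IsSmoothNLSSolution k ε T φ w) {t : ℝ} (ht : t ∈ Icc 0 T) : w t = u t := by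
  obtain ⟨D, hD, hD0, hDu⟩ := hu.exists_interaction (ht.1.trans ht.2)
  obtain ⟨E, hE, hE0, hEw⟩ := hw.exists_interaction (ht.1.trans ht.2)
  rw [← hDu t ht, ← hEw t ht, solution_unique hε hE hD (ext_ae (hE0.trans hD0.symm)) t ht]

end Uniqueness

/-! ### Nonnegative trigonometric polynomials and lower bounds for convolutions. -/

section Positivity

open scoped NNReal ComplexConjugate
open WeightedL1 Metric

variable {G : Type*} [NormedAddCommGroup G] [MeasurableSpace G] [BorelSpace G]
  [SecondCountableTopology G] {μ : Measure G} {a : ℝ≥0}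

/-- `f` is real and bounded below by `χ`. -/
def Dominates (f : WeightedL1 μ a) (χ : G → ℝ) : Prop :=
  ∀ᵐ ξ ∂μ, (f ξ).im = 0 ∧ χ ξ ≤ (f ξ).re

lemma Dominates.mono {f : WeightedL1 μ a} {χ ψ : G → ℝ} (h : Dominates f χ) (hψ : ψ ≤ χ) :
    Dominates f ψ := by
  filter_upwards [h] with ξ hξ
  exact ⟨hξ.1, (hψ ξ).trans hξ.2⟩

/-- The function equal to `c` on the closed ball and `0` elsewhere. -/
def ballBump (c : ℝ) (x : G) (r : ℝ) : G → ℝ := (closedBall x r).indicator fun _ => c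

lemma ballBump_nonneg {c : ℝ} (hc : 0 ≤ c) (x : G) (r : ℝ) : 0 ≤ ballBump c x r :=
  fun _ => indicator_nonneg (fun _ _ => hc) _

lemma ballBump_mono {c : ℝ} (hc : 0 ≤ c) (x : G) {r r' : ℝ} (h : r ≤ r') :
    ballBump c x r ≤ ballBump c x r' :=
  indicator_le_indicator_of_subset (closedBall_subset_closedBall h) fun _ => hc

lemma Dominates.nonneg {f : WeightedL1 μ a} {c : ℝ} {x : G} {r : ℝ}
    (h : Dominates f (ballBump c x r)) (hc : 0 ≤ c) : Dominates f 0 :=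
  h.mono (ballBump_nonneg hc x r)

variable [SigmaFinite μ] [μ.IsAddLeftInvariant] [μ.IsNegInvariant]

lemma measureReal_closedBall (x : G) (r : ℝ) : μ.real (closedBall x r) = μ.real (closedBall 0 r) := by
  have h : (fun η => x + η) ⁻¹' closedBall x r = closedBall 0 r := by
    ext η
    simp
  rw [Measure.real, Measure.real, ← h, measure_preimage_add]

lemma conv_real {f g : WeightedL1 μ a} (hf : ∀ᵐ ξ ∂μ, (f ξ).im = 0) (hg : ∀ᵐ ξ ∂μ, (g ξ).im = 0) :
    ∀ᵐ ξ ∂μ, conv μ a f g ξ = ((∫ η, (f η).re * (g (ξ - η)).re ∂μ : ℝ) : ℂ) ∧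
      Integrable (fun η => (f η).re * (g (ξ - η)).re) μ := by
  filter_upwards [coe_conv f g, ae_integrable_conv f g] with ξ h1 h2
  have h3 : (fun η => f η * g (ξ - η)) =ᵐ[μ]
      fun η => (((f η).re * (g (ξ - η)).re : ℝ) : ℂ) := by
    filter_upwards [hf, ae_sub_left hg ξ] with η k1 k2
    apply Complex.ext <;> simp [k1, k2]
  refine ⟨?_, ?_⟩
  · rw [h1, convFun, integral_congr_ae h3]
    exact integral_ofReal
  · have h4 := (h2.congr h3).re
    simpa using h4

lemma Dominates.conv {f g : WeightedL1 μ a} (hf : Dominates f 0) (hg : Dominates g 0) :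
    Dominates (conv μ a f g) 0 := by
  filter_upwards [conv_real (Eventually.mono hf fun _ h => h.1) (Eventually.mono hg fun _ h => h.1)] with ξ h
  rw [h.1]
  refine ⟨Complex.ofReal_im _, ?_⟩
  rw [Complex.ofReal_re]
  refine integral_nonneg_of_ae ?_
  filter_upwards [hf, ae_sub_left hg ξ] with η k1 k2
  exact mul_nonneg k1.2 k2.2

/-- The convolution of two functions that are large on balls is large on a ball. -/
lemma Dominates.conv_ballBump {f g : WeightedL1 μ a} {c₁ c₂ R ρ ρ' r : ℝ} {x y : G}
    (hf : Dominates f (ballBump c₁ x R)) (hg : Dominates g (ballBump c₂ y ρ)) (hc₁ : 0 ≤ c₁)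
    (hc₂ : 0 ≤ c₂) (hr : r ≤ ρ) (hR : ρ' + r ≤ R) :
    Dominates (WeightedL1.conv μ a f g)
      (ballBump (c₁ * c₂ * μ.real (closedBall 0 r)) (x + y) ρ') := by
  have hf0 := hf.nonneg hc₁
  have hg0 := hg.nonneg hc₂
  filter_upwards [conv_real (Eventually.mono hf fun _ h => h.1) (Eventually.mono hg fun _ h => h.1)] with ξ h
  rw [h.1]
  refine ⟨Complex.ofReal_im _, ?_⟩
  rw [Complex.ofReal_re]
  have hnn : ∀ᵐ η ∂μ, 0 ≤ (f η).re * (g (ξ - η)).re := by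
    filter_upwards [hf0, ae_sub_left hg0 ξ] with η k1 k2
    exact mul_nonneg k1.2 k2.2
  by_cases hξ : ξ ∈ closedBall (x + y) ρ'
  · have h1 : ∫ η, (closedBall (ξ - y) r).indicator (fun _ => c₁ * c₂) η ∂μ ≤
        ∫ η, (f η).re * (g (ξ - η)).re ∂μ := by
      refine integral_mono_of_nonneg (Eventually.of_forall fun η =>
        indicator_nonneg (fun _ _ => mul_nonneg hc₁ hc₂) η) h.2 ?_
      filter_upwards [hf, ae_sub_left hg ξ, hnn] with η k1 k2 k3
      by_cases hη : η ∈ closedBall (ξ - y) r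
      · have hη1 : η ∈ closedBall x R := by
          rw [mem_closedBall, dist_eq_norm] at hη hξ ⊢
          calc ‖η - x‖ = ‖(η - (ξ - y)) + (ξ - (x + y))‖ := by congr 1; abel
            _ ≤ r + ρ' := (norm_add_le _ _).trans (add_le_add hη hξ)
            _ ≤ R := by linarith
        have hη2 : ξ - η ∈ closedBall y ρ := by
          rw [mem_closedBall, dist_eq_norm] at hη ⊢
          rw [← norm_neg]
          refine le_trans (le_of_eq ?_) (hη.trans hr)
          congr 1; abel
        rw [indicator_of_mem hη]
        have k4 := k1.2
        have k5 := k2.2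
        rw [ballBump, indicator_of_mem hη1] at k4
        rw [ballBump, indicator_of_mem hη2] at k5
        exact mul_le_mul k4 k5 hc₂ (hc₁.trans k4)
      · rw [indicator_of_notMem hη]
        exact k3
    rw [integral_indicator isClosed_closedBall.measurableSet, setIntegral_const, smul_eq_mul,
      measureReal_closedBall, mul_comm] at h1
    rwa [ballBump, indicator_of_mem hξ]
  · rw [ballBump, indicator_of_notMem hξ]
    exact integral_nonneg_of_ae hnn

lemma Dominates.conjRefl_ballBump {f : WeightedL1 μ a} {c r : ℝ} {x : G}
    (hf : Dominates f (ballBump c x r)) :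
    Dominates (conjRefl μ a f) (ballBump c (-x) r) := by
  filter_upwards [ae_neg hf, coe_conjRefl f] with ξ h1 h2
  rw [h2, Complex.conj_im, Complex.conj_re, h1.1, neg_zero]
  refine ⟨rfl, le_trans (le_of_eq ?_) h1.2⟩
  have : ξ ∈ closedBall (-x) r ↔ -ξ ∈ closedBall x r := by
    rw [mem_closedBall, mem_closedBall, dist_eq_norm, dist_eq_norm, ← norm_neg]
    congr! 2
    abel
  classical
  rw [ballBump, ballBump, indicator_apply, indicator_apply]
  simp only [this]

lemma Dominates.conjRefl {f : WeightedL1 μ a} (hf : Dominates f 0) :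
    Dominates (conjRefl μ a f) 0 := by
  filter_upwards [ae_neg hf, coe_conjRefl f] with ξ h1 h2
  rw [h2, Complex.conj_im, Complex.conj_re, h1.1, neg_zero]
  exact ⟨rfl, h1.2⟩

/-- `Φ` is a trigonometric polynomial with nonnegative coefficients, one of which, with frequency
`m`, is bounded below by `χ`. -/
def IsPosTrig (Φ : ℝ → WeightedL1 μ a) (m : ℤ) (χ : G → ℝ) : Prop :=
  ∃ (ι : Type) (_ : Fintype ι) (l : ι → ℤ) (f : ι → WeightedL1 μ a), (∀ i, Dominates (f i) 0) ∧
    (∀ x, Φ x = ∑ i, Complex.exp (-(Complex.I * (l i * x : ℝ))) • f i) ∧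
    ∃ i, l i = m ∧ Dominates (f i) χ

/-- Modes add and convolution preserves nonnegativity. The pair of distinguished terms gives the
bound; the other pairs contribute nonnegative coefficients and are merely kept in the list. -/
lemma IsPosTrig.conv_ballBump {Φ Ψ : ℝ → WeightedL1 μ a} {m n : ℤ} {c₁ c₂ R ρ ρ' r : ℝ} {x y : G}
    (hΦ : IsPosTrig Φ m (ballBump c₁ x R)) (hΨ : IsPosTrig Ψ n (ballBump c₂ y ρ)) (hc₁ : 0 ≤ c₁)
    (hc₂ : 0 ≤ c₂) (hr : r ≤ ρ) (hR : ρ' + r ≤ R) :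
    IsPosTrig (fun t => conv μ a (Φ t) (Ψ t)) (m + n)
      (ballBump (c₁ * c₂ * μ.real (closedBall 0 r)) (x + y) ρ') := by
  obtain ⟨ι, _, l, f, hf, hΦ, i, hi, hfi⟩ := hΦ
  obtain ⟨κ, _, l', g, hg, hΨ, j, hj, hgj⟩ := hΨ
  refine ⟨ι × κ, inferInstance, fun p => l p.1 + l' p.2, fun p => conv μ a (f p.1) (g p.2),
    fun p => (hf p.1).conv (hg p.2), fun t => ?_, (i, j), by simp [hi, hj],
    hfi.conv_ballBump hgj hc₁ hc₂ hr hR⟩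
  simp only
  rw [hΦ, hΨ, map_sum (conv μ a), Fintype.sum_prod_type, sum_apply]
  refine Finset.sum_congr rfl fun i _ => ?_
  rw [map_sum]
  refine Finset.sum_congr rfl fun j _ => ?_
  rw [map_smul, map_smul, smul_apply, smul_smul, ← Complex.exp_add]
  congr 2
  push_cast
  ring

lemma IsPosTrig.conjRefl {Φ : ℝ → WeightedL1 μ a} {m : ℤ} {c r : ℝ} {x : G}
    (hΦ : IsPosTrig Φ m (ballBump c x r)) :
    IsPosTrig (fun t => WeightedL1.conjRefl μ a (Φ t)) (-m) (ballBump c (-x) r) := by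
  obtain ⟨ι, _, l, f, hf, hΦ, i, hi, hfi⟩ := hΦ
  refine ⟨ι, inferInstance, fun i => -l i, fun i => WeightedL1.conjRefl μ a (f i),
    fun i => (hf i).conjRefl, fun t => ?_, i, by simp [hi], hfi.conjRefl_ballBump⟩
  simp only
  rw [hΦ, map_sum]
  refine Finset.sum_congr rfl fun i _ => ?_
  rw [map_smulₛₗ, ← Complex.exp_conj]
  congr 2
  simp

/-- The sums of `k` differences of two elements and one more element of the family `(p, c)`. -/
inductive IsResonantSum {ι H : Type*} [AddCommGroup H] (p : ι → H) (c : ι → ℤ) : ℕ → H → ℤ → Prop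
  | base (j : ι) : IsResonantSum p c 0 (p j) (c j)
  | step {k : ℕ} {x : H} {m : ℤ} (i j : ι) (h : IsResonantSum p c k x m) :
      IsResonantSum p c (k + 1) (p i - p j + x) (c i - c j + m)

lemma IsPosTrig.nonlin {ι : Type*} {p : ι → G} {c : ι → ℤ} {Φ : ℝ → WeightedL1 μ a} {B A : ℝ}
    (hB : 0 ≤ B) (hA : 0 ≤ A) (hΦ : ∀ j, IsPosTrig Φ (c j) (ballBump B (p j) A)) {k : ℕ} {x : G}
    {m : ℤ} (h : IsResonantSum p c k x m) :
    IsPosTrig (fun t => nonlin μ a k (Φ t)) m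
      (ballBump (B ^ (2 * k + 1) * μ.real (closedBall 0 (A / 4)) ^ (2 * k)) x (A / 2)) := by
  induction h with
  | base j =>
    obtain ⟨ι, _, l, f, hf, hΦ, i, hi, hfi⟩ := hΦ j
    refine ⟨ι, inferInstance, l, f, hf, hΦ, i, hi, hfi.mono ?_⟩
    simpa using ballBump_mono hB (p j) (by linarith : A / 2 ≤ A)
  | step i j h ih =>
    rename_i k x m
    -- Convolving two bumps of radius `A` leaves a bound on radius `3 * A / 4`; a further
    -- convolution with the inductive function, at radius `A / 2`, returns to radius `A / 2`. The
    -- radius thus does not shrink with `k`.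
    have h1 := (hΦ i).conv_ballBump (hΦ j).conjRefl hB hB (r := A / 4) (ρ' := 3 * A / 4)
      (by linarith) (by linarith)
    have h2 := h1.conv_ballBump ih (r := A / 4) (ρ' := A / 2) (by positivity) (by positivity)
      (by linarith) (by linarith)
    have e : B ^ (2 * (k + 1) + 1) * μ.real (closedBall 0 (A / 4)) ^ (2 * (k + 1)) =
        B * B * μ.real (closedBall 0 (A / 4)) * (B ^ (2 * k + 1) *
          μ.real (closedBall 0 (A / 4)) ^ (2 * k)) * μ.real (closedBall 0 (A / 4)) := by
      ring
    rw [sub_eq_add_neg (p i), sub_eq_add_neg (c i), e]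
    exact h2

end Positivity

/-! ### Time averages over whole periods. -/

section Average

open scoped NNReal ComplexConjugate
open WeightedL1 Metric

variable {G : Type*} [NormedAddCommGroup G] [MeasurableSpace G] [BorelSpace G]
  [SecondCountableTopology G] {μ : Measure G} {a : ℝ≥0}

lemma integral_phase_period {T θ : ℝ} {n : ℤ} (hθ : θ * T = 2 * Real.pi * n) (hn : n ≠ 0) (l : ℤ) :
    ∫ τ in (0 : ℝ)..T, Complex.exp (-(Complex.I * (l * (θ * τ) : ℝ))) =
      if l = 0 then (T : ℂ) else 0 := by
  split_ifs with hl
  · simp [hl]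
  · have hθ0 : θ ≠ 0 := by
      rintro rfl
      rw [zero_mul] at hθ
      have : (n : ℝ) = 0 := by
        have h2 : (2 * Real.pi : ℝ) ≠ 0 := by positivity
        exact (mul_eq_zero.1 hθ.symm).resolve_left h2
      exact hn (by exact_mod_cast this)
    set c : ℂ := -(Complex.I * (l * θ : ℝ)) with hc
    have hc0 : c ≠ 0 := by
      rw [hc, neg_ne_zero]
      refine mul_ne_zero Complex.I_ne_zero ?_
      have : (l : ℝ) * θ ≠ 0 := mul_ne_zero (by exact_mod_cast hl) hθ0
      exact_mod_cast this
    have e : ∀ τ : ℝ, Complex.exp (-(Complex.I * (l * (θ * τ) : ℝ))) = Complex.exp (c * τ) :=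
      fun τ => by
        rw [hc]
        congr 1
        push_cast
        ring
    simp only [e]
    rw [integral_exp_mul_complex hc0]
    have h1 : c * T = ((-(l * n) : ℤ) : ℂ) * (2 * Real.pi * Complex.I) := by
      have h2 : ((θ * T : ℝ) : ℂ) = 2 * Real.pi * n := by rw [hθ]; push_cast; ring
      rw [hc]
      push_cast at h2 ⊢
      linear_combination (-(Complex.I * l)) * h2
    rw [h1, Complex.exp_int_mul_two_pi_mul_I]
    simp

/-- The time average of a trigonometric polynomial with nonnegative coefficients. -/
lemma IsPosTrig.le_re_integral {Φ : ℝ → WeightedL1 μ a} {χ : G → ℝ} (hΦ : IsPosTrig Φ 0 χ)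
    {T θ m : ℝ} {n : ℤ} (hT : 0 ≤ T) (hθ : θ * T = 2 * Real.pi * n) (hn : n ≠ 0)
    (Λ : WeightedL1 μ a →L[ℂ] ℂ) (hΛ : ∀ f, Dominates f 0 → 0 ≤ (Λ f).re)
    (hm : ∀ f, Dominates f χ → m ≤ (Λ f).re) :
    T * m ≤ (∫ τ in (0 : ℝ)..T, Λ (Φ (θ * τ))).re := by
  obtain ⟨ι, _, l, f, hf, hΦ, i, hi, hfi⟩ := hΦ
  have h1 : ∫ τ in (0 : ℝ)..T, Λ (Φ (θ * τ)) = ∑ i, (if l i = 0 then (T : ℂ) else 0) * Λ (f i) := by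
    simp only [hΦ, map_sum, map_smul, smul_eq_mul]
    rw [intervalIntegral.integral_finsetSum]
    · refine Finset.sum_congr rfl fun i _ => ?_
      rw [intervalIntegral.integral_mul_const, integral_phase_period hθ hn]
    · intro i _
      refine Continuous.intervalIntegrable ?_ _ _
      fun_prop
  rw [h1, Complex.re_sum]
  -- Only the zero modes survive the average and all are nonnegative, so every one except the
  -- distinguished resonant one can be discarded.
  have h2 : ∀ j, 0 ≤ ((if l j = 0 then (T : ℂ) else 0) * Λ (f j)).re := fun j => by
    split_ifs
    · rw [Complex.re_ofReal_mul]
      exact mul_nonneg hT (hΛ _ (hf j))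
    · simp
  refine le_trans ?_ (Finset.single_le_sum (fun j _ => h2 j) (Finset.mem_univ i))
  rw [if_pos hi, Complex.re_ofReal_mul]
  exact mul_le_mul_of_nonneg_left (hm _ hfi) hT

end Average

/-! ### Indicator functions of balls as data. -/

section Bump

open scoped NNReal ComplexConjugate
open WeightedL1 Metric

variable {G : Type*} [NormedAddCommGroup G] [MeasurableSpace G] [BorelSpace G]
  [SecondCountableTopology G] {μ : Measure G}

lemma integrable_ballBump (hμ : ∀ (x : G) r, μ (closedBall x r) < ⊤) (a : ℝ≥0) (B : ℝ) (x : G)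
    (A : ℝ) : Integrable (fun ξ => (ballBump B x A ξ : ℂ)) (expMeasure μ a) := by
  have hm : Measurable fun ξ => (ballBump B x A ξ : ℂ) :=
    Complex.measurable_ofReal.comp (measurable_const.indicator isClosed_closedBall.measurableSet)
  refine (integrable_expMeasure_iff a).2 ⟨hm.aestronglyMeasurable, ?_⟩
  calc ∫⁻ ξ, expWeight a ξ * ‖(ballBump B x A ξ : ℂ)‖ₑ ∂μ
      ≤ ∫⁻ ξ, (closedBall x A).indicator (fun _ => ENNReal.ofReal (Real.exp (a * (‖x‖ + A))) *
          ENNReal.ofReal |B|) ξ ∂μ := by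
        refine lintegral_mono fun ξ => ?_
        by_cases h : ξ ∈ closedBall x A
        · rw [ballBump, indicator_of_mem h, indicator_of_mem h, ← ofReal_norm (B : ℂ),
            Complex.norm_real, Real.norm_eq_abs, expWeight]
          gcongr
          rw [mem_closedBall, dist_eq_norm] at h
          calc ‖ξ‖ = ‖x + (ξ - x)‖ := by rw [add_sub_cancel]
            _ ≤ ‖x‖ + A := (norm_add_le _ _).trans (by gcongr)
        · simp [ballBump, indicator_of_notMem h]
    _ < ⊤ := by
        rw [lintegral_indicator isClosed_closedBall.measurableSet, setLIntegral_const]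
        exact ENNReal.mul_lt_top (by finiteness) (hμ x A)

/-- The function `B` on the closed ball of radius `A` around `x`, as an element of the weighted
space. -/
def bump (hμ : ∀ (x : G) r, μ (closedBall x r) < ⊤) (a : ℝ≥0) (B : ℝ) (x : G) (A : ℝ) :
    WeightedL1 μ a := (integrable_ballBump hμ a B x A).toL1

variable {hμ : ∀ (x : G) r, μ (closedBall x r) < ⊤} {a : ℝ≥0} {B : ℝ} {x : G} {A : ℝ}

lemma coe_bump : (bump hμ a B x A : G → ℂ) =ᵐ[μ] fun ξ => (ballBump B x A ξ : ℂ) := coe_toL1 _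

lemma dominates_bump : Dominates (bump hμ a B x A) (ballBump B x A) := by
  filter_upwards [coe_bump (hμ := hμ) (a := a) (B := B) (x := x) (A := A)] with ξ h
  rw [h]
  exact ⟨Complex.ofReal_im _, le_rfl⟩

lemma norm_ballBump_le (hB : 0 ≤ B) (ξ : G) : ‖(ballBump B x A ξ : ℂ)‖ ≤ B := by
  rw [Complex.norm_real, Real.norm_of_nonneg (ballBump_nonneg hB x A ξ)]
  exact indicator_le_self' (fun _ _ => hB) ξ

variable [SigmaFinite μ] [μ.IsAddLeftInvariant] [μ.IsNegInvariant]

/-- The condition `ha` makes the weight at most 2 on the support, so the bound does not depend on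
`a`. -/
lemma norm_bump_le (hB : 0 ≤ B) (ha : Real.exp (a * (‖x‖ + A)) ≤ 2) :
    ‖bump hμ a B x A‖ ≤ 2 * B * μ.real (closedBall 0 A) := by
  have h1 : ‖bump hμ a B x A‖ₑ ≤ ENNReal.ofReal (2 * B) * μ (closedBall x A) := by
    rw [bump, enorm_toL1]
    calc ∫⁻ ξ, expWeight a ξ * ‖(ballBump B x A ξ : ℂ)‖ₑ ∂μ
        ≤ ∫⁻ ξ, (closedBall x A).indicator (fun _ => ENNReal.ofReal (2 * B)) ξ ∂μ := by
          refine lintegral_mono fun ξ => ?_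
          by_cases h : ξ ∈ closedBall x A
          · rw [ballBump, indicator_of_mem h, indicator_of_mem h, ← ofReal_norm (B : ℂ),
              Complex.norm_real, Real.norm_of_nonneg hB, expWeight,
              ENNReal.ofReal_mul (by norm_num : (0 : ℝ) ≤ 2)]
            gcongr
            refine le_trans (Real.exp_le_exp.2 ?_) ha
            gcongr
            rw [mem_closedBall, dist_eq_norm] at h
            calc ‖ξ‖ = ‖x + (ξ - x)‖ := by rw [add_sub_cancel]
              _ ≤ ‖x‖ + A := (norm_add_le _ _).trans (by gcongr)
          · simp [ballBump, indicator_of_notMem h]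
      _ = _ := by
          rw [lintegral_indicator isClosed_closedBall.measurableSet, setLIntegral_const]
  have h2 := ENNReal.toReal_mono (ENNReal.mul_ne_top ENNReal.ofReal_ne_top (hμ x A).ne) h1
  rwa [toReal_enorm, ENNReal.toReal_mul, ENNReal.toReal_ofReal (by positivity),
    ← Measure.real, measureReal_closedBall] at h2

lemma isPosTrig_sum_bump {ι : Type} [Fintype ι] {p : ι → G} {c : ι → ℤ} (hB : 0 ≤ B) (j : ι) :
    IsPosTrig (fun t => ∑ i, Complex.exp (-(Complex.I * (c i * t : ℝ))) • bump hμ a B (p i) A)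
      (c j) (ballBump B (p j) A) :=
  ⟨ι, inferInstance, c, fun i => bump hμ a B (p i) A, fun _ => dominates_bump.nonneg hB,
    fun _ => rfl, j, rfl, dominates_bump⟩

end Bump

/-! ### Freezing the phases: error estimates. -/

section Inflation

open scoped NNReal ComplexConjugate
open WeightedL1 Metric

variable {G : Type*} [NormedAddCommGroup G] [MeasurableSpace G] [BorelSpace G]
  [SecondCountableTopology G] {μ : Measure G} {a : ℝ≥0}

variable (μ) in
/-- The normalized indicator function of a set. -/
def avgTest (S : Set G) : G → ℂ := S.indicator fun _ => ((μ.real S)⁻¹ : ℂ)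

lemma isTest_avgTest {S : Set G} (hS : MeasurableSet S) (h0 : μ S ≠ 0) (h1 : μ S ≠ ⊤) :
    IsTest μ (μ.real S)⁻¹.toNNReal (avgTest μ S) := by
  have hp : 0 < μ.real S := ENNReal.toReal_pos h0 h1
  have e : ‖((μ.real S)⁻¹ : ℂ)‖ₑ = ENNReal.ofReal (μ.real S)⁻¹ := by
    rw [← ofReal_norm, norm_inv, Complex.norm_real, Real.norm_of_nonneg hp.le]
  refine ⟨measurable_const.indicator hS, fun ξ => ?_, ?_⟩
  · rw [avgTest]
    by_cases h : ξ ∈ S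
    · rw [indicator_of_mem h, e]; rfl
    · rw [indicator_of_notMem h]; simp
  · simp only [avgTest, enorm_indicator_eq_indicator_enorm]
    rw [lintegral_indicator hS, setLIntegral_const, e, ENNReal.ofReal_inv_of_pos hp,
      Measure.real, ENNReal.ofReal_toReal h1, ENNReal.inv_mul_cancel h0 h1]

lemma integral_avgTest_mul {S : Set G} (hS : MeasurableSet S) (f : G → ℂ) :
    ∫ ξ, avgTest μ S ξ * f ξ ∂μ = ((μ.real S)⁻¹ : ℂ) * ∫ ξ in S, f ξ ∂μ := by
  rw [← integral_const_mul, ← integral_indicator hS]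
  refine integral_congr_ae (Eventually.of_forall fun ξ => ?_)
  by_cases h : ξ ∈ S <;> simp [avgTest, h]

lemma le_re_integral_avgTest_mul {S : Set G} (hS : MeasurableSet S) (h0 : μ S ≠ 0) (h1 : μ S ≠ ⊤)
    {β : ℝ} {f : WeightedL1 μ a} (hf : ∀ᵐ ξ ∂μ, ξ ∈ S → β ≤ (f ξ).re) :
    β ≤ (∫ ξ, avgTest μ S ξ * f ξ ∂μ).re := by
  have hp : 0 < μ.real S := ENNReal.toReal_pos h0 h1
  have hi : IntegrableOn f S μ := (WeightedL1.integrable f).integrableOn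
  rw [integral_avgTest_mul hS, ← Complex.ofReal_inv, Complex.re_ofReal_mul]
  have h2 : (∫ ξ in S, f ξ ∂μ).re = ∫ ξ in S, (f ξ).re ∂μ :=
    (integral_re (𝕜 := ℂ) hi).symm
  have h3 : μ.real S * β ≤ ∫ ξ in S, (f ξ).re ∂μ := by
    rw [← smul_eq_mul, ← setIntegral_const]
    refine setIntegral_mono_on_ae (integrableOn_const h1) hi.re hS hf
  rw [h2, ← div_eq_inv_mul, le_div_iff₀ hp]
  linarith

variable [SigmaFinite μ] [μ.IsAddLeftInvariant] [μ.IsNegInvariant]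

variable {Q : G → ℝ} {hQ : Measurable Q}

/-- The free evolution acts almost trivially on the low frequencies. -/
lemma norm_integral_flow_sub_le {K : ℝ≥0} {B T τ : ℝ} {h : G → ℂ} (hh : IsTest μ K h)
    (hs : ∀ ξ, h ξ ≠ 0 → |Q ξ| ≤ 1) {f : WeightedL1 μ a} (hf : DualBound K B f) (hT : 0 < T)
    (hτ : |τ| ≤ T) :
    ‖∫ ξ, h ξ * flow μ a Q hQ τ f ξ ∂μ - ∫ ξ, h ξ * f ξ ∂μ‖ ≤ T * B := by
  -- Where `h` is supported the phase differs from 1 by at most `T`; after division by `T` the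
  -- product is again a test function, and the bound on `f` applies.
  set g : G → ℂ := fun ξ => h ξ * ((Complex.exp (-(Complex.I * (τ * Q ξ : ℝ))) - 1) / T) with hg
  have hle : ∀ ξ, ‖g ξ‖ₑ ≤ ‖h ξ‖ₑ := fun ξ => by
    by_cases h0 : h ξ = 0
    · simp [hg, h0]
    · rw [← ofReal_norm, ← ofReal_norm]
      refine ENNReal.ofReal_le_ofReal ?_
      rw [hg, norm_mul, norm_div, Complex.norm_real, Real.norm_of_nonneg hT.le]
      refine mul_le_of_le_one_right (norm_nonneg _) ((div_le_one hT).2 ?_)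
      have e : -(Complex.I * (τ * Q ξ : ℝ)) = Complex.I * ((-(τ * Q ξ) : ℝ) : ℂ) := by
        push_cast; ring
      rw [e]
      refine Real.norm_exp_I_mul_ofReal_sub_one_le.trans ?_
      rw [Real.norm_eq_abs, abs_neg, abs_mul]
      calc |τ| * |Q ξ| ≤ T * 1 := mul_le_mul hτ (hs ξ h0) (abs_nonneg _) hT.le
        _ = T := mul_one T
  have hgt : IsTest μ K g := by
    refine ⟨hh.meas.mul ?_, fun ξ => (hle ξ).trans (hh.bound ξ), (lintegral_mono hle).trans hh.integral⟩
    fun_prop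
  have e : ∫ ξ, h ξ * flow μ a Q hQ τ f ξ ∂μ - ∫ ξ, h ξ * f ξ ∂μ = T * ∫ ξ, g ξ * f ξ ∂μ := by
    rw [← integral_const_mul, ← integral_sub (integrable_mul hh.meas hh.bound_weight _)
      (integrable_mul hh.meas hh.bound_weight _)]
    refine integral_congr_ae ?_
    filter_upwards [coe_flow (hQ := hQ) τ f] with ξ h1
    have hT' : (T : ℂ) ≠ 0 := by exact_mod_cast hT.ne'
    rw [h1, hg]
    field_simp
  rw [e, norm_mul, Complex.norm_real, Real.norm_of_nonneg hT.le]
  exact mul_le_mul_of_nonneg_left (hf g hgt) hT.le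

variable {hμ : ∀ (x : G) r, μ (closedBall x r) < ⊤}

lemma ae_norm_sum_smul_bump_le {ι : Type} [Fintype ι] {B A D : ℝ} (hB : 0 ≤ B) (hD : 0 ≤ D)
    (p : ι → G) {z : ι → G → ℂ} (hz : ∀ i, ∀ ξ ∈ closedBall (p i) A, ‖z i ξ‖ ≤ D) :
    ∀ᵐ ξ ∂μ, ‖∑ i, z i ξ * bump hμ a B (p i) A ξ‖ ≤ Fintype.card ι * (D * B) := by
  have h1 : ∀ᵐ ξ ∂μ, ∀ i, bump hμ a B (p i) A ξ = (ballBump B (p i) A ξ : ℂ) :=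
    ae_all_iff.2 fun i => coe_bump
  filter_upwards [h1] with ξ h1
  refine (norm_sum_le_of_le Finset.univ (f := fun i => z i ξ * bump hμ a B (p i) A ξ)
    (n := fun _ => D * B) fun i _ => ?_).trans (by simp)
  rw [h1, norm_mul]
  by_cases h : ξ ∈ closedBall (p i) A
  · exact mul_le_mul (hz i ξ h) (norm_ballBump_le hB ξ) (norm_nonneg _) hD
  · rw [ballBump, indicator_of_notMem h, Complex.ofReal_zero, norm_zero, mul_zero]
    positivity

lemma coe_sum_smul {ι : Type} [Fintype ι] (c : ι → ℂ) (f : ι → WeightedL1 μ a) :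
    (∑ i, c i • f i : WeightedL1 μ a) =ᵐ[μ] fun ξ => ∑ i, c i * f i ξ := by
  classical
  suffices h : ∀ s : Finset ι, (∑ i ∈ s, c i • f i : WeightedL1 μ a) =ᵐ[μ]
      fun ξ => ∑ i ∈ s, c i * f i ξ from h _
  intro s
  induction s using Finset.induction_on with
  | empty =>
    have h := coe_smul (0 : ℂ) (0 : WeightedL1 μ a)
    rw [zero_smul] at h
    filter_upwards [h] with ξ h
    rw [Finset.sum_empty, h, Finset.sum_empty, zero_smul, Pi.zero_apply]
  | insert i s hi ih =>
    rw [Finset.sum_insert hi]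
    filter_upwards [coe_add (c i • f i) (∑ i ∈ s, c i • f i), coe_smul (c i) (f i), ih] with ξ h1 h2 h3
    rw [h1, Pi.add_apply, h2, h3, Finset.sum_insert hi, Pi.smul_apply, smul_eq_mul]

/-- On a short time interval the free evolution of a sum of bumps is a trigonometric polynomial up
to a small error. -/
lemma ae_norm_flow_sub_trig_le {ι : Type} [Fintype ι] {B A E T θ τ : ℝ} (hB : 0 ≤ B) (hE : 0 ≤ E)
    {p : ι → G} {c : ι → ℤ} (hQE : ∀ i, ∀ ξ ∈ closedBall (p i) A, |Q ξ - θ * c i| ≤ E)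
    (hτ : τ ∈ Icc 0 T) :
    ∀ᵐ ξ ∂μ, ‖(flow μ a Q hQ τ (∑ i, bump hμ a B (p i) A) -
      ∑ i, Complex.exp (-(Complex.I * (c i * (θ * τ) : ℝ))) • bump hμ a B (p i) A :
        WeightedL1 μ a) ξ‖ ≤ Fintype.card ι * (T * E * B) := by
  have hT : 0 ≤ T := hτ.1.trans hτ.2
  have h1 := ae_norm_sum_smul_bump_le (μ := μ) (a := a) (hμ := hμ) (A := A) hB (mul_nonneg hT hE) p
    (z := fun i ξ => Complex.exp (-(Complex.I * (τ * Q ξ : ℝ))) -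
      Complex.exp (-(Complex.I * (c i * (θ * τ) : ℝ)))) (fun i ξ hξ => ?_)
  · have h2 := coe_sum_smul (fun i : ι => (1 : ℂ)) (fun i => bump hμ a B (p i) A)
    simp only [one_smul, one_mul] at h2
    filter_upwards [h1, h2, coe_flow (hQ := hQ) τ (∑ i, bump hμ a B (p i) A),
      coe_sum_smul (fun i => Complex.exp (-(Complex.I * (c i * (θ * τ) : ℝ))))
        (fun i => bump hμ a B (p i) A),
      coe_sub (flow μ a Q hQ τ (∑ i, bump hμ a B (p i) A))
        (∑ i, Complex.exp (-(Complex.I * (c i * (θ * τ) : ℝ))) • bump hμ a B (p i) A)]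
      with ξ h1 h2 h3 h4 h5
    rw [h5, Pi.sub_apply, h3, h4, h2, Finset.mul_sum, ← Finset.sum_sub_distrib]
    simpa only [sub_mul] using h1
  · have e : Complex.exp (-(Complex.I * (τ * Q ξ : ℝ))) -
        Complex.exp (-(Complex.I * (c i * (θ * τ) : ℝ))) =
        Complex.exp (Complex.I * ((-(c i * (θ * τ)) : ℝ) : ℂ)) *
          (Complex.exp (Complex.I * ((-(τ * (Q ξ - θ * c i)) : ℝ) : ℂ)) - 1) := by
      rw [mul_sub, ← Complex.exp_add, mul_one]
      congr 2 <;> push_cast <;> ring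
    rw [e, norm_mul, Complex.norm_exp_I_mul_ofReal, one_mul]
    refine Real.norm_exp_I_mul_ofReal_sub_one_le.trans ?_
    rw [Real.norm_eq_abs, abs_neg, abs_mul, abs_of_nonneg hτ.1]
    exact mul_le_mul hτ.2 (hQE i ξ hξ) (abs_nonneg _) hT

end Inflation

/-! ### Lower bound for the solution at low frequencies. -/

section Inflation

open scoped NNReal ComplexConjugate
open WeightedL1 Metric

variable {G : Type*} [NormedAddCommGroup G] [MeasurableSpace G] [BorelSpace G]
  [SecondCountableTopology G] {μ : Measure G} {a : ℝ≥0}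
  [SigmaFinite μ] [μ.IsAddLeftInvariant] [μ.IsNegInvariant]
  {Q : G → ℝ} {hQ : Measurable Q} {hμ : ∀ (x : G) r, μ (closedBall x r) < ⊤}
  {ι : Type} [Fintype ι] {p : ι → G} {c : ι → ℤ} {A B E T θ M : ℝ} {S : Set G} {k : ℕ}

lemma norm_sum_bump_le (hB : 0 ≤ B) (ha : ∀ i, Real.exp (a * (‖p i‖ + A)) ≤ 2) (z : ι → ℂ)
    (hz : ∀ i, ‖z i‖ ≤ 1) :
    ‖∑ i, z i • bump hμ a B (p i) A‖ ≤ Fintype.card ι * (2 * B * μ.real (closedBall 0 A)) := by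
  refine (norm_sum_le_of_le Finset.univ (n := fun _ => 2 * B * μ.real (closedBall 0 A))
    fun i _ => ?_).trans (by simp)
  rw [norm_smul]
  exact (mul_le_of_le_one_left (norm_nonneg _) (hz i)).trans (norm_bump_le hB (ha i))

lemma dualBound_sum_bump (K : ℝ≥0) (hB : 0 ≤ B) :
    DualBound K (Fintype.card ι * B) (∑ i, bump hμ a B (p i) A) := by
  refine dualBound_of_ae K (by positivity) ?_
  have h1 := ae_norm_sum_smul_bump_le (μ := μ) (a := a) (hμ := hμ) (A := A) hB zero_le_one p
    (z := fun _ _ => 1) (fun i ξ _ => by simp)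
  have h2 := coe_sum_smul (fun i : ι => (1 : ℂ)) (fun i => bump hμ a B (p i) A)
  simp only [one_smul] at h2
  filter_upwards [h1, h2] with ξ h1 h2
  rw [h2]
  simpa using h1

/-- Two replacements are made: the outer flow becomes the identity at low frequencies, with relative
error `T`, and the inner flow becomes a trigonometric polynomial, with relative error `T * E` passed
through the Lipschitz bound for the nonlinearity. -/
lemma norm_integral_flow_nonlin_sub_le {K : ℝ≥0} {h : G → ℂ} (hh : IsTest μ K h)
    (hs : ∀ ξ, h ξ ≠ 0 → |Q ξ| ≤ 1) (hB : 0 ≤ B) (hE : 0 ≤ E) (hT : 0 < T)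
    (ha : ∀ i, Real.exp (a * (‖p i‖ + A)) ≤ 2)
    (hQE : ∀ i, ∀ ξ ∈ closedBall (p i) A, |Q ξ - θ * c i| ≤ E)
    (hM : Fintype.card ι * (2 * B * μ.real (closedBall 0 A)) ≤ M) {τ : ℝ} (hτ : τ ∈ Icc 0 T) :
    ‖∫ ξ, h ξ * flow μ a Q hQ (-τ) (nonlin μ a k
        (flow μ a Q hQ τ (∑ i, bump hμ a B (p i) A))) ξ ∂μ -
      ∫ ξ, h ξ * nonlin μ a k (∑ i, Complex.exp (-(Complex.I * (c i * (θ * τ) : ℝ))) •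
        bump hμ a B (p i) A) ξ ∂μ‖ ≤
      (2 * k + 1) * M ^ (2 * k) * (Fintype.card ι * B) * (T + T * E) := by
  set m : ℝ := (Fintype.card ι : ℝ) with hm
  set v₀ : WeightedL1 μ a := ∑ i, bump hμ a B (p i) A with hv₀
  set W : WeightedL1 μ a := ∑ i, Complex.exp (-(Complex.I * (c i * (θ * τ) : ℝ))) •
        bump hμ a B (p i) A with hW
  have hM0 : 0 ≤ M := le_trans (by positivity) hM
  have hP := isModuleBound_dualBound (μ := μ) (a := a) K
  have hvM : ‖flow μ a Q hQ τ v₀‖ ≤ M := by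
    rw [LinearIsometry.norm_map]
    have := norm_sum_bump_le (hμ := hμ) hB ha (fun _ => 1) (fun _ => by simp)
    simp only [one_smul] at this
    exact this.trans hM
  have hWM : ‖W‖ ≤ M := by
    refine (norm_sum_bump_le hB ha _ fun i => ?_).trans hM
    have e : -(Complex.I * (c i * (θ * τ) : ℝ)) = Complex.I * ((-(c i * (θ * τ)) : ℝ) : ℂ) := by
      push_cast; ring
    rw [e, Complex.norm_exp_I_mul_ofReal]
  have hN : DualBound K (M ^ (2 * k) * (m * B)) (nonlin μ a k (flow μ a Q hQ τ v₀)) :=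
    hP.nonlin (by positivity) hM0 k hvM (hP.phase _ _ (dualBound_sum_bump K hB))
  have h1 := norm_integral_flow_sub_le (hQ := hQ) (τ := -τ) hh hs hN hT
    (by rw [abs_neg, abs_of_nonneg hτ.1]; exact hτ.2)
  have hD : DualBound K (m * (T * E * B)) (flow μ a Q hQ τ v₀ - W) :=
    dualBound_of_ae K (by positivity) (ae_norm_flow_sub_trig_le hB hE hQE hτ)
  have h2 := hP.nonlin_sub (by positivity) hM0 k hvM hWM hD h hh
  have e := map_sub (pairing μ a h hh.meas K hh.bound_weight)
    (nonlin μ a k (flow μ a Q hQ τ v₀)) (nonlin μ a k W)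
  simp only [pairing_apply] at e
  rw [e] at h2
  have h3 := norm_add_le_of_le h1 h2
  rw [sub_add_sub_cancel] at h3
  refine h3.trans ?_
  have h4 : T * (M ^ (2 * k) * (m * B)) ≤ (2 * k + 1) * (T * (M ^ (2 * k) * (m * B))) :=
    le_mul_of_one_le_left (by positivity) (by linarith [(Nat.cast_nonneg k : (0 : ℝ) ≤ k)])
  calc _ ≤ (2 * k + 1) * (T * (M ^ (2 * k) * (m * B))) +
        (2 * k + 1) * M ^ (2 * k) * (m * (T * E * B)) := by gcongr
    _ = _ := by ring

/-- The time integral of the resonant part of the nonlinearity at low frequencies. -/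
lemma le_norm_integral_nonlin {K : ℝ≥0} (hS : MeasurableSet S) (h0 : μ S ≠ 0) (h1 : μ S ≠ ⊤)
    (hSA : S ⊆ closedBall 0 (A / 2)) (hh : IsTest μ K (avgTest μ S)) (hB : 0 ≤ B) (hA : 0 ≤ A)
    (hT : 0 ≤ T) {n : ℤ} (hθ : θ * T = 2 * Real.pi * n) (hn : n ≠ 0)
    (hres : IsResonantSum p c k 0 0) :
    T * (B ^ (2 * k + 1) * μ.real (closedBall (0 : G) (A / 4)) ^ (2 * k)) ≤
      ‖∫ τ in (0 : ℝ)..T, ∫ ξ, avgTest μ S ξ * nonlin μ a k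
        (∑ i, Complex.exp (-(Complex.I * (c i * (θ * τ) : ℝ))) • bump hμ a B (p i) A) ξ ∂μ‖ := by
  refine le_trans ?_ (Complex.re_le_norm _)
  refine (IsPosTrig.nonlin hB hA (isPosTrig_sum_bump (μ := μ) (a := a) (hμ := hμ) hB) hres).le_re_integral
    hT hθ hn (pairing μ a (avgTest μ S) hh.meas K hh.bound_weight) (fun f hf => ?_) (fun f hf => ?_)
  · refine le_re_integral_avgTest_mul hS h0 h1 ?_
    filter_upwards [hf] with ξ hξ _
    exact hξ.2
  · refine le_re_integral_avgTest_mul hS h0 h1 ?_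
    filter_upwards [hf] with ξ hξ hξS
    have := hξ.2
    rwa [ballBump, indicator_of_mem (hSA hξS)] at this

/-- Lower bound at low frequencies for the solution with data a sum of bumps. -/
theorem le_norm_integral_solution {ε : ℝ} (hε : |ε| = 1) {v : ℝ → WeightedL1 μ a}
    (hv : ∀ t ∈ Icc 0 T, HasDerivWithinAt v (field μ a Q hQ ε k t (v t)) (Icc 0 T) t)
    (hvM : ∀ t ∈ Icc 0 T, ‖v t‖ ≤ 2 * M) (hv0 : v 0 = ∑ i, bump hμ a B (p i) A)
    (hM : Fintype.card ι * (2 * B * μ.real (closedBall 0 A)) ≤ M)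
    (hMT : T * (2 * M) ^ (2 * k) ≤ 1 / 2)
    (hS : MeasurableSet S) (h0 : μ S ≠ 0) (h1 : μ S ≠ ⊤) (hSA : S ⊆ closedBall 0 (A / 2))
    (hSQ : ∀ ξ ∈ S, |Q ξ| ≤ 1) (hSp : ∀ i, Disjoint S (closedBall (p i) A))
    (hB : 0 ≤ B) (hA : 0 ≤ A) (hE : 0 ≤ E) (hT : 0 < T)
    (ha : ∀ i, Real.exp (a * (‖p i‖ + A)) ≤ 2)
    (hQE : ∀ i, ∀ ξ ∈ closedBall (p i) A, |Q ξ - θ * c i| ≤ E)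
    {n : ℤ} (hθ : θ * T = 2 * Real.pi * n) (hn : n ≠ 0) (hres : IsResonantSum p c k 0 0) :
    T * (B ^ (2 * k + 1) * μ.real (closedBall (0 : G) (A / 4)) ^ (2 * k)) -
      (2 * k + 1) * (Fintype.card ι * B) * (T * (2 * M) ^ (2 * k)) *
        (T + T * E + 2 * (T * (2 * M) ^ (2 * k))) ≤
      ‖∫ ξ, avgTest μ S ξ * v T ξ ∂μ‖ := by
  set K : ℝ≥0 := (μ.real S)⁻¹.toNNReal
  have hh : IsTest μ K (avgTest μ S) := isTest_avgTest hS h0 h1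
  set Λ : WeightedL1 μ a →L[ℂ] ℂ := pairing μ a (avgTest μ S) hh.meas K hh.bound_weight with hΛ
  set m : ℝ := (Fintype.card ι : ℝ) with hm
  have hM0 : 0 ≤ M := le_trans (by positivity) hM
  set v₀ : WeightedL1 μ a := ∑ i, bump hμ a B (p i) A with hv₀
  set W : ℝ → WeightedL1 μ a := fun τ =>
    ∑ i, Complex.exp (-(Complex.I * (c i * (θ * τ) : ℝ))) • bump hμ a B (p i) A with hW
  have hs : ∀ ξ, avgTest μ S ξ ≠ 0 → |Q ξ| ≤ 1 := fun ξ hξ =>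
    hSQ ξ (by by_contra hn; exact hξ (indicator_of_notMem hn _))
  -- the data have no low frequencies
  have hΛ0 : Λ v₀ = 0 := by
    rw [hv₀, map_sum]
    refine Finset.sum_eq_zero fun i _ => ?_
    rw [hΛ, pairing_apply]
    refine integral_eq_zero_of_ae ?_
    filter_upwards [coe_bump (hμ := hμ) (a := a) (B := B) (x := p i) (A := A)] with ξ h
    rw [h]
    by_cases hξ : ξ ∈ S
    · simp [ballBump, indicator_of_notMem (disjoint_left.1 (hSp i) hξ)]
    · simp [avgTest, indicator_of_notMem hξ]
  -- the second Picard iterate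
  have hd : DualBound K (m * B) (v 0) := by rw [hv0]; exact dualBound_sum_bump K hB
  have hmB : 0 ≤ m * B := by positivity
  have h2 : ‖Λ (v T - v 0 - ∫ τ in (0 : ℝ)..T, field μ a Q hQ ε k τ (v 0))‖ ≤
      2 * (2 * k + 1) * (T * (2 * M) ^ (2 * k)) ^ 2 * (m * B) :=
    dualBound_sub_picard hε hM0 hT.le hMT hv hvM hmB hd _ hh
  set Ψ : ℝ → WeightedL1 μ a := fun τ =>
    flow μ a Q hQ (-τ) (nonlin μ a k (flow μ a Q hQ τ v₀)) with hΨ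
  have hΨc : Continuous Ψ := by
    rw [← continuousOn_univ]
    exact continuousOn_flow continuousOn_neg ((continuous_nonlin k).comp_continuousOn
      (continuousOn_flow continuousOn_id continuousOn_const))
  have hWc : Continuous fun τ => nonlin μ a k (W τ) := by
    refine (continuous_nonlin k).comp ?_
    fun_prop
  have h3 : ‖(∫ τ in (0 : ℝ)..T, Λ (Ψ τ)) - ∫ τ in (0 : ℝ)..T, Λ (nonlin μ a k (W τ))‖ ≤
      (2 * k + 1) * M ^ (2 * k) * (m * B) * (T + T * E) * T := by
    have c1 : Continuous fun τ => Λ (Ψ τ) := Λ.continuous.comp hΨc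
    have c2 : Continuous fun τ => Λ (nonlin μ a k (W τ)) := Λ.continuous.comp hWc
    rw [← intervalIntegral.integral_sub (c1.intervalIntegrable _ _) (c2.intervalIntegrable _ _)]
    refine (intervalIntegral.norm_integral_le_of_norm_le_const fun τ hτ => ?_).trans_eq
      (by rw [sub_zero, abs_of_pos hT])
    rw [uIoc_of_le hT.le] at hτ
    exact norm_integral_flow_nonlin_sub_le hh hs hB hE hT ha hQE hM (Ioc_subset_Icc_self hτ)
  have h4 : T * (B ^ (2 * k + 1) * μ.real (closedBall (0 : G) (A / 4)) ^ (2 * k)) ≤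
      ‖∫ τ in (0 : ℝ)..T, Λ (nonlin μ a k (W τ))‖ :=
    le_norm_integral_nonlin hS h0 h1 hSA hh hB hA hT.le hθ hn hres
  have h5 : ‖Λ (∫ τ in (0 : ℝ)..T, field μ a Q hQ ε k τ (v 0))‖ =
      ‖∫ τ in (0 : ℝ)..T, Λ (Ψ τ)‖ := by
    have e : ∀ τ, field μ a Q hQ ε k τ (v 0) = (-(Complex.I * ε)) • Ψ τ := fun τ => by
      rw [hv0]; rfl
    simp only [e]
    rw [intervalIntegral.integral_smul, map_smul, norm_smul, norm_coupling hε, one_mul,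
      ← ContinuousLinearMap.intervalIntegral_comp_comm _ (hΨc.intervalIntegrable _ _)]
  rw [map_sub, map_sub, hv0, hΛ0, sub_zero] at h2
  rw [hv0] at h5
  -- Reverse triangle inequalities: the solution is compared with its first iterate, and the iterate
  -- with the resonant model, whose average is bounded below in `h4`.
  have h6 := norm_sub_norm_le (Λ (∫ τ in (0 : ℝ)..T, field μ a Q hQ ε k τ v₀)) (Λ (v T))
  rw [norm_sub_rev] at h6
  have h7 := norm_sub_norm_le (∫ τ in (0 : ℝ)..T, Λ (nonlin μ a k (W τ)))
    (∫ τ in (0 : ℝ)..T, Λ (Ψ τ))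
  rw [norm_sub_rev] at h7
  have h8 : M ^ (2 * k) ≤ (2 * M) ^ (2 * k) := by gcongr; linarith
  have h9 : (2 * k + 1) * M ^ (2 * k) * (m * B) * (T + T * E) * T ≤
      (2 * k + 1) * (2 * M) ^ (2 * k) * (m * B) * (T + T * E) * T := by gcongr
  have h10 : Λ (v T) = ∫ ξ, avgTest μ S ξ * v T ξ ∂μ := rfl
  rw [← h10]
  have : (2 * k + 1) * (m * B) * (T * (2 * M) ^ (2 * k)) *
        (T + T * E + 2 * (T * (2 * M) ^ (2 * k))) =
      (2 * k + 1) * (2 * M) ^ (2 * k) * (m * B) * (T + T * E) * T +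
      2 * (2 * k + 1) * (T * (2 * M) ^ (2 * k)) ^ 2 * (m * B) := by ring
  linarith

end Inflation

/-! ### Volumes of balls, and norms of the data and of low frequencies. -/

section FreqVolume

open scoped NNReal
open WeightedL1 Metric

variable {d₁ d₂ : ℕ}

lemma freqMeasure_closedBall (x : Freq d₁ d₂) (r : ℝ) :
    freqMeasure d₁ d₂ (closedBall x r) =
      Measure.count (closedBall x.1 r) * volume (closedBall x.2 r) := by
  rw [← Measure.prod_prod, closedBall_prod_same]

lemma freqMeasure_closedBall_lt_top (x : Freq d₁ d₂) (r : ℝ) :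
    freqMeasure d₁ d₂ (closedBall x r) < ⊤ := by
  rw [freqMeasure_closedBall]
  refine ENNReal.mul_lt_top (Measure.count_apply_lt_top.2 ?_) measure_closedBall_lt_top
  exact (isCompact_closedBall x.1 r).finite_of_discrete

lemma count_closedBall_zero {n : ℕ} {r : ℝ} (hr : 0 ≤ r) :
    (Measure.count (closedBall (0 : Fin n → ℤ) r)).toReal = (2 * ⌊r⌋ + 1 : ℝ) ^ n := by
  have e : closedBall (0 : Fin n → ℤ) r =
      ((Fintype.piFinset fun _ : Fin n => Finset.Icc (-⌊r⌋) ⌊r⌋ : Finset (Fin n → ℤ)) :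
        Set (Fin n → ℤ)) := by
    ext k
    simp only [mem_closedBall, dist_zero_right, pi_norm_le_iff_of_nonneg hr, Finset.mem_coe,
      Fintype.mem_piFinset, Finset.mem_Icc]
    refine forall_congr' fun j => ?_
    rw [Int.norm_eq_abs, abs_le, neg_le, neg_le (a := ⌊r⌋), Int.le_floor, Int.le_floor]
    push_cast
    rfl
  have hf : 0 ≤ ⌊r⌋ := Int.floor_nonneg.2 hr
  rw [e, Measure.count_apply_finset, Fintype.card_piFinset_const, Int.card_Icc]
  have h2 : ((⌊r⌋ + 1 - -⌊r⌋).toNat : ℝ) = 2 * ⌊r⌋ + 1 := by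
    have : (((⌊r⌋ + 1 - -⌊r⌋).toNat : ℤ) : ℝ) = ((⌊r⌋ + 1 - -⌊r⌋ : ℤ) : ℝ) := by
      rw [Int.toNat_of_nonneg (by linarith)]
    push_cast at this
    linarith
  rw [ENNReal.toReal_natCast, Nat.cast_pow, h2]

lemma freqMeasure_real_closedBall {r : ℝ} (hr : 0 ≤ r) :
    (freqMeasure d₁ d₂).real (closedBall 0 r) = (2 * ⌊r⌋ + 1 : ℝ) ^ d₂ *
      (r ^ d₁ * (volume (ball (0 : EuclideanSpace ℝ (Fin d₁)) 1)).toReal) := by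
  rw [Measure.real, freqMeasure_closedBall, ENNReal.toReal_mul]
  simp only [Prod.fst_zero, Prod.snd_zero]
  rw [count_closedBall_zero hr, Measure.addHaar_closedBall _ _ hr, ENNReal.toReal_mul,
    ENNReal.toReal_ofReal (by positivity), finrank_euclideanSpace_fin]

lemma volume_unitBall_pos (n : ℕ) :
    0 < (volume (ball (0 : EuclideanSpace ℝ (Fin n)) 1)).toReal :=
  ENNReal.toReal_pos (measure_ball_pos _ _ one_pos).ne' measure_ball_lt_top.ne

variable (d₁ d₂) in
/-- The volume of the balls of the dual group is comparable to a power of the radius. -/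
lemma exists_freqVolume_bounds : ∃ c C : ℝ, 0 < c ∧ 0 < C ∧ ∀ r : ℝ, 1 / 8 ≤ r →
    c * r ^ (d₁ + d₂) ≤ (freqMeasure d₁ d₂).real (closedBall 0 r) ∧
      (freqMeasure d₁ d₂).real (closedBall 0 r) ≤ C * r ^ (d₁ + d₂) := by
  set w := (volume (ball (0 : EuclideanSpace ℝ (Fin d₁)) 1)).toReal with hw
  have hw0 : 0 < w := volume_unitBall_pos d₁
  -- The restriction to radii at least 1/8 is what gives 2⌊r⌋ + 1 ≤ 10r; it will cover radius A/4
  -- with A ≥ 1/2.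
  refine ⟨w, 10 ^ d₂ * w, hw0, by positivity, fun r hr => ?_⟩
  have hr0 : 0 ≤ r := by linarith
  have h1 := Int.lt_floor_add_one r
  have h2 := Int.floor_le r
  have h3 : (0 : ℝ) ≤ ⌊r⌋ := by exact_mod_cast Int.floor_nonneg.2 hr0
  rw [freqMeasure_real_closedBall hr0, pow_add]
  constructor
  · calc w * (r ^ d₁ * r ^ d₂) = r ^ d₂ * (r ^ d₁ * w) := by ring
      _ ≤ (2 * ⌊r⌋ + 1 : ℝ) ^ d₂ * (r ^ d₁ * w) := by gcongr; linarith
  · calc (2 * ⌊r⌋ + 1 : ℝ) ^ d₂ * (r ^ d₁ * w) ≤ (10 * r) ^ d₂ * (r ^ d₁ * w) := by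
          gcongr; linarith
      _ = _ := by rw [mul_pow]; ring

variable (d₂) in
/-- The radius of a ball of frequencies of length at most `1 / 4`. -/
def lowRadius : ℝ := (4 * (1 + d₂))⁻¹

lemma lowRadius_pos : 0 < lowRadius d₂ := by unfold lowRadius; positivity

lemma lowRadius_le : lowRadius d₂ ≤ 1 / 4 := by
  unfold lowRadius
  rw [one_div]
  gcongr
  linarith [(Nat.cast_nonneg d₂ : (0 : ℝ) ≤ d₂)]

lemma norm_freqEmb_le_of_mem_lowBall {ξ : Freq d₁ d₂} (h : ξ ∈ closedBall 0 (lowRadius d₂)) :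
    ‖freqEmb ξ‖ ≤ 1 / 4 := by
  rw [mem_closedBall, dist_zero_right] at h
  refine (norm_freqEmb_le ξ).trans ?_
  have h1 : (0 : ℝ) < 1 + d₂ := by positivity
  calc (1 + d₂ : ℝ) * ‖ξ‖ ≤ (1 + d₂ : ℝ) * (4 * (1 + d₂ : ℝ))⁻¹ := by gcongr; exact h
    _ = 1 / 4 := by field_simp

lemma freqMeasure_lowBall_pos :
    0 < (freqMeasure d₁ d₂).real (closedBall 0 (lowRadius d₂)) := by
  rw [freqMeasure_real_closedBall lowRadius_pos.le]
  have h3 : (0 : ℝ) ≤ ⌊lowRadius d₂⌋ := by exact_mod_cast Int.floor_nonneg.2 lowRadius_pos.le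
  have := volume_unitBall_pos d₁
  have := lowRadius_pos (d₂ := d₂)
  positivity

variable {a : ℝ≥0}

/-- The mean of the Fourier transform over low frequencies is controlled by its `L²` norm. -/
lemma lowFreqNorm_synth_ge {f : WeightedL1 (freqMeasure d₁ d₂) a}
    (hf2 : MemLp f 2 (freqMeasure d₁ d₂)) {m : ℝ}
    (hm : m ≤ ‖∫ ξ, avgTest (freqMeasure d₁ d₂) (closedBall 0 (lowRadius d₂)) ξ * f ξ
      ∂(freqMeasure d₁ d₂)‖) :
    ENNReal.ofReal (synthConst d₁ d₂ *
      (Real.sqrt ((freqMeasure d₁ d₂).real (closedBall 0 (lowRadius d₂))) * m)) ≤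
      lowFreqNorm (synth f) := by
  set S : Set (Freq d₁ d₂) := closedBall 0 (lowRadius d₂) with hS
  have hSm : MeasurableSet S := isClosed_closedBall.measurableSet
  have hV : 0 < (freqMeasure d₁ d₂).real S := freqMeasure_lowBall_pos
  rw [lowFreqNorm_synth f.integrable hf2, ENNReal.ofReal_mul synthConst_pos.le]
  gcongr
  rw [integral_avgTest_mul hSm, norm_mul, norm_inv, Complex.norm_real,
    Real.norm_of_nonneg hV.le] at hm
  have h1 : ENNReal.ofReal ‖∫ ξ in S, f ξ ∂(freqMeasure d₁ d₂)‖ ^ 2 ≤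
      (∫⁻ ξ in S, ‖f ξ‖ₑ ^ 2 ∂(freqMeasure d₁ d₂)) * ENNReal.ofReal ((freqMeasure d₁ d₂).real S) := by
    have h2 := lintegral_mul_sq_le ((freqMeasure d₁ d₂).restrict S) (f := fun ξ => ‖f ξ‖ₑ) (g := fun _ => 1)
      f.aesm.enorm.restrict aemeasurable_const
    simp only [mul_one, one_pow, lintegral_const, Measure.restrict_apply_univ, one_mul] at h2
    rw [Measure.real, ENNReal.ofReal_toReal (freqMeasure_closedBall_lt_top _ _).ne]
    refine le_trans ?_ h2
    rw [ofReal_norm]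
    gcongr
    exact enorm_integral_le_lintegral_enorm _
  have h3 : (∫⁻ ξ in S, ‖f ξ‖ₑ ^ 2 ∂(freqMeasure d₁ d₂)) ≤ ∫⁻ ξ in {ξ | ‖freqEmb ξ‖ ≤ 1}, ‖f ξ‖ₑ ^ 2 ∂(freqMeasure d₁ d₂) :=
    lintegral_mono_set fun ξ hξ => (norm_freqEmb_le_of_mem_lowBall hξ).trans (by norm_num)
  set L := ∫⁻ ξ in {ξ | ‖freqEmb ξ‖ ≤ 1}, ‖f ξ‖ₑ ^ 2 ∂(freqMeasure d₁ d₂) with hL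
  set I := ‖∫ ξ in S, f ξ ∂(freqMeasure d₁ d₂)‖ with hI
  have h4 : ENNReal.ofReal (I ^ 2 / (freqMeasure d₁ d₂).real S) ≤ L := by
    rw [ENNReal.ofReal_div_of_pos hV, ENNReal.ofReal_pow (norm_nonneg _)]
    refine ENNReal.div_le_of_le_mul (h1.trans ?_)
    gcongr
  calc ENNReal.ofReal (Real.sqrt ((freqMeasure d₁ d₂).real S) * m)
      ≤ ENNReal.ofReal ((I ^ 2 / (freqMeasure d₁ d₂).real S) ^ (1 / 2 : ℝ)) := by
        refine ENNReal.ofReal_le_ofReal ?_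
        rw [← Real.sqrt_eq_rpow, Real.sqrt_div (by positivity), Real.sqrt_sq (norm_nonneg _),
          le_div_iff₀ (Real.sqrt_pos.2 hV)]
        have h5 : m * (freqMeasure d₁ d₂).real S ≤ I := by
          rw [← div_eq_inv_mul, le_div_iff₀ hV] at hm
          exact hm
        calc Real.sqrt ((freqMeasure d₁ d₂).real S) * m * Real.sqrt ((freqMeasure d₁ d₂).real S)
            = m * (Real.sqrt ((freqMeasure d₁ d₂).real S) * Real.sqrt ((freqMeasure d₁ d₂).real S)) := by ring
          _ ≤ I := by rwa [Real.mul_self_sqrt hV.le]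
    _ = ENNReal.ofReal (I ^ 2 / (freqMeasure d₁ d₂).real S) ^ (1 / 2 : ℝ) := by
        rw [ENNReal.ofReal_rpow_of_nonneg (by positivity) (by norm_num)]
    _ ≤ L ^ (1 / 2 : ℝ) := by gcongr

/-- The Sobolev norm of negative order of data supported at high frequencies. -/
lemma sobolevNorm_sum_bump_le {ι : Type} [Fintype ι] {p : ι → Freq d₁ d₂} {A B ρ s : ℝ} (hB : 0 ≤ B)
    (hs : s < 0) (hρ : 1 ≤ ρ) (hp : ∀ i, ∀ ξ ∈ closedBall (p i) A, ρ ≤ ‖freqEmb ξ‖) :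
    sobolevNorm s (synth (∑ i, bump freqMeasure_closedBall_lt_top a B (p i) A :
        WeightedL1 (freqMeasure d₁ d₂) a)) ≤
      ENNReal.ofReal (synthConst d₁ d₂ * (Fintype.card ι * B * ρ ^ s *
        Real.sqrt (Fintype.card ι * (freqMeasure d₁ d₂).real (closedBall 0 A)))) := by
  set μ := freqMeasure d₁ d₂ with hμ
  set f : WeightedL1 μ a := ∑ i, bump freqMeasure_closedBall_lt_top a B (p i) A with hf
  have hbound : ∀ᵐ ξ ∂μ, ‖f ξ‖ ≤ Fintype.card ι * B ∧ ((∀ i, ξ ∉ closedBall (p i) A) → f ξ = 0) := by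
    have h1 : ∀ᵐ ξ ∂μ, ∀ i, bump freqMeasure_closedBall_lt_top a B (p i) A ξ =
        (ballBump B (p i) A ξ : ℂ) := ae_all_iff.2 fun i => coe_bump
    have h2 := coe_sum_smul (μ := μ) (fun i : ι => (1 : ℂ))
      (fun i => bump freqMeasure_closedBall_lt_top a B (p i) A)
    simp only [one_smul, one_mul] at h2
    filter_upwards [h1, h2] with ξ h1 h2
    rw [h2]
    constructor
    · refine (norm_sum_le_of_le Finset.univ (n := fun _ => B) fun i _ => ?_).trans (by simp)
      rw [h1]
      exact norm_ballBump_le hB ξ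
    · intro h
      refine Finset.sum_eq_zero fun i _ => ?_
      rw [h1, ballBump, indicator_of_notMem (h i), Complex.ofReal_zero]
  set W : ℝ := Fintype.card ι * B * ρ ^ s with hW
  have hρ0 : 0 < ρ := by linarith
  have hW0 : 0 ≤ W := by positivity
  have h3 : ∫⁻ ξ, (freqWeight s ξ * ‖f ξ‖ₑ) ^ 2 ∂μ ≤
      ENNReal.ofReal (W ^ 2 * (Fintype.card ι * μ.real (closedBall 0 A))) := by
    calc ∫⁻ ξ, (freqWeight s ξ * ‖f ξ‖ₑ) ^ 2 ∂μ
        ≤ ∫⁻ ξ, (⋃ i, closedBall (p i) A).indicator (fun _ => ENNReal.ofReal (W ^ 2)) ξ ∂μ := by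
          refine lintegral_mono_ae ?_
          filter_upwards [hbound] with ξ hξ
          by_cases h : ξ ∈ ⋃ i, closedBall (p i) A
          · rw [indicator_of_mem h, ENNReal.ofReal_pow hW0, hW,
              mul_comm _ (ρ ^ s), ENNReal.ofReal_mul (by positivity), ← ofReal_norm (f ξ)]
            obtain ⟨i, hi⟩ := mem_iUnion.1 h
            gcongr
            · rw [freqWeight]
              refine ENNReal.ofReal_le_ofReal ?_
              rw [sobolevWeight, if_neg (not_le.2 hs)]
              exact Real.rpow_le_rpow_of_nonpos hρ0 ((hp i ξ hi).trans (le_max_right _ _)) hs.le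
            · exact hξ.1
          · rw [indicator_of_notMem h, hξ.2 (by simpa using h)]
            simp
      _ = ENNReal.ofReal (W ^ 2) * μ (⋃ i, closedBall (p i) A) := by
          rw [lintegral_indicator (MeasurableSet.iUnion fun i => isClosed_closedBall.measurableSet),
            setLIntegral_const]
      _ ≤ ENNReal.ofReal (W ^ 2) * ENNReal.ofReal (Fintype.card ι * μ.real (closedBall 0 A)) := by
          gcongr
          calc μ (⋃ i, closedBall (p i) A) ≤ ∑ i, μ (closedBall (p i) A) :=
                measure_iUnion_fintype_le _ _
            _ = ∑ _i : ι, ENNReal.ofReal (μ.real (closedBall 0 A)) := by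
                refine Finset.sum_congr rfl fun i _ => ?_
                rw [← measureReal_closedBall (p i) A, Measure.real,
                  ENNReal.ofReal_toReal (freqMeasure_closedBall_lt_top _ _).ne]
            _ = _ := by
                rw [Finset.sum_const, Finset.card_univ, nsmul_eq_mul, ENNReal.ofReal_mul (by simp),
                  ENNReal.ofReal_natCast]
      _ = _ := by rw [← ENNReal.ofReal_mul (by positivity)]
  rw [sobolevNorm_synth s f.integrable
    (memLp_two_of_bounded f (hbound.mono fun ξ h => h.1)), ENNReal.ofReal_mul synthConst_pos.le]
  gcongr
  calc (∫⁻ ξ, (freqWeight s ξ * ‖f ξ‖ₑ) ^ 2 ∂μ) ^ (1 / 2 : ℝ)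
      ≤ ENNReal.ofReal (W ^ 2 * (Fintype.card ι * μ.real (closedBall 0 A))) ^ (1 / 2 : ℝ) := by
        gcongr
    _ = ENNReal.ofReal (W * Real.sqrt (Fintype.card ι * μ.real (closedBall 0 A))) := by
        rw [ENNReal.ofReal_rpow_of_nonneg (by positivity) (by norm_num), ← Real.sqrt_eq_rpow,
          Real.sqrt_mul (by positivity), Real.sqrt_sq hW0]

end FreqVolume

/-! ### The solution at a single frequency scale. -/

section Scale

open scoped NNReal
open WeightedL1 Metric

variable {d₁ d₂ : ℕ}

/-- Balls of frequencies of radius `A` around the points `p i`, of length at least `ρ`, whose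
dispersion relation is resonant on a time interval of length `T` up to an error `E`. -/
structure IsResonantScale {ι : Type} (k : ℕ) (p : ι → Freq d₁ d₂) (c : ι → ℤ) (A E T ρ : ℝ) :
    Prop where
  le_radius : 1 / 2 ≤ A
  error_nonneg : 0 ≤ E
  time_pos : 0 < T
  one_le : 1 ≤ ρ
  le_norm : ∀ i, ∀ ξ ∈ closedBall (p i) A, ρ ≤ ‖freqEmb ξ‖
  resonant : IsResonantSum p c k 0 0
  period : ∃ (θ : ℝ) (n : ℤ), n ≠ 0 ∧ θ * T = 2 * Real.pi * n ∧
    ∀ i, ∀ ξ ∈ closedBall (p i) A, |freqSq ξ - θ * c i| ≤ E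

/-- The exponent may depend on the data: positivity is needed only for smoothness, and every
estimate is uniform once the weight is at most 2 on the bumps. -/
lemma exists_weight {ι : Type} [Fintype ι] {H : Type*} [NormedAddCommGroup H] (p : ι → H) (A : ℝ) :
    ∃ a : ℝ≥0, 0 < a ∧ ∀ i, Real.exp (a * (‖p i‖ + A)) ≤ 2 := by
  set R : ℝ := ∑ i, ‖p i‖ + |A| + 1 with hR
  have hR0 : 0 < R := by positivity
  have hl : 0 < Real.log 2 := Real.log_pos one_lt_two
  refine ⟨⟨Real.log 2 / R, by positivity⟩, ?_, fun i => ?_⟩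
  · exact NNReal.coe_pos.1 (show (0 : ℝ) < Real.log 2 / R by positivity)
  · rw [← Real.le_log_iff_exp_le two_pos]
    have h1 : ‖p i‖ + A ≤ R := by
      have := Finset.single_le_sum (fun j _ => norm_nonneg (p j)) (Finset.mem_univ i)
      have := le_abs_self A
      simp only [hR] at *
      linarith
    calc Real.log 2 / R * (‖p i‖ + A) ≤ Real.log 2 / R * R := by gcongr
      _ = Real.log 2 := by field_simp

variable {ι : Type} [Fintype ι] {p : ι → Freq d₁ d₂} {c : ι → ℤ} {A E T ρ B M s ε : ℝ} {k : ℕ}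

/-- The solution with data a sum of bumps at one scale. -/
theorem IsResonantScale.exists_solution (h : IsResonantScale k p c A E T ρ) (hε : |ε| = 1)
    (hs : s < 0) (hB : 0 ≤ B)
    (hM : Fintype.card ι * (2 * B * (freqMeasure d₁ d₂).real (closedBall 0 A)) ≤ M)
    (hMT : T * (2 * M) ^ (2 * k) ≤ 1 / 2) :
    ∃ (φ : NLSCover d₁ d₂ → ℂ) (u : ℝ → NLSCover d₁ d₂ → ℂ), MemHInfty φ ∧
      sobolevNorm s φ ≤ ENNReal.ofReal (synthConst d₁ d₂ * (Fintype.card ι * B * ρ ^ s *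
        Real.sqrt (Fintype.card ι * (freqMeasure d₁ d₂).real (closedBall 0 A)))) ∧
      IsSmoothNLSSolution k ε T φ u ∧
      ENNReal.ofReal (synthConst d₁ d₂ *
        (Real.sqrt ((freqMeasure d₁ d₂).real (closedBall 0 (lowRadius d₂))) *
          (T * (B ^ (2 * k + 1) *
              (freqMeasure d₁ d₂).real (closedBall 0 (A / 4)) ^ (2 * k)) -
            (2 * k + 1) * (Fintype.card ι * B) * (T * (2 * M) ^ (2 * k)) *
              (T + T * E + 2 * (T * (2 * M) ^ (2 * k)))))) ≤ lowFreqNorm (u T) := by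
  obtain ⟨a, ha, hap⟩ := exists_weight p A
  obtain ⟨θ, n, hn, hθ, hQE⟩ := h.period
  have hM0 : 0 ≤ M := le_trans (by positivity) hM
  set v₀ : WeightedL1 (freqMeasure d₁ d₂) a :=
    ∑ i, bump freqMeasure_closedBall_lt_top a B (p i) A with hv₀
  have hv₀M : ‖v₀‖ ≤ M := by
    have := norm_sum_bump_le (hμ := freqMeasure_closedBall_lt_top (d₁ := d₁) (d₂ := d₂)) hB hap
      (fun _ => 1) (fun _ => by simp)
    simp only [one_smul] at this
    exact this.trans hM
  obtain ⟨v, hv0, hvM, hv⟩ := WeightedL1.exists_solution (Q := freqSq) (hQ := measurable_freqSq)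
    hε hM0 h.time_pos.le hMT hv₀M
  have hm : 0 ≤ Fintype.card ι * B := by positivity
  have hv₀B : ∀ᵐ ξ ∂(freqMeasure d₁ d₂), ‖v 0 ξ‖ ≤ Fintype.card ι * B := by
    rw [hv0]
    exact ae_le_of_dualBound _ fun K => dualBound_sum_bump K hB
  have hvB := ae_bound_solution hε hM0 hMT hv hvM hm hv₀B
  have hsol := isSmoothNLSSolution_synth ha hv hvB
  have hT : T ∈ Icc 0 T := ⟨h.time_pos.le, le_rfl⟩
  have hρ := h.one_le
  refine ⟨synth (v 0), _, memHInfty_synth _ ha hv₀B, ?_, hsol, ?_⟩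
  · rw [hv0]
    exact sobolevNorm_sum_bump_le hB hs hρ h.le_norm
  · have h1 := le_norm_integral_solution (S := closedBall 0 (lowRadius d₂)) hε hv hvM hv0 hM hMT
      isClosed_closedBall.measurableSet
      (ENNReal.toReal_pos_iff.1 freqMeasure_lowBall_pos).1.ne'
      (freqMeasure_closedBall_lt_top _ _).ne
      (closedBall_subset_closedBall (lowRadius_le.trans (by linarith [h.le_radius])))
      (fun ξ hξ => ?_) (fun i => ?_) hB (by linarith [h.le_radius]) h.error_nonneg h.time_pos hap hQE
      hθ hn h.resonant
    · have h2 : MemLp (v T) 2 (freqMeasure d₁ d₂) := memLp_two_of_bounded _ (hvB T hT)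
      have h3 := lowFreqNorm_synth_ge h2 h1
      refine h3.trans_eq ?_
      rw [lowFreqNorm_synth (v T).integrable h2, lowFreqNorm_synth (WeightedL1.integrable _)
        (memLp_two_of_bounded _ (ae_flow_bound T (hvB T hT)))]
      congr 2
      refine lintegral_congr_ae (ae_restrict_of_ae ?_)
      filter_upwards [coe_flow (hQ := measurable_freqSq) T (v T)] with ξ hξ
      have e : -(Complex.I * (T * freqSq ξ : ℝ)) = Complex.I * ((-(T * freqSq ξ) : ℝ) : ℂ) := by
        push_cast; ring
      show _ = ‖flow _ a freqSq measurable_freqSq T (v T) ξ‖ₑ ^ 2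
      rw [hξ, enorm_mul, e, ← ofReal_norm, ← ofReal_norm (Complex.exp _), Complex.norm_exp_I_mul_ofReal]
      simp
    · rw [← norm_freqEmb_sq, abs_of_nonneg (by positivity)]
      have := norm_freqEmb_le_of_mem_lowBall hξ
      have := norm_nonneg (freqEmb ξ)
      nlinarith
    · refine disjoint_left.2 fun ξ h1 h2 => ?_
      have := norm_freqEmb_le_of_mem_lowBall h1
      have := h.le_norm i ξ h2
      linarith

end Scale

/-! ### Choice of amplitude and passage to the limit along scales. -/

section Limit

open scoped NNReal
open WeightedL1 Metric

variable {d₁ d₂ : ℕ}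

lemma IsResonantSum.nonempty {ι H : Type*} [AddCommGroup H] {p : ι → H} {c : ι → ℤ} {k : ℕ} {x : H}
    {m : ℤ} (h : IsResonantSum p c k x m) : Nonempty ι := by
  induction h with
  | base j => exact ⟨j⟩
  | step i j h ih => exact ih

/-- Choice of the amplitude at one scale. -/
lemma IsResonantScale.exists_amplitude {ι : Type} [Fintype ι] {p : ι → Freq d₁ d₂} {c : ι → ℤ}
    {A E T ρ s ε κ m q V₁ V₂ : ℝ} {k : ℕ} (h : IsResonantScale k p c A E T ρ) (hε : |ε| = 1)
    (hs : s < 0) (hk : k ≠ 0) (hm : (Fintype.card ι : ℝ) = m) (hm1 : 1 ≤ m) (hκ0 : 0 < κ)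
    (hκ : κ ≤ 1 / 2) (hV₁ : 0 < V₁) (hV₂ : 0 < V₂)
    (hVA : (freqMeasure d₁ d₂).real (closedBall 0 A) ≤ V₂ * A ^ (d₁ + d₂))
    (hVA4 : V₁ * A ^ (d₁ + d₂) ≤ (freqMeasure d₁ d₂).real (closedBall 0 (A / 4)))
    (hq : q = (V₁ / (4 * m * V₂)) ^ (2 * k)) (hκq : (2 * k + 1) * m * (2 * κ) ≤ q / 4)
    (hTE : (2 * k + 1) * m * (T + T * E) ≤ q / 4) :
    ∃ (φ : NLSCover d₁ d₂ → ℂ) (u : ℝ → NLSCover d₁ d₂ → ℂ), MemHInfty φ ∧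
      sobolevNorm s φ ≤ ENNReal.ofReal (synthConst d₁ d₂ * Real.sqrt (m * V₂) / (4 * V₂) *
        κ ^ (1 / (2 * k : ℝ)) * (T ^ (-1 / (2 * k : ℝ)) * (A ^ (d₁ + d₂)) ^ (-1 / 2 : ℝ) * ρ ^ s)) ∧
      IsSmoothNLSSolution k ε T φ u ∧
      ENNReal.ofReal (synthConst d₁ d₂ *
        Real.sqrt ((freqMeasure d₁ d₂).real (closedBall 0 (lowRadius d₂))) * κ * q / 2 *
        κ ^ (1 / (2 * k : ℝ)) / (4 * m * V₂) * (T ^ (1 / (2 * k : ℝ)) * A ^ (d₁ + d₂))⁻¹) ≤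
        lowFreqNorm (u T) := by
  have hT := h.time_pos
  have hA : 0 < A := by linarith [h.le_radius]
  have hρ : 0 < ρ := by linarith [h.one_le]
  set R : ℝ := A ^ (d₁ + d₂) with hR
  have hR0 : 0 < R := by positivity
  have hm0 : 0 < m := by linarith
  -- `M` is determined by T(2M)^{2k} = κ; `B` is then the largest height for which the volume bound
  -- guarantees data of norm at most `M`.
  set M : ℝ := κ ^ (1 / (2 * k : ℝ)) * T ^ (-1 / (2 * k : ℝ)) / 2 with hM
  have hM0 : 0 < M := by positivity
  set B : ℝ := M / (2 * m * V₂ * R) with hB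
  have hB0 : 0 < B := by positivity
  have hk' : (k : ℝ) ≠ 0 := by exact_mod_cast hk
  have hMκ : T * (2 * M) ^ (2 * k) = κ := by
    have e : 2 * M = κ ^ (1 / (2 * k : ℝ)) * T ^ (-1 / (2 * k : ℝ)) := by rw [hM]; ring
    rw [e, mul_pow, ← Real.rpow_natCast, ← Real.rpow_natCast, ← Real.rpow_mul hκ0.le,
      ← Real.rpow_mul hT.le]
    have e1 : 1 / (2 * k : ℝ) * ((2 * k : ℕ) : ℝ) = 1 := by push_cast; field_simp
    have e2 : -1 / (2 * k : ℝ) * ((2 * k : ℕ) : ℝ) = -1 := by push_cast; field_simp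
    rw [e1, e2, Real.rpow_one, Real.rpow_neg_one]
    field_simp
  obtain ⟨φ, u, hφ, hφs, hu, hlow⟩ := h.exists_solution (B := B) (M := M) (s := s) hε hs hB0.le
    (by
      rw [hm]
      calc m * (2 * B * (freqMeasure d₁ d₂).real (closedBall 0 A)) ≤ m * (2 * B * (V₂ * R)) := by
            gcongr
        _ = M := by rw [hB]; field_simp)
    (by rw [hMκ]; exact hκ)
  refine ⟨φ, u, hφ, hφs.trans (ENNReal.ofReal_le_ofReal ?_), hu,
    le_trans (ENNReal.ofReal_le_ofReal ?_) hlow⟩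
  · rw [hm]
    have e3 : R ^ (-1 / 2 : ℝ) = (Real.sqrt R)⁻¹ := by
      rw [Real.sqrt_eq_rpow, ← Real.rpow_neg hR0.le]; norm_num
    have e4 : Real.sqrt (m * V₂ * R) = Real.sqrt (m * V₂) * Real.sqrt R :=
      Real.sqrt_mul (by positivity) _
    have e5 : Real.sqrt R * Real.sqrt R = R := Real.mul_self_sqrt hR0.le
    have hsR : 0 < Real.sqrt R := Real.sqrt_pos.2 hR0
    have hsc := synthConst_pos (d₁ := d₁) (d₂ := d₂)
    calc synthConst d₁ d₂ * (m * B * ρ ^ s *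
          Real.sqrt (m * (freqMeasure d₁ d₂).real (closedBall 0 A)))
        ≤ synthConst d₁ d₂ * (m * B * ρ ^ s * Real.sqrt (m * V₂ * R)) := by
          have h0 : m * (freqMeasure d₁ d₂).real (closedBall 0 A) ≤ m * V₂ * R := by
            rw [mul_assoc]; gcongr
          gcongr
      _ = synthConst d₁ d₂ * (m * B * ρ ^ s * (Real.sqrt (m * V₂) * Real.sqrt R)) := by rw [e4]
      _ = synthConst d₁ d₂ * Real.sqrt (m * V₂) * κ ^ (1 / (2 * k : ℝ)) *
            T ^ (-1 / (2 * k : ℝ)) * ρ ^ s / (4 * V₂) * (Real.sqrt R / R) := by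
          rw [hB, hM]; field_simp; norm_num
      _ = synthConst d₁ d₂ * Real.sqrt (m * V₂) * κ ^ (1 / (2 * k : ℝ)) *
            T ^ (-1 / (2 * k : ℝ)) * ρ ^ s / (4 * V₂) * (Real.sqrt R)⁻¹ := by
          congr 1
          rw [eq_comm, inv_eq_iff_eq_inv, inv_div, eq_div_iff hsR.ne', e5]
      _ ≤ _ := by
          rw [e3]
          apply le_of_eq
          ring
  · rw [hm, hMκ]
    have hsc := synthConst_pos (d₁ := d₁) (d₂ := d₂)
    -- Since B V₁ R is V₁/(4 m V₂) times 2M, the resonant term is at least T(2M)^{2k} q B, with `q`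
    -- a constant independent of the scale.
    have h1 : κ * q * B ≤ T * (B ^ (2 * k + 1) *
        (freqMeasure d₁ d₂).real (closedBall 0 (A / 4)) ^ (2 * k)) := by
      calc κ * q * B = T * (B ^ (2 * k + 1) * (V₁ * R) ^ (2 * k)) := by
            rw [← hMκ, hq, pow_succ B, mul_assoc T, ← mul_pow,
              show B ^ (2 * k) * B * (V₁ * R) ^ (2 * k) = (B * (V₁ * R)) ^ (2 * k) * B by
                rw [mul_pow]; ring, ← mul_assoc]
            congr 3
            rw [hB]
            field_simp
            ring
        _ ≤ _ := by gcongr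
    -- The Picard remainder and the phase errors each use at most a quarter of the resonant term, so
    -- half of it survives.
    have h2 : (2 * k + 1) * (m * B) * κ * (T + T * E + 2 * κ) ≤ κ * q * B / 2 := by
      calc (2 * k + 1) * (m * B) * κ * (T + T * E + 2 * κ)
          = (B * κ) * ((2 * k + 1) * m * (T + T * E) + (2 * k + 1) * m * (2 * κ)) := by ring
        _ ≤ (B * κ) * (q / 4 + q / 4) := by gcongr
        _ = _ := by ring
    have h3 : κ * q * B / 2 ≤ T * (B ^ (2 * k + 1) *
        (freqMeasure d₁ d₂).real (closedBall 0 (A / 4)) ^ (2 * k)) -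
        (2 * k + 1) * (m * B) * κ * (T + T * E + 2 * κ) := by linarith
    have e6 : T ^ (-1 / (2 * k : ℝ)) = (T ^ (1 / (2 * k : ℝ)))⁻¹ := by
      rw [← Real.rpow_neg hT.le, neg_div]
    calc _ = synthConst d₁ d₂ *
          (Real.sqrt ((freqMeasure d₁ d₂).real (closedBall 0 (lowRadius d₂))) *
            (κ * q * B / 2)) := by
          rw [hB, hM, e6]
          field_simp
          ring
      _ ≤ _ := by gcongr

/-- Norm inflation with infinite loss of regularity at time `T`, uniformly in the size `δ`. -/
def HasInfiniteLossInflation (d₁ d₂ k : ℕ) (ε s : ℝ) : Prop :=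
  ∀ δ : ℝ, 0 < δ → ∃ (φ : NLSCover d₁ d₂ → ℂ) (T : ℝ) (u : ℝ → NLSCover d₁ d₂ → ℂ),
    MemHInfty φ ∧ sobolevNorm s φ < ENNReal.ofReal δ ∧ 0 < T ∧ T < δ ∧
    IsSmoothNLSSolution k ε T φ u ∧ lowFreqNorm (u T) > ENNReal.ofReal δ⁻¹

/-- Inflation from a sequence of resonant scales. -/
theorem hasInfiniteLossInflation_of_tendsto {ι : Type} [Fintype ι] {c : ι → ℤ} {s ε : ℝ} {k : ℕ}
    (hε : |ε| = 1) (hs : s < 0) (hk : k ≠ 0) {p : ℕ → ι → Freq d₁ d₂} {A E T ρ : ℕ → ℝ}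
    (h : ∀ᶠ N in atTop, IsResonantScale k (p N) c (A N) (E N) (T N) (ρ N))
    (hT : Tendsto T atTop (𝓝 0)) (hTE : Tendsto (fun N => T N * E N) atTop (𝓝 0))
    (hTA : Tendsto (fun N => T N ^ (1 / (2 * k : ℝ)) * A N ^ (d₁ + d₂)) atTop (𝓝 0))
    (hTs : Tendsto (fun N => T N ^ (-1 / (2 * k : ℝ)) * (A N ^ (d₁ + d₂)) ^ (-1 / 2 : ℝ) *
      ρ N ^ s) atTop (𝓝 0)) :
    HasInfiniteLossInflation d₁ d₂ k ε s := by
  intro δ hδ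
  obtain ⟨V₁, V₂, hV₁, hV₂, hV⟩ := exists_freqVolume_bounds d₁ d₂
  obtain ⟨m, hm⟩ : ∃ m : ℝ, (Fintype.card ι : ℝ) = m := ⟨_, rfl⟩
  have hm1 : 1 ≤ m := by
    obtain ⟨N, hN⟩ := h.exists
    have : Nonempty ι := hN.resonant.nonempty
    rw [← hm]
    exact_mod_cast Fintype.card_pos
  set V₃ : ℝ := V₁ / 4 ^ (d₁ + d₂) with hV₃
  have hV₃0 : 0 < V₃ := by positivity
  obtain ⟨q, hq⟩ : ∃ q, q = (V₃ / (4 * m * V₂)) ^ (2 * k) := ⟨_, rfl⟩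
  have hm0 : 0 < m := by linarith
  have hq0 : 0 < q := by rw [hq]; positivity
  -- The constant is chosen before the scale, small enough for the Picard remainder; afterwards only
  -- `T + T * E` has to become small as the scale grows.
  obtain ⟨κ, hκ⟩ : ∃ κ, κ = min (1 / 2) (q / 8 / ((2 * k + 1) * m)) := ⟨_, rfl⟩
  have hκ0 : 0 < κ := by
    rw [hκ]
    exact lt_min (by norm_num) (by positivity)
  have hκ1 : κ ≤ 1 / 2 := by rw [hκ]; exact min_le_left _ _
  have hκq : (2 * k + 1) * m * (2 * κ) ≤ q / 4 := by
    have h1 : κ ≤ q / 8 / ((2 * k + 1) * m) := by rw [hκ]; exact min_le_right _ _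
    rw [le_div_iff₀ (by positivity)] at h1
    linarith
  have e1 : ∀ᶠ N in atTop, (2 * k + 1) * m * (T N + T N * E N) ≤ q / 4 := by
    have h1 := (hT.add hTE).const_mul ((2 * k + 1) * m)
    rw [add_zero, mul_zero] at h1
    exact h1.eventually_le_const (by positivity)
  have e2 : ∀ᶠ N in atTop, T N < δ := hT.eventually_lt_const hδ
  have e3 : ∀ᶠ N in atTop, synthConst d₁ d₂ * Real.sqrt (m * V₂) / (4 * V₂) *
        κ ^ (1 / (2 * k : ℝ)) * (T N ^ (-1 / (2 * k : ℝ)) * (A N ^ (d₁ + d₂)) ^ (-1 / 2 : ℝ) *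
          ρ N ^ s) < δ := by
    have h1 := hTs.const_mul (synthConst d₁ d₂ * Real.sqrt (m * V₂) / (4 * V₂) *
        κ ^ (1 / (2 * k : ℝ)))
    rw [mul_zero] at h1
    exact h1.eventually_lt_const hδ
  obtain ⟨C, hC⟩ : ∃ C, C = synthConst d₁ d₂ *
        Real.sqrt ((freqMeasure d₁ d₂).real (closedBall 0 (lowRadius d₂))) * κ * q / 2 *
        κ ^ (1 / (2 * k : ℝ)) / (4 * m * V₂) := ⟨_, rfl⟩
  have hC0 : 0 < C := by
    have h1 := synthConst_pos (d₁ := d₁) (d₂ := d₂)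
    have h2 := Real.sqrt_pos.2 (freqMeasure_lowBall_pos (d₁ := d₁) (d₂ := d₂))
    rw [hC]
    positivity
  have e4 : ∀ᶠ N in atTop, T N ^ (1 / (2 * k : ℝ)) * A N ^ (d₁ + d₂) < C * δ :=
    hTA.eventually_lt_const (by positivity)
  obtain ⟨N, hN, h1, h2, h3, h4⟩ := (h.and (e1.and (e2.and (e3.and e4)))).exists
  have hA := hN.le_radius
  obtain ⟨φ, u, hφ, hφs, hu, hlow⟩ := hN.exists_amplitude hε hs hk hm hm1 hκ0 hκ1 hV₃0 hV₂
    (hV (A N) (by linarith)).2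
    (by
      refine le_trans (le_of_eq ?_) (hV (A N / 4) (by linarith)).1
      rw [hV₃, div_pow]
      ring) hq hκq h1
  refine ⟨φ, T N, u, hφ, hφs.trans_lt ((ENNReal.ofReal_lt_ofReal_iff hδ).2 h3), hN.time_pos, h2,
    hu, lt_of_lt_of_le ?_ hlow⟩
  rw [← hC]
  have hT0 := hN.time_pos
  have hA0 : 0 < A N := by linarith
  have h5 : 0 < T N ^ (1 / (2 * k : ℝ)) * A N ^ (d₁ + d₂) := by positivity
  refine (ENNReal.ofReal_lt_ofReal_iff (by positivity)).2 ?_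
  rw [← div_eq_mul_inv, inv_eq_one_div, div_lt_div_iff₀ hδ h5]
  linarith

end Limit

/-! ### Scales given by powers of N. -/

section Powers

open scoped NNReal
open WeightedL1 Metric

variable {d₁ d₂ : ℕ}

lemma tendsto_zero_of_le_rpow {f : ℕ → ℝ} {C β : ℝ} (hβ : β < 0)
    (h : ∀ᶠ N : ℕ in atTop, 0 ≤ f N ∧ f N ≤ C * (N : ℝ) ^ β) : Tendsto f atTop (𝓝 0) := by
  have h1 : Tendsto (fun N : ℕ => C * (N : ℝ) ^ β) atTop (𝓝 0) := by
    have h2 := ((tendsto_rpow_neg_atTop (neg_pos.2 hβ)).comp tendsto_natCast_atTop_atTop).const_mul C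
    simpa [Function.comp_def] using h2
  exact squeeze_zero' (h.mono fun N h => h.1) (h.mono fun N h => h.2) h1

/-- Inflation from resonant scales of power type. -/
theorem hasInfiniteLossInflation_of_rpow {ι : Type} [Fintype ι] {c : ι → ℤ} {s ε : ℝ} {k : ℕ}
    (hε : |ε| = 1) (hs : s < 0) (hk : k ≠ 0) {p : ℕ → ι → Freq d₁ d₂} {T : ℕ → ℝ}
    {C a b α e t : ℝ} (ha : 0 < a)
    (h : ∀ᶠ N : ℕ in atTop, IsResonantScale k (p N) c ((N : ℝ) ^ α / 2) (C * (N : ℝ) ^ e) (T N)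
      ((N : ℝ) / 2))
    (hT : ∀ᶠ N : ℕ in atTop, a * (N : ℝ) ^ (-t) ≤ T N ∧ T N ≤ b * (N : ℝ) ^ (-t))
    (ht : 0 < t) (het : e < t) (hαt : α * ((d₁ + d₂ : ℕ) : ℝ) < t / (2 * k))
    (hst : s + t / (2 * k) - α * ((d₁ + d₂ : ℕ) : ℝ) / 2 < 0) :
    HasInfiniteLossInflation d₁ d₂ k ε s := by
  obtain ⟨D, hD⟩ : ∃ D, D = d₁ + d₂ := ⟨_, rfl⟩
  rw [← hD] at hαt hst
  have hk0 : (0 : ℝ) < k := by exact_mod_cast Nat.pos_of_ne_zero hk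
  have hpos := h.and (hT.and (eventually_gt_atTop 0))
  have hA : ∀ N : ℕ, 0 < N → ((N : ℝ) ^ α / 2) ^ D = (1 / 2) ^ D * (N : ℝ) ^ (α * D) :=
    fun N hN => by
      rw [Real.rpow_mul (Nat.cast_nonneg N), Real.rpow_natCast, div_pow, one_div, inv_pow]
      ring
  -- With D the total dimension, the four quantities are bounded by powers with exponents -t, e - t,
  -- αD - t/(2k) and s + t/(2k) - αD/2. The lower bound on `T` enters only in the last one, where
  -- `T` has a negative exponent.
  refine hasInfiniteLossInflation_of_tendsto hε hs hk h
    (tendsto_zero_of_le_rpow (neg_neg_iff_pos.2 ht) (C := b) ?_)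
    (tendsto_zero_of_le_rpow (sub_neg.2 het) (C := b * C) ?_)
    (tendsto_zero_of_le_rpow (sub_neg.2 hαt) (C := b ^ (1 / (2 * k : ℝ)) * (1 / 2) ^ D) ?_)
    (tendsto_zero_of_le_rpow hst (C := a ^ (-1 / (2 * k : ℝ)) * ((1 / 2) ^ D) ^ (-1 / 2 : ℝ) *
      (1 / 2) ^ s) ?_)
  · filter_upwards [hpos] with N ⟨hN, hTN, _⟩
    exact ⟨hN.time_pos.le, hTN.2⟩
  · filter_upwards [hpos] with N ⟨hN, hTN, hN0⟩
    have hN1 : (0 : ℝ) < N := by exact_mod_cast hN0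
    refine ⟨mul_nonneg hN.time_pos.le hN.error_nonneg, ?_⟩
    calc T N * (C * (N : ℝ) ^ e) ≤ (b * (N : ℝ) ^ (-t)) * (C * (N : ℝ) ^ e) :=
          mul_le_mul_of_nonneg_right hTN.2 hN.error_nonneg
      _ = b * C * ((N : ℝ) ^ e * (N : ℝ) ^ (-t)) := by ring
      _ = _ := by rw [← Real.rpow_add hN1, sub_eq_add_neg]
  · filter_upwards [hpos] with N ⟨hN, hTN, hN0⟩
    have hN1 : (0 : ℝ) < N := by exact_mod_cast hN0
    have hT0 := hN.time_pos
    have hA0 : 0 < (N : ℝ) ^ α / 2 := by positivity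
    have hb : 0 < b := by
      have := hT0.trans_le hTN.2
      exact pos_of_mul_pos_left this (by positivity)
    refine ⟨by positivity, ?_⟩
    rw [← hD, hA N hN0]
    calc T N ^ (1 / (2 * k : ℝ)) * ((1 / 2) ^ D * (N : ℝ) ^ (α * D))
        ≤ (b * (N : ℝ) ^ (-t)) ^ (1 / (2 * k : ℝ)) * ((1 / 2) ^ D * (N : ℝ) ^ (α * D)) := by
          gcongr
          exact hTN.2
      _ = b ^ (1 / (2 * k : ℝ)) * (1 / 2) ^ D *
            ((N : ℝ) ^ (α * D) * (N : ℝ) ^ (-(t / (2 * k)))) := by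
          rw [Real.mul_rpow hb.le (by positivity), ← Real.rpow_mul hN1.le,
            show -t * (1 / (2 * k : ℝ)) = -(t / (2 * k)) by ring]
          ring
      _ = _ := by rw [← Real.rpow_add hN1, sub_eq_add_neg]
  · filter_upwards [hpos] with N ⟨hN, hTN, hN0⟩
    have hN1 : (0 : ℝ) < N := by exact_mod_cast hN0
    have hT0 := hN.time_pos
    refine ⟨by positivity, ?_⟩
    rw [← hD, hA N hN0]
    calc T N ^ (-1 / (2 * k : ℝ)) * ((1 / 2) ^ D * (N : ℝ) ^ (α * D)) ^ (-1 / 2 : ℝ) *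
          ((N : ℝ) / 2) ^ s
        ≤ (a * (N : ℝ) ^ (-t)) ^ (-1 / (2 * k : ℝ)) *
          ((1 / 2) ^ D * (N : ℝ) ^ (α * D)) ^ (-1 / 2 : ℝ) * ((N : ℝ) / 2) ^ s := by
          gcongr ?_ * _ * _
          refine Real.rpow_le_rpow_of_nonpos (by positivity) hTN.1 ?_
          exact div_nonpos_of_nonpos_of_nonneg (by norm_num) (by positivity)
      _ = a ^ (-1 / (2 * k : ℝ)) * ((1 / 2) ^ D) ^ (-1 / 2 : ℝ) * (1 / 2) ^ s *
          ((N : ℝ) ^ s * (N : ℝ) ^ (t / (2 * k)) * (N : ℝ) ^ (-(α * D / 2))) := by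
          rw [Real.mul_rpow ha.le (by positivity), ← Real.rpow_mul hN1.le,
            Real.mul_rpow (x := (1 / 2) ^ D) (by positivity) (by positivity),
            ← Real.rpow_mul hN1.le, div_eq_mul_one_div (N : ℝ) 2,
            Real.mul_rpow hN1.le (by norm_num),
            show -t * (-1 / (2 * k : ℝ)) = t / (2 * k) by ring,
            show α * D * (-1 / 2 : ℝ) = -(α * D / 2) by ring]
          ring
      _ = _ := by rw [← Real.rpow_add hN1, ← Real.rpow_add hN1, sub_eq_add_neg]

lemma IsResonantSum.map {ι H H' : Type*} [AddCommGroup H] [AddCommGroup H'] (f : H →+ H')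
    {p : ι → H} {c : ι → ℤ} {k : ℕ} {x : H} {m : ℤ} (h : IsResonantSum p c k x m) :
    IsResonantSum (fun i => f (p i)) c k (f x) m := by
  induction h with
  | base j => exact .base j
  | step i j h ih =>
    rw [map_add, map_sub]
    exact .step i j ih

lemma freqEmb_nsmul (N : ℕ) (ξ : Freq d₁ d₂) : freqEmb (N • ξ) = (N : ℝ) • freqEmb ξ := by
  refine PiLp.ext fun i => ?_
  rcases i with i | j
  · simp [freqEmb_inl]
  · simp [freqEmb_inr]

lemma freqEmb_sub (ξ η : Freq d₁ d₂) : freqEmb (ξ - η) = freqEmb ξ - freqEmb η := by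
  rw [sub_eq_add_neg, freqEmb_add, freqEmb_neg, sub_eq_add_neg]

lemma norm_freqEmb_sub_le {x ξ : Freq d₁ d₂} {A : ℝ} (h : ξ ∈ closedBall x A) :
    ‖freqEmb ξ - freqEmb x‖ ≤ (1 + d₂) * A := by
  rw [mem_closedBall, dist_eq_norm] at h
  rw [← freqEmb_sub]
  exact (norm_freqEmb_le _).trans (by gcongr)

/-- The frequencies near `N κ` have length comparable to `N`. -/
lemma eventually_le_norm_freqEmb {α : ℝ} (hα : α < 1) {κ : Freq d₁ d₂} (hκ : 1 ≤ ‖freqEmb κ‖) :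
    ∀ᶠ N : ℕ in atTop, ∀ ξ ∈ closedBall (N • κ) ((N : ℝ) ^ α / 2), (N : ℝ) / 2 ≤ ‖freqEmb ξ‖ := by
  have h1 : ∀ᶠ N : ℕ in atTop, (1 + d₂ : ℝ) * (N : ℝ) ^ (α - 1) ≤ 1 := by
    have h2 : Tendsto (fun N : ℕ => (1 + d₂ : ℝ) * (N : ℝ) ^ (α - 1)) atTop (𝓝 0) :=
      tendsto_zero_of_le_rpow (sub_neg.2 hα) (C := 1 + d₂)
        (Eventually.of_forall fun N => ⟨by positivity, le_rfl⟩)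
    exact h2.eventually_le_const one_pos
  filter_upwards [h1, eventually_gt_atTop 0] with N h1 hN0 ξ hξ
  have hN1 : (0 : ℝ) < N := by exact_mod_cast hN0
  have h2 := norm_freqEmb_sub_le hξ
  rw [freqEmb_nsmul] at h2
  have h3 : (1 + d₂ : ℝ) * (N : ℝ) ^ α ≤ N := by
    have h4 : (N : ℝ) ^ α = (N : ℝ) ^ (α - 1) * N := by
      rw [Real.rpow_sub_one hN1.ne']; field_simp
    calc (1 + d₂ : ℝ) * (N : ℝ) ^ α = ((1 + d₂ : ℝ) * (N : ℝ) ^ (α - 1)) * N := by rw [h4]; ring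
      _ ≤ 1 * N := by gcongr
      _ = N := one_mul _
  have h5 : (N : ℝ) ≤ ‖(N : ℝ) • freqEmb κ‖ := by
    rw [norm_smul, Real.norm_of_nonneg hN1.le]
    exact le_mul_of_one_le_right hN1.le hκ
  have h6 := norm_sub_norm_le ((N : ℝ) • freqEmb κ) (freqEmb ξ)
  rw [norm_sub_rev] at h6
  linarith

/-- Inflation from a resonant configuration of frequencies of integral squared length. -/
theorem hasInfiniteLossInflation_of_config {ι : Type} [Fintype ι] {c : ι → ℤ} {s ε : ℝ} {k : ℕ}
    (hε : |ε| = 1) (hs : s < 0) (hk : k ≠ 0) {κ : ι → Freq d₁ d₂} (hc : ∀ i, freqSq (κ i) = c i)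
    (hc1 : ∀ i, 1 ≤ c i) (hres : IsResonantSum κ c k 0 0) {C α e t : ℝ} (hC : 0 ≤ C) (hα : α < 1)
    (hα0 : 0 ≤ α) (hE : ∀ᶠ N : ℕ in atTop, ∀ i, ∀ ξ ∈ closedBall (N • κ i) ((N : ℝ) ^ α / 2),
      |freqSq ξ - (N : ℝ) ^ 2 * c i| ≤ C * (N : ℝ) ^ e)
    (ht : 0 < t) (ht2 : t < 2) (het : e < t) (hαt : α * ((d₁ + d₂ : ℕ) : ℝ) < t / (2 * k))
    (hst : s + t / (2 * k) - α * ((d₁ + d₂ : ℕ) : ℝ) / 2 < 0) :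
    HasInfiniteLossInflation d₁ d₂ k ε s := by
  have hκ : ∀ i, 1 ≤ ‖freqEmb (κ i)‖ := fun i => by
    have h1 : (1 : ℝ) ≤ ‖freqEmb (κ i)‖ ^ 2 := by
      rw [norm_freqEmb_sq, hc]; exact_mod_cast hc1 i
    exact (one_le_sq_iff₀ (norm_nonneg _)).1 h1
  have hρ := eventually_all.2 fun i => eventually_le_norm_freqEmb hα (hκ i)
  have hfl : ∀ᶠ N : ℕ in atTop, 1 ≤ (N : ℝ) ^ (2 - t) :=
    ((tendsto_rpow_atTop (sub_pos.2 ht2)).comp tendsto_natCast_atTop_atTop).eventually_ge_atTop 1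
  have hexp : ∀ N : ℕ, 2 ≤ N → (N : ℝ) ^ (-t) = (N : ℝ) ^ (2 - t) / (N : ℝ) ^ 2 := fun N hN => by
    have hN1 : (0 : ℝ) < N := by exact_mod_cast (by lia : 0 < N)
    rw [sub_eq_add_neg, Real.rpow_add hN1, Real.rpow_two]
    field_simp
  -- The time is a whole number of periods 2π/N². Because t < 2 this number eventually is positive,
  -- and rounding down loses at most a factor 2, whence the constants π and 2π.
  refine hasInfiniteLossInflation_of_rpow hε hs hk (p := fun N i => N • κ i) (c := c) (a := Real.pi)
    (b := 2 * Real.pi) (T := fun N => 2 * Real.pi * ⌊(N : ℝ) ^ (2 - t)⌋ / (N : ℝ) ^ 2)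
    Real.pi_pos (C := C) (α := α) (e := e) ?_ ?_ ht het hαt hst
  · filter_upwards [hρ, hE, hfl, eventually_ge_atTop 2] with N hρ hE hfl hN
    have hN2 : (2 : ℝ) ≤ N := by exact_mod_cast hN
    have hn : 1 ≤ ⌊(N : ℝ) ^ (2 - t)⌋ := Int.le_floor.2 (by exact_mod_cast hfl)
    have hn' : (0 : ℝ) < ⌊(N : ℝ) ^ (2 - t)⌋ := by exact_mod_cast (by linarith)
    refine ⟨?_, by positivity, by have := Real.pi_pos; positivity, by linarith, hρ, ?_,
      (N : ℝ) ^ 2, ⌊(N : ℝ) ^ (2 - t)⌋, by linarith, by field_simp, hE⟩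
    · have : (1 : ℝ) ≤ (N : ℝ) ^ α := Real.one_le_rpow (by linarith) hα0
      linarith
    · have := hres.map (nsmulAddMonoidHom N)
      simpa using this
  · filter_upwards [hfl, eventually_ge_atTop 2] with N hfl hN
    have hN1 : (0 : ℝ) < N := by exact_mod_cast (by lia : 0 < N)
    have hpi := Real.pi_pos
    rw [hexp N hN, mul_div_assoc', mul_div_assoc']
    constructor
    · have h1 : (N : ℝ) ^ (2 - t) ≤ 2 * ⌊(N : ℝ) ^ (2 - t)⌋ := by
        have h2 := Int.lt_floor_add_one ((N : ℝ) ^ (2 - t))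
        have h3 : (1 : ℝ) ≤ ⌊(N : ℝ) ^ (2 - t)⌋ := by
          exact_mod_cast Int.le_floor.2 (by exact_mod_cast hfl)
        linarith
      gcongr ?_ / _
      calc Real.pi * (N : ℝ) ^ (2 - t) ≤ Real.pi * (2 * ⌊(N : ℝ) ^ (2 - t)⌋) := by gcongr
        _ = _ := by ring
    · gcongr
      exact Int.floor_le _

end Powers

/-! ### Resonant configurations and their dispersion errors. -/

section Cases

open scoped NNReal RealInnerProductSpace
open WeightedL1 Metric

variable {d₁ d₂ : ℕ}

/-- The difference of squares factors into a difference of lengths of order N^α and a sum of lengths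
of order N. -/
lemma abs_freqSq_sub_le {N α : ℝ} (hN : 1 ≤ N) (hα : α ≤ 1) {κ ξ : Freq d₁ d₂}
    (h : ‖freqEmb ξ - N • freqEmb κ‖ ≤ (1 + d₂) * (N ^ α / 2)) :
    |freqSq ξ - N ^ 2 * freqSq κ| ≤
      ((2 * ‖freqEmb κ‖ + (1 + d₂)) * (1 + d₂)) * N ^ (1 + α) := by
  have hN0 : 0 < N := by linarith
  set x := N • freqEmb κ with hx
  have hxn : ‖x‖ = N * ‖freqEmb κ‖ := by rw [hx, norm_smul, Real.norm_of_nonneg hN0.le]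
  have e : freqSq ξ - N ^ 2 * freqSq κ = (‖freqEmb ξ‖ - ‖x‖) * (‖freqEmb ξ‖ + ‖x‖) := by
    rw [← norm_freqEmb_sq, ← norm_freqEmb_sq, hxn]; ring
  have h1 : |‖freqEmb ξ‖ - ‖x‖| ≤ (1 + d₂) * (N ^ α / 2) := (abs_norm_sub_norm_le _ _).trans h
  have h2 : N ^ α ≤ N := by
    calc N ^ α ≤ N ^ (1 : ℝ) := Real.rpow_le_rpow_of_exponent_le hN hα
      _ = N := Real.rpow_one N
  have h3 : ‖freqEmb ξ‖ + ‖x‖ ≤ (2 * ‖freqEmb κ‖ + (1 + d₂)) * N := by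
    have h4 := (abs_le.1 h1).2
    have h5 : (1 + d₂ : ℝ) * (N ^ α / 2) ≤ (1 + d₂) * N := by gcongr; linarith
    rw [hxn] at h4 ⊢
    linarith
  rw [e, abs_mul, abs_of_nonneg (by positivity : 0 ≤ ‖freqEmb ξ‖ + ‖x‖)]
  calc |‖freqEmb ξ‖ - ‖x‖| * (‖freqEmb ξ‖ + ‖x‖)
      ≤ ((1 + d₂) * (N ^ α / 2)) * ((2 * ‖freqEmb κ‖ + (1 + d₂)) * N) := by gcongr
    _ ≤ ((1 + d₂) * N ^ α) * ((2 * ‖freqEmb κ‖ + (1 + d₂)) * N) := by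
        gcongr
        have : 0 ≤ N ^ α := by positivity
        linarith
    _ = _ := by rw [Real.rpow_add hN0, Real.rpow_one]; ring

/-- The dispersion relation near a dilated configuration. -/
lemma exists_dispersion_bound {ι : Type} [Fintype ι] {κ : ι → Freq d₁ d₂} {c : ι → ℤ} {α : ℝ}
    (hα : α ≤ 1) (hc : ∀ i, freqSq (κ i) = c i) :
    ∃ C : ℝ, 0 ≤ C ∧ ∀ᶠ N : ℕ in atTop, ∀ i, ∀ ξ ∈ closedBall (N • κ i) ((N : ℝ) ^ α / 2),
      |freqSq ξ - (N : ℝ) ^ 2 * c i| ≤ C * (N : ℝ) ^ (1 + α) := by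
  refine ⟨∑ i, (2 * ‖freqEmb (κ i)‖ + (1 + d₂)) * (1 + d₂), by positivity, ?_⟩
  filter_upwards [eventually_ge_atTop 1] with N hN i ξ hξ
  have h1 := norm_freqEmb_sub_le hξ
  rw [freqEmb_nsmul] at h1
  rw [← hc]
  refine (abs_freqSq_sub_le (by exact_mod_cast hN) hα h1).trans ?_
  gcongr
  exact Finset.single_le_sum (f := fun i => (2 * ‖freqEmb (κ i)‖ + (1 + d₂)) * (1 + d₂))
    (fun i _ => by positivity) (Finset.mem_univ i)

/-- The dispersion relation on balls of radius less than `1` around integral points. -/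
lemma abs_freqSq_sub_le_of_integral {κ ξ : Freq d₁ d₂} {N : ℕ} (hκ : κ.2 = 0)
    (h : ξ ∈ closedBall (N • κ) (1 / 2)) : |freqSq ξ - (N : ℝ) ^ 2 * freqSq κ| ≤ 1 := by
  rw [← closedBall_prod_same, mem_prod, Prod.smul_snd, hκ, smul_zero, mem_closedBall,
    mem_closedBall, dist_zero_right, Prod.smul_fst] at h
  have h1 : ∀ j, ξ.1 j = N * κ.1 j := fun j => by
    have h2 := (dist_le_pi_dist ξ.1 (N • κ.1) j).trans h.1
    rw [Int.dist_eq] at h2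
    have h3 : |ξ.1 j - N * κ.1 j| < 1 := by
      have h4 : (|ξ.1 j - N * κ.1 j| : ℝ) < 1 := by
        refine lt_of_le_of_lt ?_ (by norm_num : (1 / 2 : ℝ) < 1)
        simpa using h2
      exact_mod_cast h4
    have h5 := Int.abs_lt_one_iff.1 h3
    lia
  have e : freqSq ξ - (N : ℝ) ^ 2 * freqSq κ = ‖ξ.2‖ ^ 2 := by
    simp only [freqSq, hκ, norm_zero, h1]
    push_cast
    simp only [mul_pow, ← Finset.mul_sum]
    ring
  rw [e, abs_of_nonneg (by positivity)]
  have := norm_nonneg ξ.2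
  nlinarith [h.2]

/-- The unit coordinate vectors of the dual group. -/
def coordFreq : Fin d₁ ⊕ Fin d₂ → Freq d₁ d₂ :=
  Sum.elim (fun i => (0, EuclideanSpace.single i 1)) fun j => (Pi.single j 1, 0)

lemma freqEmb_coordFreq (i : Fin d₁ ⊕ Fin d₂) :
    freqEmb (coordFreq i) = EuclideanSpace.single i 1 := by
  refine PiLp.ext fun l => ?_
  rcases i with i | i <;> rcases l with l | l <;>
    simp [coordFreq, freqEmb_inl, freqEmb_inr, Pi.single_apply]

lemma freqSq_nsmul_coordFreq (n : ℕ) (i : Fin d₁ ⊕ Fin d₂) :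
    freqSq (n • coordFreq i) = (n : ℝ) ^ 2 := by
  rw [← norm_freqEmb_sq, freqEmb_nsmul, freqEmb_coordFreq, norm_smul]
  simp

lemma freqSq_coordFreq (i : Fin d₁ ⊕ Fin d₂) : freqSq (coordFreq i) = 1 := by
  have := freqSq_nsmul_coordFreq 1 i
  simpa using this

lemma freqSq_coordFreq_add {i j : Fin d₁ ⊕ Fin d₂} (h : i ≠ j) :
    freqSq (coordFreq i + coordFreq j) = 2 := by
  have h1 : ⟪(EuclideanSpace.single i 1 : NLSCover d₁ d₂), EuclideanSpace.single j 1⟫ = 0 := by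
    simp [EuclideanSpace.inner_single_left, h]
  rw [← norm_freqEmb_sq, freqEmb_add, freqEmb_coordFreq, freqEmb_coordFreq, norm_add_sq_real, h1]
  norm_num

/-- Three vertices of a square, the fourth being the origin. -/
def squareConfig (i j : Fin d₁ ⊕ Fin d₂) : Fin 3 → Freq d₁ d₂ :=
  ![coordFreq i, coordFreq j, coordFreq i + coordFreq j]

/-- The alternating sum e_i - (e_i + e_j) + e_j vanishes, and so does 1 - 2 + 1 for the assigned
squared lengths. -/
lemma isResonantSum_squareConfig (i j : Fin d₁ ⊕ Fin d₂) :
    IsResonantSum (squareConfig i j) ![1, 1, 2] 1 0 0 := by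
  have h := IsResonantSum.step (p := squareConfig i j) (c := ![1, 1, 2]) 0 2 (.base 1)
  simpa [squareConfig] using h

lemma freqSq_squareConfig {i j : Fin d₁ ⊕ Fin d₂} (h : i ≠ j) (l : Fin 3) :
    freqSq (squareConfig i j l) = (![1, 1, 2] : Fin 3 → ℤ) l := by
  fin_cases l
  · simpa [squareConfig] using freqSq_coordFreq i
  · simpa [squareConfig] using freqSq_coordFreq j
  · simpa [squareConfig] using freqSq_coordFreq_add h

/-- The collinear frequencies with the resonance `1 + 1 + 4 = 3 + 3`, `1 + 1 + 16 = 9 + 9`. -/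
def lineConfig (i : Fin d₁ ⊕ Fin d₂) : Fin 3 → Freq d₁ d₂ :=
  ![1 • coordFreq i, 3 • coordFreq i, 4 • coordFreq i]

/-- For `k = 2` the sum is 1 - 3 + 1 - 3 + 4, with squares 1 - 9 + 1 - 9 + 16. For larger `k`
trivial differences of a frequency with itself are added. -/
lemma isResonantSum_lineConfig (i : Fin d₁ ⊕ Fin d₂) {k : ℕ} (hk : 2 ≤ k) :
    IsResonantSum (lineConfig i) ![1, 9, 16] k 0 0 := by
  induction k, hk using Nat.le_induction with
  | base =>
    have h := IsResonantSum.step (p := lineConfig i) (c := ![1, 9, 16]) 0 1 (.step 0 1 (.base 2))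
    have e : lineConfig i 0 - lineConfig i 1 + (lineConfig i 0 - lineConfig i 1 + lineConfig i 2) =
        (0 : Freq d₁ d₂) := by
      show 1 • coordFreq i - 3 • coordFreq i + (1 • coordFreq i - 3 • coordFreq i +
        4 • coordFreq i) = _
      abel
    rw [e] at h
    exact h
  | succ k hk ih =>
    have h := IsResonantSum.step (p := lineConfig i) (c := ![1, 9, 16]) 0 0 ih
    simpa using h

lemma freqSq_lineConfig (i : Fin d₁ ⊕ Fin d₂) (l : Fin 3) :
    freqSq (lineConfig i l) = (![1, 9, 16] : Fin 3 → ℤ) l := by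
  fin_cases l
  · simpa [lineConfig] using freqSq_nsmul_coordFreq 1 i
  · refine (freqSq_nsmul_coordFreq 3 i).trans ?_
    norm_num
  · refine (freqSq_nsmul_coordFreq 4 i).trans ?_
    norm_num

end Cases

/-! ### Choice of exponents in each case. -/

section Inflation

open WeightedL1 Metric

variable {d₁ d₂ k : ℕ} {ε s : ℝ}

/-- The one-dimensional cubic equation. -/
lemma hasInfiniteLossInflation_cubic_line (hε : |ε| = 1) (hd : d₁ + d₂ = 1) (hs : s < -2 / 3) :
    HasInfiniteLossInflation d₁ d₂ 1 ε s := by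
  obtain ⟨i⟩ : Nonempty (Fin d₁ ⊕ Fin d₂) := by
    rw [← Fintype.card_pos_iff, Fintype.card_sum, Fintype.card_fin, Fintype.card_fin]
    lia
  set κ : Fin 2 → Freq d₁ d₂ := ![1 • coordFreq i, 2 • coordFreq i] with hκ
  have hκn : ∀ l, 1 ≤ ‖freqEmb (κ l)‖ := fun l => by
    fin_cases l <;> simp [hκ, freqEmb_add, two_nsmul, freqEmb_coordFreq, ← two_smul ℝ, norm_smul]
  -- Only the frequencies cancel, 1 - 2 + 1 = 0; the squared lengths 1, 4 do not. All bumps are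
  -- therefore assigned mode zero, and the whole of |ξ|², of order N², counts as error.
  have hres : IsResonantSum κ (fun _ => 0) 1 0 0 := by
    have h := IsResonantSum.step (p := κ) (c := fun _ => 0) 0 1 (.base 0)
    have e : κ 0 - κ 1 + κ 0 = 0 := by
      show 1 • coordFreq i - 2 • coordFreq i + 1 • coordFreq i = _
      abel
    rw [e] at h
    exact h
  obtain ⟨c, hc⟩ : ∃ c : Fin 2 → ℤ, ∀ l, freqSq (κ l) = c l :=
    ⟨![1, 4], fun l => by
      fin_cases l
      · simpa [hκ] using freqSq_nsmul_coordFreq 1 i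
      · refine (freqSq_nsmul_coordFreq 2 i).trans ?_
        norm_num⟩
  obtain ⟨C, hC, hE⟩ := exists_dispersion_bound (α := 5 / 6) (by norm_num) hc
  have hρ := eventually_all.2 fun l => eventually_le_norm_freqEmb (α := 5 / 6) (by norm_num) (hκn l)
  set S : ℝ := C + ∑ l, |(c l : ℝ)| with hS
  -- The time N^{-13/6} beats the error N². With α = 5/6 one has α < t/2 = 13/12 and t/2 - α/2 =
  -- 2/3, the threshold. The period is `T` itself, as no nonzero mode has to be matched.
  refine hasInfiniteLossInflation_of_rpow hε (by linarith) one_ne_zero (p := fun N l => N • κ l)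
    (c := fun _ => 0) (a := 1) (b := 1) (T := fun N => (N : ℝ) ^ (-(13 / 6) : ℝ)) one_pos (C := S)
    (α := 5 / 6) (e := 2) (t := 13 / 6) ?_ (Eventually.of_forall fun N => by simp) (by norm_num)
    (by norm_num) (by rw [hd]; norm_num) (by rw [hd]; push_cast; linarith)
  filter_upwards [hρ, hE, eventually_ge_atTop 2] with N hρ hE hN
  have hN2 : (2 : ℝ) ≤ N := by exact_mod_cast hN
  have hT : 0 < (N : ℝ) ^ (-(13 / 6) : ℝ) := by positivity
  refine ⟨?_, by positivity, hT, by linarith, hρ, ?_,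
    2 * Real.pi / (N : ℝ) ^ (-(13 / 6) : ℝ), 1, one_ne_zero, ?_, fun l ξ hξ => ?_⟩
  · have : (1 : ℝ) ≤ (N : ℝ) ^ (5 / 6 : ℝ) := Real.one_le_rpow (by linarith) (by norm_num)
    linarith
  · have := hres.map (nsmulAddMonoidHom N)
    simpa using this
  · rw [div_mul_cancel₀ _ hT.ne', Int.cast_one, mul_one]
  · have h1 := hE l ξ hξ
    have h2 : (N : ℝ) ^ (1 + 5 / 6 : ℝ) ≤ (N : ℝ) ^ 2 := by
      rw [← Real.rpow_two]
      exact Real.rpow_le_rpow_of_exponent_le (by linarith) (by norm_num)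
    have h3 : |(c l : ℝ)| ≤ ∑ l, |(c l : ℝ)| :=
      Finset.single_le_sum (f := fun l => |(c l : ℝ)|) (fun l _ => abs_nonneg _) (Finset.mem_univ l)
    rw [Int.cast_zero, mul_zero, sub_zero, Real.rpow_two]
    calc |freqSq ξ| = |(freqSq ξ - (N : ℝ) ^ 2 * c l) + (N : ℝ) ^ 2 * c l| := by
          rw [sub_add_cancel]
      _ ≤ C * (N : ℝ) ^ (1 + 5 / 6 : ℝ) + (N : ℝ) ^ 2 * |(c l : ℝ)| := by
          refine (abs_add_le _ _).trans (add_le_add h1 (le_of_eq ?_))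
          rw [abs_mul, abs_of_nonneg (by positivity : 0 ≤ (N : ℝ) ^ 2)]
      _ ≤ C * (N : ℝ) ^ 2 + (N : ℝ) ^ 2 * ∑ l, |(c l : ℝ)| := by gcongr
      _ = S * (N : ℝ) ^ 2 := by rw [hS]; ring

/-- The cubic equation in dimension at least two. -/
lemma hasInfiniteLossInflation_cubic (hε : |ε| = 1) (hd : 2 ≤ d₁ + d₂) (hs : s < -1 / 3) :
    HasInfiniteLossInflation d₁ d₂ 1 ε s := by
  have hcard : 1 < Fintype.card (Fin d₁ ⊕ Fin d₂) := by simpa using (by lia : 1 < d₁ + d₂)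
  obtain ⟨i, j, hij⟩ := Fintype.one_lt_card_iff.1 hcard
  have hc := freqSq_squareConfig hij
  obtain ⟨D, hD⟩ : ∃ D : ℝ, ((d₁ + d₂ : ℕ) : ℝ) = D := ⟨_, rfl⟩
  have hD2 : 2 ≤ D := by rw [← hD]; exact_mod_cast hd
  have hα : 2 / (3 * D) ≤ 1 / 3 := by
    rw [div_le_div_iff₀ (by linarith) (by norm_num)]
    linarith
  have hαD : 2 / (3 * D) * D = 2 / 3 := by field_simp
  obtain ⟨C, hC, hE⟩ := exists_dispersion_bound (α := 2 / (3 * D)) (by linarith) hc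
  -- With αD = 2/3 and t = 4/3 + τ, the error exponent 1 + α is at most 4/3 < t, αD is below t/2,
  -- and t/2 - αD/2 = 1/3 + τ/2 stays below -s.
  obtain ⟨τ, hτ0, hτ1, hτ2⟩ : ∃ τ : ℝ, 0 < τ ∧ τ ≤ 1 / 3 ∧ τ ≤ -1 / 3 - s :=
    ⟨min (1 / 3) (-1 / 3 - s), lt_min (by norm_num) (by linarith), min_le_left _ _,
      min_le_right _ _⟩
  refine hasInfiniteLossInflation_of_config hε (by linarith) one_ne_zero hc (fun l => ?_)
    (isResonantSum_squareConfig i j) hC (by linarith) (by positivity) hE (t := 4 / 3 + τ)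
    (by linarith) (by linarith) (by linarith) ?_ ?_
  · fin_cases l <;> simp
  · rw [hD, hαD]
    push_cast
    linarith
  · rw [hD, hαD]
    push_cast
    linarith

/-- The equation of higher order. -/
lemma hasInfiniteLossInflation_higher (hε : |ε| = 1) (hd : 1 ≤ d₁ + d₂) (hk : 2 ≤ k)
    (hs : s < -1 / (2 * (k : ℝ) + 1)) : HasInfiniteLossInflation d₁ d₂ k ε s := by
  obtain ⟨i⟩ : Nonempty (Fin d₁ ⊕ Fin d₂) := by
    rw [← Fintype.card_pos_iff, Fintype.card_sum, Fintype.card_fin, Fintype.card_fin]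
    lia
  have hc := freqSq_lineConfig i
  obtain ⟨D, hD⟩ : ∃ D : ℝ, ((d₁ + d₂ : ℕ) : ℝ) = D := ⟨_, rfl⟩
  have hD1 : 1 ≤ D := by rw [← hD]; exact_mod_cast hd
  have hk2 : (2 : ℝ) ≤ k := by exact_mod_cast hk
  -- With αD = 3w/2 and t = 7kw/2 one gets t/(2k) = 7w/4 > αD and t/(2k) - αD/2 = w, the threshold.
  -- Since kw = (1 - w)/2, the condition 1 + α < t follows from w ≤ 1/5.
  obtain ⟨w, hw⟩ : ∃ w : ℝ, w = 1 / (2 * (k : ℝ) + 1) := ⟨_, rfl⟩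
  have hw0 : 0 < w := by rw [hw]; positivity
  have hwk : w * (2 * k + 1) = 1 := by rw [hw]; field_simp
  have hw5 : w ≤ 1 / 5 := by
    rw [hw]
    exact one_div_le_one_div_of_le (by norm_num) (by linarith)
  have hs' : s < -w := by rwa [hw, ← neg_div]
  have hα : 3 / 2 * w / D ≤ 3 / 2 * w := div_le_self (by positivity) hD1
  have hαD : 3 / 2 * w / D * D = 3 / 2 * w := by field_simp
  obtain ⟨C, hC, hE⟩ := exists_dispersion_bound (α := 3 / 2 * w / D) (by linarith) hc
  have htk : 7 / 2 * (k * w) / (2 * k) = 7 / 4 * w := by field_simp; norm_num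
  have hkw : k * w = (1 - w) / 2 := by linarith
  refine hasInfiniteLossInflation_of_config hε (by linarith) (by lia) hc (fun l => ?_)
    (isResonantSum_lineConfig i hk) hC (by linarith) (by positivity) hE (t := 7 / 2 * (k * w))
    (by positivity) (by linarith) ?_ ?_ ?_
  · fin_cases l <;> simp
  · linarith
  · rw [hD, hαD, htk]
    linarith
  · rw [hD, hαD, htk]
    linarith

/-- Resonant configurations in periodic directions. -/
lemma hasInfiniteLossInflation_of_integral (hε : |ε| = 1) (hs : s < 0) (hk : k ≠ 0)
    {κ : Fin 3 → Freq d₁ d₂} {c : Fin 3 → ℤ} (hκ : ∀ l, (κ l).2 = 0)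
    (hc : ∀ l, freqSq (κ l) = c l) (hc1 : ∀ l, 1 ≤ c l) (hres : IsResonantSum κ c k 0 0) :
    HasInfiniteLossInflation d₁ d₂ k ε s := by
  have hk0 : (0 : ℝ) < k := by exact_mod_cast Nat.pos_of_ne_zero hk
  -- With α = 0 the error stays bounded, so any small t > 0 is admissible; t ≤ -ks makes t/(2k) at
  -- most half of -s.
  obtain ⟨t, ht0, ht1, hts⟩ : ∃ t : ℝ, 0 < t ∧ t ≤ 1 ∧ t ≤ -(k * s) :=
    ⟨min 1 (-(k * s)), lt_min one_pos (by nlinarith), min_le_left _ _, min_le_right _ _⟩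
  refine hasInfiniteLossInflation_of_config hε hs hk hc hc1 hres (C := 1) (α := 0) (e := 0)
    (t := t) zero_le_one one_pos le_rfl (Eventually.of_forall fun N l ξ hξ => ?_) ht0
    (by linarith) ht0 ?_ ?_
  · rw [Real.rpow_zero] at hξ ⊢
    rw [one_mul, ← hc]
    exact abs_freqSq_sub_le_of_integral (hκ l) hξ
  · rw [zero_mul]
    positivity
  · have : t / (2 * k) ≤ -s / 2 := by
      rw [div_le_div_iff₀ (by positivity) two_pos]
      linarith
    linarith

/-- The cubic equation with at least two periodic directions. -/
lemma hasInfiniteLossInflation_cubic_periodic (hε : |ε| = 1) (hd : 2 ≤ d₂) (hs : s < 0) :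
    HasInfiniteLossInflation d₁ d₂ 1 ε s := by
  have hcard : 1 < Fintype.card (Fin d₂) := by simpa using (by lia : 1 < d₂)
  obtain ⟨i, j, hij⟩ := Fintype.one_lt_card_iff.1 hcard
  refine hasInfiniteLossInflation_of_integral hε hs one_ne_zero (fun l => ?_)
    (freqSq_squareConfig (i := Sum.inr i) (j := Sum.inr j) (by simpa using hij)) (fun l => ?_)
    (isResonantSum_squareConfig _ _)
  · fin_cases l <;> simp [squareConfig, coordFreq]
  · fin_cases l <;> simp

/-- The equation of higher order with a periodic direction. -/
lemma hasInfiniteLossInflation_higher_periodic (hε : |ε| = 1) (hd : 1 ≤ d₂) (hk : 2 ≤ k)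
    (hs : s < 0) : HasInfiniteLossInflation d₁ d₂ k ε s := by
  refine hasInfiniteLossInflation_of_integral hε hs (by lia) (fun l => ?_)
    (freqSq_lineConfig (Sum.inr ⟨0, hd⟩)) (fun l => ?_) (isResonantSum_lineConfig _ hk)
  · fin_cases l <;> simp [lineConfig, coordFreq]
  · fin_cases l <;> simp

theorem hasInfiniteLossInflation_of_lt_threshold {d : ℕ} (hε : |ε| = 1) (hd : d₁ + d₂ = d)
    (hd1 : 1 ≤ d) (hk : 1 ≤ k) (hs : s < inflationThreshold d d₂ k) :
    HasInfiniteLossInflation d₁ d₂ k ε s := by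
  unfold inflationThreshold at hs
  split_ifs at hs with h1 h2 h3
  · obtain ⟨rfl, rfl⟩ := h1
    exact hasInfiniteLossInflation_cubic_line hε hd hs
  · obtain ⟨h2, rfl, -⟩ := h2
    exact hasInfiniteLossInflation_cubic hε (by lia) hs
  · exact hasInfiniteLossInflation_higher hε (by lia) h3.1 hs
  -- The excluded cases leave either the cubic equation with at least two periodic directions, or a
  -- higher power with at least one.
  · rcases hk.eq_or_lt with rfl | hk
    · exact hasInfiniteLossInflation_cubic_periodic hε (by lia) hs
    · exact hasInfiniteLossInflation_higher_periodic hε (by lia) hk hs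

end Inflation

end

theorem propositionA1 (d d₂ ν : ℕ) (hd : 1 ≤ d) (hd₂ : d₂ ≤ d) (hν : 1 ≤ ν)
    (ε : ℝ) (hε : ε = 1 ∨ ε = -1) (s : ℝ) (hs : s < inflationThreshold d d₂ ν)
    (δ : ℝ) (hδ : 0 < δ) :
    ∃ (φ : NLSCover (d - d₂) d₂ → ℂ) (T : ℝ) (u : ℝ → NLSCover (d - d₂) d₂ → ℂ),
      MemHInfty φ ∧ sobolevNorm s φ < ENNReal.ofReal δ ∧ 0 < T ∧ T < δ ∧
      IsSmoothNLSSolution ν ε T φ u ∧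
      (∀ v : ℝ → NLSCover (d - d₂) d₂ → ℂ, IsSmoothNLSSolution ν ε T φ v →
        ∀ t ∈ Set.Icc 0 T, v t = u t) ∧
      lowFreqNorm (u T) > ENNReal.ofReal δ⁻¹ ∧
      ∀ σ : ℝ, sobolevNorm σ (u T) > ENNReal.ofReal δ⁻¹ := by
  have hε' : |ε| = 1 := by rcases hε with rfl | rfl <;> simp
  obtain ⟨φ, T, u, hφ, hφs, hT, hTδ, hu, hlow⟩ :=
    hasInfiniteLossInflation_of_lt_threshold hε' (Nat.sub_add_cancel hd₂) hd hν hs δ hδ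
  exact ⟨φ, T, u, hφ, hφs, hT, hTδ, hu, fun v hv t ht => hu.unique hε' hv ht, hlow,
    fun σ => hlow.trans_le (lowFreqNorm_le_sobolevNorm σ _)⟩
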